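/- Let $(Y,\omega)$ be a pre-symplectic manifold, i.e. $Y$ is a finite-dimensional smooth manifold and $\omega$ is a smooth closed $2$-form on $Y$ of constant rank $2k$. Let $E=T\mathcal F=\ker\omega\subset TY$ be the tangent bundle of its null foliation $\mathcal F$, let $N\mathcal F=TY/T\mathcal F$, and let $\Pi:TY=G\oplus T\mathcal F$ be a smooth splitting, identified with the projection $\Pi:TY\to T\mathcal F$ with kernel $G$. Its transverse curvature is $F_\Pi(\eta_1,\eta_2)=\Pi([X_1,X_2])$ for sections $\eta_1,\eta_2$ of $N\mathcal F$, where $X_i$ is the section of $G$ that lifts $\eta_i$. Let $\Omega^j(\mathcal F)=\Gamma(\Lambda^jE^*)$ be the leafwise $j$-forms and $d_{\mathcal F}:\Omega^j(\mathcal F)\to\Omega^{j+1}(\mathcal F)$ the exterior derivative along the leaves. For $X\in\Gamma(G)$ and $\xi\in\Omega^j(\mathcal F)$ let $\nabla_X\xi\in\Omega^j(\mathcal F)$ be the covariant derivative defined by the splitting, $$(\nabla_X\xi)(W_1,\dots,W_j)=X\bigl(\xi(W_1,\dots,W_j)\bigr)-\sum_{i}\xi\bigl(W_1,\dots,\Pi[X,W_i],\dots,W_j\bigr),\qquad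 W_i\in\Gamma(E).$$ Define the bracket $\{\cdot,\cdot\}_\Pi:\Omega^{i}(\mathcal F)\times\Omega^{j}(\mathcal F)\to\Omega^{i+j}(\mathcal F)$ by $$\{\xi_1,\xi_2\}_\Pi=\tfrac12\sum_{a,b}\omega^{ab}\,\nabla_{e_a}\xi_1\wedge\nabla_{e_b}\xi_2,$$ where $(e_a)$ is any local frame of $G$ and $(\omega^{ab})$ is the inverse of the matrix $\omega_{ab}=\omega(e_a,e_b)$. Theorem. If $F_\Pi\equiv0$, then $\bigl(\bigoplus_{j}\Omega^j(\mathcal F),\,d_{\mathcal F},\,\{\cdot,\cdot\}_\Pi\bigr)$ is a differential graded Lie algebra over $\mathbb R$: $d_{\mathcal F}$ is linear of degree $1$ with $d_{\mathcal F}^2=0$; the bracket is bilinear of degree $0$, with $$\{\xi_1,\xi_2\}_\Pi=-(-1)^{|\xi_1||\xi_2|}\{\xi_2,\xi_1\}_\Pi,$$ $$\{\xi_1,\{\xi_2,\xi_3\}_\Pi\}_\Pi=\{\{\xi_1,\xi_2\}_\Pi,\xi_3\}_\Pi+(-1)^{|\xi_1||\xi_2|}\{\xi_2,\{\xi_1,\xi_3\}_\Pi\}_\Pi;$$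 and $d_{\mathcal F}$ is a graded derivation of the bracket, $$d_{\mathcal F}\{\xi_1,\xi_2\}_\Pi=\{d_{\mathcal F}\xi_1,\xi_2\}_\Pi+(-1)^{|\xi_1|}\{\xi_1,d_{\mathcal F}\xi_2\}_\Pi .$$ -/

import Mathlib

open scoped Manifold ContDiff Topology

noncomputable section

namespace PreSymp

/-! ### Linear algebra -/

/-- A multilinear form on a finite-dimensional Hausdorff topological vector space is continuous. -/
theorem continuous_alternating {W : Type*} [AddCommGroup W] [Module ℝ W] [TopologicalSpace W]
    [IsTopologicalAddGroup W] [ContinuousSMul ℝ W] [T2Space W] [FiniteDimensional ℝ W] {n : ℕ}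
    (f : W [⋀^Fin n]→ₗ[ℝ] ℝ) : Continuous f := by
  let b := Module.finBasis ℝ W
  have key : (f : (Fin n → W) → ℝ) = fun v =>
      ∑ r : Fin n → Fin (Module.finrank ℝ W),
        (∏ i, b.repr (v i) (r i)) * f (fun i => b (r i)) := by
    funext v
    have hv : v = fun i => ∑ k, b.repr (v i) k • b k := by
      funext i
      exact (b.sum_repr (v i)).symm
    calc f v = f.toMultilinearMap (fun i => ∑ k, b.repr (v i) k • b k) := by
          rw [← hv]; rfl
      _ = _ := by
          rw [MultilinearMap.map_sum]
          refine Finset.sum_congr rfl fun r _ => ?_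
          rw [MultilinearMap.map_smul_univ]
          rfl
  rw [key]
  refine continuous_finsetSum _ fun r _ => Continuous.mul ?_ continuous_const
  refine continuous_finsetProd _ fun i _ => ?_
  exact (LinearMap.continuous_of_finiteDimensional (b.coord (r i))).comp (continuous_apply i)

/-- An alternating form on a finite-dimensional space, as a continuous alternating form. -/
def toContinuousForm {W : Type*} [AddCommGroup W] [Module ℝ W] [TopologicalSpace W]
    [IsTopologicalAddGroup W] [ContinuousSMul ℝ W] [T2Space W] [FiniteDimensional ℝ W] {n : ℕ}
    (f : W [⋀^Fin n]→ₗ[ℝ] ℝ) : W [⋀^Fin n]→L[ℝ] ℝ :=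
  { f with cont := continuous_alternating f }

/-- The wedge product of alternating forms,
`(a ∧ b)(v₁, …, v_{p+q}) = ∑ sign(σ) a(v_{σ1}, …, v_{σp}) b(v_{σ(p+1)}, …, v_{σ(p+q)})`,
the sum being over `(p, q)`-shuffles. -/
def wedge {W : Type*} [AddCommGroup W] [Module ℝ W] {p q : ℕ}
    (a : W [⋀^Fin p]→ₗ[ℝ] ℝ) (b : W [⋀^Fin q]→ₗ[ℝ] ℝ) : W [⋀^Fin (p + q)]→ₗ[ℝ] ℝ :=
  ((LinearMap.mul' ℝ ℝ).compAlternatingMap (a.domCoprod b)).domDomCongr finSumFinEquiv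

/-! ### Differential graded Lie algebras -/

/-- Let `M` be a graded real vector space (`M j` in degree `j`), `L` a graded subspace,
`d` a map of degree `1` and `br` a binary operation of degree `0` on `M`.  This says that
`d` and `br` restrict to `L` and make `L` a differential graded Lie algebra.  Identities between
homogeneous elements are written in the direct sum of all the `M j`. -/
structure IsDGLieAlgebra {M : ℕ → Type*} [∀ j, AddCommGroup (M j)] [∀ j, Module ℝ (M j)]
    (L : ∀ j, Submodule ℝ (M j)) (d : ∀ j, M j → M (j + 1))
    (br : ∀ i j, M i → M j → M (i + j)) : Prop where
  d_mem : ∀ j, ∀ a ∈ L j, d j a ∈ L (j + 1)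
  d_add : ∀ j, ∀ a ∈ L j, ∀ b ∈ L j, d j (a + b) = d j a + d j b
  d_smul : ∀ j (r : ℝ), ∀ a ∈ L j, d j (r • a) = r • d j a
  d_d : ∀ j, ∀ a ∈ L j, d (j + 1) (d j a) = 0
  br_mem : ∀ i j, ∀ a ∈ L i, ∀ b ∈ L j, br i j a b ∈ L (i + j)
  br_add_left : ∀ i j, ∀ a ∈ L i, ∀ a' ∈ L i, ∀ b ∈ L j,
    br i j (a + a') b = br i j a b + br i j a' b
  br_add_right : ∀ i j, ∀ a ∈ L i, ∀ b ∈ L j, ∀ b' ∈ L j,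
    br i j a (b + b') = br i j a b + br i j a b'
  br_smul_left : ∀ i j (r : ℝ), ∀ a ∈ L i, ∀ b ∈ L j, br i j (r • a) b = r • br i j a b
  br_smul_right : ∀ i j (r : ℝ), ∀ a ∈ L i, ∀ b ∈ L j, br i j a (r • b) = r • br i j a b
  /-- `{a, b} = -(-1)^{|a||b|} {b, a}` -/
  br_symm : ∀ i j, ∀ a ∈ L i, ∀ b ∈ L j,
    DirectSum.of M (i + j) (br i j a b) =
      -((-1 : ℝ) ^ (i * j) • DirectSum.of M (j + i) (br j i b a))
  /-- `{a, {b, c}} = {{a, b}, c} + (-1)^{|a||b|} {b, {a, c}}` -/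
  jacobi : ∀ i j k, ∀ a ∈ L i, ∀ b ∈ L j, ∀ c ∈ L k,
    DirectSum.of M (i + (j + k)) (br i (j + k) a (br j k b c)) =
      DirectSum.of M (i + j + k) (br (i + j) k (br i j a b) c) +
        (-1 : ℝ) ^ (i * j) • DirectSum.of M (j + (i + k)) (br j (i + k) b (br i k a c))
  /-- `d {a, b} = {d a, b} + (-1)^{|a|} {a, d b}` -/
  leibniz : ∀ i j, ∀ a ∈ L i, ∀ b ∈ L j,
    DirectSum.of M (i + j + 1) (d (i + j) (br i j a b)) =
      DirectSum.of M (i + 1 + j) (br (i + 1) j (d i a) b) +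
        (-1 : ℝ) ^ i • DirectSum.of M (i + (j + 1)) (br i (j + 1) a (d j b))

/-! ### Differential forms on a manifold modelled on `V` -/

/-- The tangent space of a manifold modelled on `V`. -/
abbrev Tan (V : Type*) [NormedAddCommGroup V] [NormedSpace ℝ V] {Y : Type*} [TopologicalSpace Y]
    [ChartedSpace V Y] (y : Y) : Type _ :=
  TangentSpace 𝓘(ℝ, V) y

instance {V : Type*} [NormedAddCommGroup V] [NormedSpace ℝ V] [FiniteDimensional ℝ V]
    {Y : Type*} [TopologicalSpace Y] [ChartedSpace V Y] (y : Y) :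
    FiniteDimensional ℝ (TangentSpace 𝓘(ℝ, V) y) :=
  inferInstanceAs (FiniteDimensional ℝ V)

instance {V : Type*} [NormedAddCommGroup V] [NormedSpace ℝ V]
    {Y : Type*} [TopologicalSpace Y] [ChartedSpace V Y] (y : Y) :
    T2Space (TangentSpace 𝓘(ℝ, V) y) :=
  inferInstanceAs (T2Space V)

/-- Not necessarily smooth differential `n`-forms on `Y`. -/
abbrev FormField (V : Type*) [NormedAddCommGroup V] [NormedSpace ℝ V] (Y : Type*)
    [TopologicalSpace Y] [ChartedSpace V Y] (n : ℕ) : Type _ :=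
  (y : Y) → Tan V y [⋀^Fin n]→L[ℝ] ℝ

variable {V : Type*} [NormedAddCommGroup V] [NormedSpace ℝ V]
  {Y : Type*} [TopologicalSpace Y] [ChartedSpace V Y]

/-- Smoothness of a differential form, as a section of the bundle of alternating forms. -/
def FormField.IsSmooth [IsManifold 𝓘(ℝ, V) ∞ Y] {n : ℕ} (η : FormField V Y n) : Prop :=
  ContMDiff 𝓘(ℝ, V) (𝓘(ℝ, V).prod 𝓘(ℝ, V [⋀^Fin n]→L[ℝ] ℝ)) ∞
    (fun y => Bundle.TotalSpace.mk' (V [⋀^Fin n]→L[ℝ] ℝ)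
      (E := fun y : Y => Tan V y [⋀^Fin n]→L[ℝ] Bundle.Trivial Y ℝ y) y (η y))

/-- The expression of a form in the preferred chart at `x`, that is, its pull-back to `V` under the
inverse of the chart. -/
def FormField.inChart {n : ℕ} (η : FormField V Y n) (x : Y) (u : V) : V [⋀^Fin n]→L[ℝ] ℝ :=
  (η ((extChartAt 𝓘(ℝ, V) x).symm u)).compContinuousLinearMap
    (mfderiv 𝓘(ℝ, V) 𝓘(ℝ, V) (extChartAt 𝓘(ℝ, V) x).symm u ∘L
      ((NormedSpace.fromTangentSpace (𝕜 := ℝ) u).symm : V →L[ℝ] TangentSpace 𝓘(ℝ, V) u))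

/-- The exterior derivative of a differential form on `Y`, computed at `x` in the chart at `x`. -/
def FormField.d {n : ℕ} (η : FormField V Y n) : FormField V Y (n + 1) := fun x =>
  (extDeriv (η.inChart x) (extChartAt 𝓘(ℝ, V) x x)).compContinuousLinearMap
    ((NormedSpace.fromTangentSpace (𝕜 := ℝ) (extChartAt 𝓘(ℝ, V) x x) :
        TangentSpace 𝓘(ℝ, V) (extChartAt 𝓘(ℝ, V) x x) →L[ℝ] V) ∘L
      mfderiv 𝓘(ℝ, V) 𝓘(ℝ, V) (extChartAt 𝓘(ℝ, V) x) x)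

/-- The kernel `{v | om(v, ·) = 0}` of a `2`-form at a point. -/
def FormField.kernel (om : FormField V Y 2) (y : Y) : Submodule ℝ (Tan V y) :=
  LinearMap.ker (AlternatingMap.curryLeft (om y).toAlternatingMap)

/-- Pre-symplectic forms on `Y`: smooth closed `2`-forms of constant rank `2k`. -/
structure PreSymplecticForm (V : Type*) [NormedAddCommGroup V] [NormedSpace ℝ V]
    (Y : Type*) [TopologicalSpace Y] [ChartedSpace V Y] [IsManifold 𝓘(ℝ, V) ∞ Y] where
  form : FormField V Y 2
  smooth : form.IsSmooth
  closed : form.d = 0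
  k : ℕ
  rank_eq : ∀ y, Module.finrank ℝ (form.kernel y) + 2 * k = Module.finrank ℝ V

variable [IsManifold 𝓘(ℝ, V) ∞ Y]

/-- The tangent space `E_y = T_y𝓕` of the null foliation: the kernel of the pre-symplectic form. -/
abbrev PreSymplecticForm.E (om : PreSymplecticForm V Y) (y : Y) : Submodule ℝ (Tan V y) :=
  om.form.kernel y

/-! ### Leafwise forms -/

/-- Not necessarily smooth leafwise `j`-forms: sections of `Λ^j E*`. -/
abbrev LeafField (om : PreSymplecticForm V Y) (j : ℕ) : Type _ :=
  (y : Y) → om.E y [⋀^Fin j]→ₗ[ℝ] ℝ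

/-- The restriction of a differential form on `Y` to the leaves. -/
def FormField.toLeaf (om : PreSymplecticForm V Y) {j : ℕ} (η : FormField V Y j) : LeafField om j :=
  fun y => (η y).toAlternatingMap.compLinearMap (om.E y).subtype

/-- `Ω^j(𝓕) = Γ(Λ^j E*)`, the smooth leafwise forms.  As `Λ^j E*` is a quotient bundle of
`Λ^j T*Y`, its smooth sections are the restrictions to `E` of the smooth `j`-forms on `Y`. -/
def leafwiseForms (om : PreSymplecticForm V Y) (j : ℕ) : Submodule ℝ (LeafField om j) where
  carrier := {ξ | ∃ η : FormField V Y j, η.IsSmooth ∧ η.toLeaf om = ξ}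
  zero_mem' := ⟨0, Bundle.contMDiff_zeroSection ℝ
    (fun y : Y => Tan V y [⋀^Fin j]→L[ℝ] Bundle.Trivial Y ℝ y), rfl⟩
  add_mem' := by
    rintro _ _ ⟨η, hη, rfl⟩ ⟨η', hη', rfl⟩
    exact ⟨η + η', ContMDiff.add_section (F := V [⋀^Fin j]→L[ℝ] ℝ)
      (V := fun y : Y => Tan V y [⋀^Fin j]→L[ℝ] Bundle.Trivial Y ℝ y) hη hη', rfl⟩
  smul_mem' := by
    rintro r _ ⟨η, hη, rfl⟩
    exact ⟨r • η, ContMDiff.const_smul_section (F := V [⋀^Fin j]→L[ℝ] ℝ)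
      (V := fun y : Y => Tan V y [⋀^Fin j]→L[ℝ] Bundle.Trivial Y ℝ y) hη, rfl⟩

/-! ### Splittings -/

/-- A splitting `TY = G ⊕ T𝓕`, given by the smooth projection `P` of `TY` onto `T𝓕` along
`G = ker P`. -/
structure Splitting (om : PreSymplecticForm V Y) where
  P : (y : Y) → Tan V y →L[ℝ] Tan V y
  smooth : ContMDiff 𝓘(ℝ, V) (𝓘(ℝ, V).prod 𝓘(ℝ, V →L[ℝ] V)) ∞
    (fun y => Bundle.TotalSpace.mk' (V →L[ℝ] V) (E := fun y : Y => Tan V y →L[ℝ] Tan V y) y (P y))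
  idem : ∀ y v, P y (P y v) = P y v
  range_eq : ∀ y, LinearMap.range (P y : Tan V y →ₗ[ℝ] Tan V y) = om.E y

namespace Splitting

variable {om : PreSymplecticForm V Y} (S : Splitting om)

/-- The complement `G_y = ker P_y` of `E_y`. -/
abbrev G (y : Y) : Submodule ℝ (Tan V y) :=
  LinearMap.ker (S.P y : Tan V y →ₗ[ℝ] Tan V y)

theorem apply_mem (y : Y) (v : Tan V y) : S.P y v ∈ om.E y := by
  rw [← S.range_eq y]
  exact ⟨v, rfl⟩

theorem apply_of_mem {y : Y} {v : Tan V y} (hv : v ∈ om.E y) : S.P y v = v := by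
  rw [← S.range_eq y] at hv
  obtain ⟨w, rfl⟩ := hv
  exact S.idem y w

/-- The projection `T_yY → E_y` along `G_y`. -/
def toE (y : Y) : Tan V y →ₗ[ℝ] om.E y :=
  (S.P y : Tan V y →ₗ[ℝ] Tan V y).codRestrict (om.E y) (S.apply_mem y)

/-- The inverse of the isomorphism `G_y → N_y𝓕 = T_yY / E_y` induced by the quotient map,
as a map into `T_yY`: the class of `v` goes to `v - P v`. -/
def lift (y : Y) : (Tan V y ⧸ om.E y) →ₗ[ℝ] Tan V y :=
  (om.E y).liftQ (LinearMap.id - (S.P y : Tan V y →ₗ[ℝ] Tan V y)) fun v hv => by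
    simp [S.apply_of_mem hv]

/-- The transverse curvature of the splitting on sections of the normal bundle `N𝓕`,
`F(η₁, η₂) = P [X₁, X₂]` with `Xᵢ` the section of `G` that lifts `ηᵢ`. -/
def curvature (η₁ η₂ : (y : Y) → Tan V y ⧸ om.E y) (y : Y) : om.E y :=
  S.toE y (VectorField.mlieBracket 𝓘(ℝ, V) (fun z => S.lift z (η₁ z)) (fun z => S.lift z (η₂ z)) y)

/-- Vanishing of the transverse curvature: `F(η₁, η₂)` vanishes at `y` for all sections `η₁`, `η₂`
of `N𝓕` that are smooth at `y` (that is, whose lifts to `G` are smooth there). -/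
def IsFlat : Prop :=
  ∀ (y : Y) (η₁ η₂ : (y : Y) → Tan V y ⧸ om.E y),
    ContMDiffAt 𝓘(ℝ, V) 𝓘(ℝ, V).tangent ∞
      (fun z => (⟨z, S.lift z (η₁ z)⟩ : TangentBundle 𝓘(ℝ, V) Y)) y →
    ContMDiffAt 𝓘(ℝ, V) 𝓘(ℝ, V).tangent ∞
      (fun z => (⟨z, S.lift z (η₂ z)⟩ : TangentBundle 𝓘(ℝ, V) Y)) y →
    S.curvature η₁ η₂ y = 0

variable [FiniteDimensional ℝ V]

/-- The extension of a leafwise form to a form on `Y` that vanishes when one argument lies in `G`: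
`(v₁, …, v_j) ↦ ξ(P v₁, …, P v_j)`. -/
def extend {j : ℕ} (ξ : LeafField om j) : FormField V Y j := fun y =>
  toContinuousForm ((ξ y).compLinearMap (S.toE y))

/-- The leafwise differential `d_𝓕`: the restriction to the leaves of the exterior derivative of an
extension to `Y`. -/
def leafD (j : ℕ) (ξ : LeafField om j) : LeafField om (j + 1) :=
  (S.extend ξ).d.toLeaf om

/-- The covariant derivative `∇_v ξ` of a leafwise form in a transverse direction `v ∈ G_y`, for the
connection on `E*` along `G` induced by the splitting.  It is the restriction to `E` of the Lie
derivative of `S.extend ξ` along any section `X` of `G` through `v`; as `ι_X (S.extend ξ) = 0`, by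
Cartan's formula this is `(d (S.extend ξ))(v, ·)`, that is,
`(∇_X ξ)(W₁, …, W_j) = X (ξ(W₁, …, W_j)) - ∑ i, ξ(W₁, …, P [X, W_i], …, W_j)`.
In foliation coordinates `(y, q)`, with `G` spanned by `Y_i = ∂/∂y^i + R_i^α ∂/∂q^α`, on `1`-forms
`(∇_{Y_i} ξ)_α = Y_i(ξ_α) + ξ_β ∂R_i^β/∂q^α`. -/
def nabla {j : ℕ} (ξ : LeafField om j) (y : Y) (v : S.G y) : om.E y [⋀^Fin j]→ₗ[ℝ] ℝ :=
  (AlternatingMap.curryLeft ((S.extend ξ).d y).toAlternatingMap (v : Tan V y)).compLinearMap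
    (om.E y).subtype

/-- The matrix `om_{ij} = om(e_i, e_j)` in a basis `e` of `G_y`. -/
def omegaMatrix (y : Y) {ι : Type*} (e : Module.Basis ι ℝ (S.G y)) : Matrix ι ι ℝ :=
  Matrix.of fun i j => om.form y ![(e i : Tan V y), (e j : Tan V y)]

/-- The bracket `{ξ₁, ξ₂} = ½ ∑_{i,j} om^{ij} ∇_i ξ₁ ∧ ∇_j ξ₂`, computed at each point `y` in a
basis `e` of `G_y` (on which it does not depend), where `(om^{ij})` is the inverse of the matrix
`om_{ij} = om(e_i, e_j)`. -/
def bracket (i j : ℕ) (ξ₁ : LeafField om i) (ξ₂ : LeafField om j) : LeafField om (i + j) := fun y =>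
  let e := Module.finBasis ℝ (S.G y)
  (1 / 2 : ℝ) • ∑ a, ∑ b, (S.omegaMatrix y e)⁻¹ a b •
    wedge (S.nabla ξ₁ y (e a)) (S.nabla ξ₂ y (e b))

end Splitting

end PreSymp

end

open scoped Manifold ContDiff Topology

noncomputable section

namespace PreSymp

set_option linter.unusedSectionVars false

section

/-! ### The signed shuffle algebra of functions on lists -/

/-! All the identities are local, and flatness says that `G` is involutive. Near any point `G`
therefore has a commuting frame `e a` (`exists_commuting_frame`), with a coframe `ε a` that is dual
to it and vanishes on the leaves. A leafwise form is the same thing as a horizontal form on `Y`,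
that is, one killed by every contraction with `e a` (`Hor`). On horizontal forms the covariant
derivative along `e a` is the Lie derivative `L a`, by Cartan's formula, and the leafwise
differential is `d - ∑ ε a ∧ L a`. The operators `L a` are derivations of the wedge product; on
alternating forms they commute with each other and with `d`. They fail to commute with the leafwise
differential only through `θ b a = L b (ε a)`: the commutator with `L b` is `∑ θ b a ∧ L a`
(`dF_L`).

Closedness of the form, which is `½ ∑ μ a b ε a ∧ ε b`, is used three times. It makes the kernel
involutive; this is the structure equation `d (ε a) = ∑ ε b ∧ θ b a` (`d_eps`), and it makes the
leafwise differential square to zero (`dF_dF`). Its component along `G` is a cyclic identity for the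
derivatives of `μ` (`Lf_μ`), equivalent to the Jacobi identity of the bivector `W = μ⁻¹`
(`poisson_jacobi`); as the `L a` commute, this yields the graded Jacobi identity (`jacobi_brk`). Its
mixed component expresses the leafwise differential of `μ`, hence of `W`, through `θ`
(`dF_const_W`), and these terms cancel the commutators in the Leibniz rule (`dF_brk`).

This computation is carried out for functions on lists of indices with values in a ring of smooth
functions, all degrees at once, so that no casts between degrees occur. An element is determined by
its value on the empty list and its contractions with the first index, and most identities follow by
induction on the list. The return to the manifold rests on `toListForm_wedge` for the wedge product,
`d_locForm` and `inChart_d` for the exterior derivative, `bracket_eq` for the independence of the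
bracket from the basis, and `exists_local_flatFrame`, which collects them. -/

/-- Functions on lists.  The value on `[k₁, …, k_n]` plays the role of the coefficient of a
differential form on the vectors with indices `k₁, …, k_n`. -/
def ListForm (κ R : Type*) := List κ → R

namespace ListForm

variable {κ ι R : Type*} [CommRing R]

instance : AddCommGroup (ListForm κ R) := inferInstanceAs (AddCommGroup (List κ → R))

instance : Module R (ListForm κ R) := inferInstanceAs (Module R (List κ → R))

@[ext] theorem ext {F G : ListForm κ R} (h : ∀ l, F l = G l) : F = G := funext h

@[simp] theorem add_apply (F G : ListForm κ R) (l : List κ) : (F + G) l = F l + G l := rfl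
@[simp] theorem sub_apply (F G : ListForm κ R) (l : List κ) : (F - G) l = F l - G l := rfl
@[simp] theorem neg_apply (F : ListForm κ R) (l : List κ) : (-F) l = -F l := rfl
@[simp] theorem zero_apply (l : List κ) : (0 : ListForm κ R) l = 0 := rfl
@[simp] theorem smul_apply (r : R) (F : ListForm κ R) (l : List κ) : (r • F) l = r * F l := rfl

theorem sum_apply {α : Type*} (s : Finset α) (F : α → ListForm κ R) (l : List κ) :
    (∑ a ∈ s, F a) l = ∑ a ∈ s, F a l :=
  Finset.sum_apply l s F

/-- Contraction with the `k`-th vector. -/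
def contr (k : κ) : ListForm κ R →ₗ[R] ListForm κ R where
  toFun F l := F (k :: l)
  map_add' _ _ := rfl
  map_smul' _ _ := rfl

/-- The grading involution. -/
def grade : ListForm κ R →ₗ[R] ListForm κ R where
  toFun F l := (-1) ^ l.length * F l
  map_add' _ _ := by ext l; exact mul_add _ _ _
  map_smul' r F := by ext l; exact mul_left_comm _ _ _

theorem contr_apply (k : κ) (F : ListForm κ R) (l : List κ) : contr k F l = F (k :: l) := rfl

theorem grade_apply (F : ListForm κ R) (l : List κ) : grade F l = (-1) ^ l.length * F l := rfl

theorem contr_grade (k : κ) (F : ListForm κ R) : contr k (grade F) = -grade (contr k F) := by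
  ext l
  simp [contr_apply, grade_apply, pow_succ]

theorem grade_grade (F : ListForm κ R) : grade (grade F) = F := by
  ext l
  simp [grade_apply, ← mul_assoc, ← mul_pow]

/-- The shuffle product. -/
def shuffle : List κ → ListForm κ R → ListForm κ R → R
  | [], F, G => F [] * G []
  | k :: l, F, G => shuffle l (contr k F) G + shuffle l (grade F) (contr k G)

instance : Mul (ListForm κ R) := ⟨fun F G l => shuffle l F G⟩

theorem mul_nil (F G : ListForm κ R) : (F * G) [] = F [] * G [] := rfl

theorem mul_cons (F G : ListForm κ R) (k : κ) (l : List κ) :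
    (F * G) (k :: l) = (contr k F * G) l + (grade F * contr k G) l := rfl

theorem contr_mul (k : κ) (F G : ListForm κ R) :
    contr k (F * G) = contr k F * G + grade F * contr k G := rfl

theorem ext_contr {F G : ListForm κ R} (h0 : F [] = G []) (h : ∀ k, contr k F = contr k G) :
    F = G := by
  ext l
  cases l with
  | nil => exact h0
  | cons k l => exact congrFun (h k) l

/-- The functions supported on the empty list. -/
def const (r : R) : ListForm κ R
  | [] => r
  | _ :: _ => 0

@[simp] theorem const_nil (r : R) : (const r : ListForm κ R) [] = r := rfl

@[simp] theorem contr_const (k : κ) (r : R) : contr k (const r : ListForm κ R) = 0 := rfl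

@[simp] theorem grade_const (r : R) : grade (const r : ListForm κ R) = const r := by
  ext l
  cases l <;> simp [grade_apply, const]

/-- The ring axioms are checked value by value, by induction on the list with the factors
generalised: contraction of a product yields products of contracted and graded factors, evaluated on
a shorter list. -/
theorem add_mul_aux (F G H : ListForm κ R) (l : List κ) :
    ((F + G) * H) l = (F * H) l + (G * H) l := by
  induction l generalizing F G H with
  | nil => simp [mul_nil, add_mul]
  | cons k l ih => simp only [mul_cons, map_add, ih]; ring

theorem mul_add_aux (F G H : ListForm κ R) (l : List κ) :
    (F * (G + H)) l = (F * G) l + (F * H) l := by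
  induction l generalizing F G H with
  | nil => simp [mul_nil, mul_add]
  | cons k l ih => simp only [mul_cons, map_add, ih]; ring

theorem smul_mul_aux (r : R) (F G : ListForm κ R) (l : List κ) :
    ((r • F) * G) l = r * (F * G) l := by
  induction l generalizing F G with
  | nil => simp [mul_nil, mul_assoc]
  | cons k l ih => simp only [mul_cons, map_smul, ih]; ring

theorem mul_smul_aux (r : R) (F G : ListForm κ R) (l : List κ) :
    (F * (r • G)) l = r * (F * G) l := by
  induction l generalizing F G with
  | nil => simp [mul_nil, mul_left_comm]
  | cons k l ih => simp only [mul_cons, map_smul, ih]; ring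

theorem neg_mul_aux (F G : ListForm κ R) (l : List κ) : ((-F) * G) l = -(F * G) l := by
  have h := smul_mul_aux (-1) F G l
  simpa using h

theorem const_mul (r : R) (G : ListForm κ R) : const r * G = r • G := by
  ext l
  have h0 : ∀ (l : List κ) (G : ListForm κ R), ((0 : ListForm κ R) * G) l = 0 := fun l G => by
    simpa using smul_mul_aux 0 (0 : ListForm κ R) G l
  induction l generalizing G with
  | nil => simp [mul_nil]
  | cons k l ih =>
    rw [mul_cons, grade_const, ih, contr_const, h0]
    simp [contr_apply]

theorem mul_const (r : R) (G : ListForm κ R) : G * const r = r • G := by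
  ext l
  have h0 : ∀ (l : List κ) (G : ListForm κ R), (G * (0 : ListForm κ R)) l = 0 := fun l G => by
    simpa using mul_smul_aux 0 G (0 : ListForm κ R) l
  induction l generalizing G with
  | nil => simp [mul_nil, mul_comm]
  | cons k l ih =>
    rw [mul_cons, ih, contr_const, h0]
    simp [contr_apply]

theorem grade_mul_aux (F G : ListForm κ R) (l : List κ) :
    grade (F * G) l = (grade F * grade G) l := by
  induction l generalizing F G with
  | nil => simp [grade_apply, mul_nil]
  | cons k l ih =>
    have hneg : ∀ (F G : ListForm κ R), (F * (-G)) l = -(F * G) l := fun F G => by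
      simpa using mul_smul_aux (-1) F G l
    have h := ih (contr k F) G
    have h' := ih (grade F) (contr k G)
    simp only [grade_apply, mul_cons, List.length_cons, pow_succ, contr_grade, neg_mul_aux,
      hneg] at h h' ⊢
    rw [← h, ← h']
    ring

theorem mul_assoc_aux (F G H : ListForm κ R) (l : List κ) :
    ((F * G) * H) l = (F * (G * H)) l := by
  have hg : ∀ F G : ListForm κ R, grade (F * G) = grade F * grade G := fun F G => by
    ext l
    exact grade_mul_aux F G l
  induction l generalizing F G H with
  | nil => simp [mul_nil, mul_assoc]
  | cons k l ih => simp only [mul_cons, contr_mul, add_mul_aux, mul_add_aux, ih, hg]; ring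

instance : Ring (ListForm κ R) where
  one := const 1
  mul_assoc F G H := by ext l; exact mul_assoc_aux F G H l
  one_mul F := (const_mul 1 F).trans (one_smul R F)
  mul_one F := (mul_const 1 F).trans (one_smul R F)
  left_distrib F G H := by ext l; exact mul_add_aux F G H l
  right_distrib F G H := by ext l; exact add_mul_aux F G H l
  zero_mul G := by ext l; simpa using smul_mul_aux 0 (0 : ListForm κ R) G l
  mul_zero F := by ext l; simpa using mul_smul_aux 0 F (0 : ListForm κ R) l
  zsmul := fun n F => n • F
  zsmul_zero' := SubNegMonoid.zsmul_zero'
  zsmul_succ' := SubNegMonoid.zsmul_succ'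
  zsmul_neg' := SubNegMonoid.zsmul_neg'
  nsmul := fun n F => n • F
  nsmul_zero := AddMonoid.nsmul_zero
  nsmul_succ := AddMonoid.nsmul_succ
  neg_add_cancel := neg_add_cancel
  sub_eq_add_neg := sub_eq_add_neg

instance : Algebra R (ListForm κ R) :=
  Algebra.ofModule (fun r F G => by ext l; exact smul_mul_aux r F G l)
    (fun r F G => by ext l; exact mul_smul_aux r F G l)

/-- Even elements are central and odd elements supercommute. -/
theorem mul_comm_aux (F : ListForm κ R) (l : List κ) :
    (grade F = F → ∀ G : ListForm κ R, (F * G) l = (G * F) l) ∧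
      (grade F = -F → ∀ G : ListForm κ R, (F * G) l = (grade G * F) l) := by
  -- Contraction reverses parity, so the even and odd cases need each other in the induction.
  induction l generalizing F with
  | nil =>
    refine ⟨fun _ G => by simp [mul_nil, mul_comm], fun _ G => ?_⟩
    simp [mul_nil, mul_comm, grade_apply]
  | cons k l ih =>
    refine ⟨fun h G => ?_, fun h G => ?_⟩
    · have hk : grade (contr k F) = -contr k F := by
        rw [← neg_eq_iff_eq_neg, ← contr_grade, h]
      rw [mul_cons, mul_cons, h, (ih F).1 h, (ih (contr k F)).2 hk, add_comm]
    · have hk : grade (contr k F) = contr k F := by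
        rw [← neg_inj, ← contr_grade, h, map_neg]
      rw [mul_cons, mul_cons, h, (ih (contr k F)).1 hk, contr_grade, grade_grade, neg_mul_aux,
        neg_mul_aux, (ih F).2 h, add_comm]

theorem mul_comm_of_even {F : ListForm κ R} (h : grade F = F) (G : ListForm κ R) :
    F * G = G * F := by
  ext l
  exact (mul_comm_aux F l).1 h G

theorem mul_comm_of_odd {F : ListForm κ R} (h : grade F = -F) (G : ListForm κ R) :
    F * G = grade G * F := by
  ext l
  exact (mul_comm_aux F l).2 h G

/-- Only the parities of `i` and `j` matter: an even factor is central, and an odd one passes `G` at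
the cost of the grading involution, which contributes `(-1) ^ j`. -/
theorem mul_comm_of_grade {F G : ListForm κ R} {i j : ℕ} (hF : grade F = (-1 : R) ^ i • F)
    (hG : grade G = (-1 : R) ^ j • G) : F * G = (-1 : R) ^ (i * j) • (G * F) := by
  rcases Nat.even_or_odd i with hi | hi
  · rw [hi.neg_one_pow, one_smul] at hF
    rw [mul_comm_of_even hF, (hi.mul_right j).neg_one_pow, one_smul]
  · rw [hi.neg_one_pow, neg_smul, one_smul] at hF
    rw [mul_comm_of_odd hF, hG, smul_mul_assoc, pow_mul, hi.neg_one_pow]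

/-! ### Derivations and contractions -/

/-- The `1`-form with the given coefficients. -/
def covector (θ : κ → R) : ListForm κ R
  | [] => 0
  | [k] => θ k
  | _ :: _ :: _ => 0

@[simp] theorem covector_nil (θ : κ → R) : covector θ [] = 0 := rfl

@[simp] theorem contr_covector (k : κ) (θ : κ → R) : contr k (covector θ) = const (θ k) := by
  ext l
  cases l <;> rfl

theorem grade_covector (θ : κ → R) : grade (covector θ) = -covector θ := by
  refine ext_contr (by simp [grade_apply]) fun k => ?_
  rw [contr_grade, map_neg, contr_covector, grade_const]

variable [Algebra ℝ R]

/-- Coefficientwise action of a derivation. -/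
def deriv (δ : Derivation ℝ R R) : ListForm κ R →+ ListForm κ R where
  toFun F l := δ (F l)
  map_zero' := by ext l; exact map_zero δ
  map_add' F G := by ext l; exact map_add δ _ _

theorem deriv_apply (δ : Derivation ℝ R R) (F : ListForm κ R) (l : List κ) :
    deriv δ F l = δ (F l) := rfl

theorem contr_deriv (δ : Derivation ℝ R R) (k : κ) (F : ListForm κ R) :
    contr k (deriv δ F) = deriv δ (contr k F) := rfl

theorem deriv_grade (δ : Derivation ℝ R R) (F : ListForm κ R) :
    deriv δ (grade F) = grade (deriv δ F) := by
  ext l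
  rcases neg_one_pow_eq_or R l.length with h | h <;> simp [deriv_apply, grade_apply, h]

theorem deriv_mul (δ : Derivation ℝ R R) (F G : ListForm κ R) :
    deriv δ (F * G) = deriv δ F * G + F * deriv δ G := by
  ext l
  induction l generalizing F G with
  | nil => simp [deriv_apply, mul_nil, mul_comm, add_comm]
  | cons k l ih =>
    have h := ih (contr k F) G
    have h' := ih (grade F) (contr k G)
    simp only [deriv_apply, add_apply, mul_cons, map_add, contr_deriv, deriv_grade] at h h' ⊢
    rw [h, h']
    ring

/-- The exterior derivative attached to derivations `D k` in the directions `k`. -/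
def dAux (D : κ → Derivation ℝ R R) : List κ → ListForm κ R → R
  | [], _ => 0
  | k :: l, F => D k (F l) - dAux D l (contr k F)

/-- The exterior derivative attached to derivations `D k` in the directions `k`. -/
def d (D : κ → Derivation ℝ R R) : ListForm κ R →+ ListForm κ R where
  toFun F l := dAux D l F
  map_zero' := by
    ext l
    induction l with
    | nil => rfl
    | cons k l ih =>
      have : dAux D (k :: l) 0 = D k 0 - dAux D l 0 := rfl
      rw [this, ih, map_zero, zero_apply, sub_zero]; rfl
  map_add' F G := by
    ext l
    change dAux D l (F + G) = dAux D l F + dAux D l G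
    induction l generalizing F G with
    | nil => simp [dAux]
    | cons k l ih =>
      simp only [dAux, map_add, add_apply, ih]
      ring

variable (D : κ → Derivation ℝ R R)

@[simp] theorem d_nil (F : ListForm κ R) : d D F [] = 0 := rfl

/-- Cartan's formula for the coordinate direction `k`, whose Lie derivative acts on coefficients
only. With the value `0` on the empty list it determines `d`, and it drives every induction about
`d`. -/
theorem contr_d (k : κ) (F : ListForm κ R) :
    contr k (d D F) = deriv (D k) F - d D (contr k F) := rfl

theorem d_cons (k : κ) (l : List κ) (F : ListForm κ R) :
    d D F (k :: l) = D k (F l) - d D (contr k F) l := rfl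

theorem d_grade (F : ListForm κ R) : d D (grade F) = -grade (d D F) := by
  ext l
  induction l generalizing F with
  | nil => simp [grade_apply]
  | cons k l ih =>
    have h := ih (contr k F)
    have h2 := congrFun (deriv_grade (D k) F) l
    simp only [d_cons, grade_apply, contr_grade, map_neg, neg_apply, List.length_cons,
      pow_succ, deriv_apply] at h h2 ⊢
    rw [h, h2]
    ring

theorem d_mul (F G : ListForm κ R) : d D (F * G) = d D F * G + grade F * d D G := by
  ext l
  induction l generalizing F G with
  | nil => simp [mul_nil]
  | cons k l ih =>
    have h := ih (contr k F) G
    have h' := ih (grade F) (contr k G)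
    have h2 := congrFun (deriv_mul (D k) F G) l
    simp only [d_cons, contr_mul, map_add, add_apply, mul_cons, contr_d, contr_grade, sub_mul,
      mul_sub, sub_apply, neg_mul, neg_apply, grade_grade, d_grade, deriv_apply] at h h' h2 ⊢
    rw [h2, h, h']
    ring

theorem d_deriv (hD : ∀ j k r, D j (D k r) = D k (D j r)) (j : κ) (F : ListForm κ R) :
    d D (deriv (D j) F) = deriv (D j) (d D F) := by
  ext l
  induction l generalizing F with
  | nil => simp [deriv_apply]
  | cons k l ih =>
    have h := ih (contr k F)
    simp only [d_cons, deriv_apply, contr_deriv, map_sub] at h ⊢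
    rw [h, hD]

/-- Contraction with `k` turns `d (d F)` into `D k (d F) - d (D k F) + d (d (contr k F))`. The first
two terms cancel as the directions commute, and the last falls to the induction. Alternation plays
no role. -/
theorem d_d (hD : ∀ j k r, D j (D k r) = D k (D j r)) (F : ListForm κ R) : d D (d D F) = 0 := by
  ext l
  induction l generalizing F with
  | nil => rfl
  | cons k l ih =>
    rw [d_cons, contr_d, map_sub, sub_apply, d_deriv D hD, ih, deriv_apply]
    simp

theorem d_smul (r : R) (F : ListForm κ R) :
    d D (r • F) = d D (const r) * F + r • d D F := by
  rw [← const_mul, d_mul, grade_const, const_mul]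

theorem d_const_eq_covector (r : R) : d D (const r) = covector fun k => D k r := by
  refine ext_contr rfl fun k => ?_
  rw [contr_d, contr_const, map_zero, sub_zero, contr_covector]
  ext l
  cases l <;> simp [deriv_apply, const]

section Fintype

variable [Fintype κ]

/-- Contraction with a vector field given by its components. -/
def iota (X : κ → R) : ListForm κ R →ₗ[R] ListForm κ R := ∑ k, X k • contr k

theorem iota_eq (X : κ → R) (F : ListForm κ R) : iota X F = ∑ k, X k • contr k F := by
  simp [iota]

theorem iota_apply (X : κ → R) (F : ListForm κ R) (l : List κ) :
    iota X F l = ∑ k, X k * F (k :: l) := by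
  rw [iota_eq, sum_apply]; rfl

theorem iota_mul (X : κ → R) (F G : ListForm κ R) :
    iota X (F * G) = iota X F * G + grade F * iota X G := by
  simp only [iota_eq, contr_mul, smul_add, Finset.sum_add_distrib, Finset.sum_mul,
    Finset.mul_sum, smul_mul_assoc, mul_smul_comm]

theorem iota_grade (X : κ → R) (F : ListForm κ R) : iota X (grade F) = -grade (iota X F) := by
  simp [iota_eq, contr_grade]

@[simp] theorem iota_const (X : κ → R) (r : R) : iota X (const r : ListForm κ R) = 0 := by
  simp [iota_eq]

theorem const_sum {α : Type*} (s : Finset α) (r : α → R) :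
    (const (∑ a ∈ s, r a) : ListForm κ R) = ∑ a ∈ s, const (r a) := by
  ext l
  rw [sum_apply]
  cases l <;> simp [const]

theorem smul_const (r s : R) : r • (const s : ListForm κ R) = const (r * s) := by
  ext l
  cases l <;> simp [const]

theorem iota_covector (X θ : κ → R) : iota X (covector θ) = const (∑ k, X k * θ k) := by
  simp [iota_eq, const_sum, smul_const]

/-- The Lie derivative, defined by Cartan's formula. -/
def lie (X : κ → R) : ListForm κ R →+ ListForm κ R :=
  (d D).comp (iota X).toAddMonoidHom + (iota X).toAddMonoidHom.comp (d D)

theorem lie_apply (X : κ → R) (F : ListForm κ R) :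
    lie D X F = d D (iota X F) + iota X (d D F) := rfl

theorem lie_mul (X : κ → R) (F G : ListForm κ R) :
    lie D X (F * G) = lie D X F * G + F * lie D X G := by
  simp only [lie_apply, iota_mul, d_mul, map_add, grade_grade, iota_grade, d_grade, add_mul,
    mul_add, neg_mul]
  abel

theorem lie_grade (X : κ → R) (F : ListForm κ R) : lie D X (grade F) = grade (lie D X F) := by
  simp [lie_apply, iota_grade, d_grade]

theorem lie_d (hD : ∀ j k r, D j (D k r) = D k (D j r)) (X : κ → R) (F : ListForm κ R) :
    lie D X (d D F) = d D (lie D X F) := by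
  simp [lie_apply, d_d D hD]

theorem lie_const (X : κ → R) (r : R) : lie D X (const r) = const (∑ k, X k * D k r) := by
  rw [lie_apply, iota_const, map_zero, zero_add, d_const_eq_covector, iota_covector]

theorem lie_smul (X : κ → R) (r : R) (F : ListForm κ R) :
    lie D X (r • F) = (∑ k, X k * D k r) • F + r • lie D X F := by
  rw [← const_mul, lie_mul, lie_const, const_mul, const_mul]

/-- The coordinate expression of the Lie derivative: coefficients are differentiated along `X`, and
each index is hit by `dX`. -/
theorem lie_eq (X : κ → R) (F : ListForm κ R) :
    lie D X F = ∑ k, (d D (const (X k)) * contr k F + X k • deriv (D k) F) := by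
  rw [lie_apply, iota_eq, iota_eq, map_sum, ← Finset.sum_add_distrib]
  refine Finset.sum_congr rfl fun k _ => ?_
  rw [d_smul, contr_d, smul_sub]
  abel

/-! ### Alternating elements -/

/-- Functions on lists that are alternating in the entries of the list. -/
def IsAlt (F : ListForm κ R) : Prop :=
  ∀ l₁ j k l₂, F (l₁ ++ j :: k :: l₂) = -F (l₁ ++ k :: j :: l₂)

/-- The calculus uses alternation only through this anticommutation; products, `d` and Cartan's
formula make sense for all functions on lists. -/
theorem IsAlt.contr_contr {F : ListForm κ R} (hF : IsAlt F) (j k : κ) :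
    contr j (contr k F) = -contr k (contr j F) := by
  ext l
  exact hF [] k j l

theorem IsAlt.contr {F : ListForm κ R} (hF : IsAlt F) (k : κ) : IsAlt (contr k F) :=
  fun l₁ => hF (k :: l₁)

theorem IsAlt.add {F G : ListForm κ R} (hF : IsAlt F) (hG : IsAlt G) : IsAlt (F + G) :=
  fun l₁ j k l₂ => by rw [add_apply, add_apply, hF, hG]; ring

theorem IsAlt.smul {F : ListForm κ R} (r : R) (hF : IsAlt F) : IsAlt (r • F) :=
  fun l₁ j k l₂ => by rw [smul_apply, smul_apply, hF]; ring

theorem IsAlt.neg {F : ListForm κ R} (hF : IsAlt F) : IsAlt (-F) :=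
  fun l₁ j k l₂ => by rw [neg_apply, neg_apply, hF]

theorem IsAlt.sub {F G : ListForm κ R} (hF : IsAlt F) (hG : IsAlt G) : IsAlt (F - G) :=
  sub_eq_add_neg F G ▸ hF.add hG.neg

theorem IsAlt.sum {α : Type*} {s : Finset α} {F : α → ListForm κ R} (hF : ∀ a ∈ s, IsAlt (F a)) :
    IsAlt (∑ a ∈ s, F a) := by
  intro l₁ j k l₂
  rw [sum_apply, sum_apply, ← Finset.sum_neg_distrib]
  exact Finset.sum_congr rfl fun a ha => hF a ha _ _ _ _

theorem IsAlt.grade {F : ListForm κ R} (hF : IsAlt F) : IsAlt (grade F) :=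
  fun l₁ j k l₂ => by simp [grade_apply, hF l₁ j k l₂]

theorem IsAlt.iota {F : ListForm κ R} (hF : IsAlt F) (X : κ → R) : IsAlt (iota X F) := by
  rw [iota_eq]
  exact IsAlt.sum fun k _ => (hF.contr k).smul _

theorem IsAlt.mul {F G : ListForm κ R} (hF : IsAlt F) (hG : IsAlt G) : IsAlt (F * G) := by
  intro l₁ j k l₂
  induction l₁ generalizing F G with
  | nil =>
    have h : ListForm.contr k (ListForm.contr j (F * G)) =
        -ListForm.contr j (ListForm.contr k (F * G)) := by
      simp only [contr_mul, map_add, contr_grade, hF.contr_contr j k, hG.contr_contr j k, neg_mul,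
        mul_neg]
      abel
    exact congrFun h l₂
  | cons m l₁ ih =>
    simp only [List.cons_append, mul_cons, ih (hF.contr m) hG, ih hF.grade (hG.contr m)]
    ring

theorem IsAlt.d {F : ListForm κ R} (hF : IsAlt F) : IsAlt (d D F) := by
  intro l₁ j k l₂
  induction l₁ generalizing F with
  | nil =>
    have h : ListForm.contr k (ListForm.contr j (ListForm.d D F)) =
        -ListForm.contr j (ListForm.contr k (ListForm.d D F)) := by
      simp only [contr_d, map_sub, contr_deriv, hF.contr_contr j k, map_neg]
      abel
    exact congrFun h l₂
  | cons m l₁ ih =>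
    simp only [List.cons_append, d_cons, ih (hF.contr m), hF l₁ j k l₂, map_neg]
    ring

theorem IsAlt.lie {F : ListForm κ R} (hF : IsAlt F) (X : κ → R) : IsAlt (lie D X F) :=
  ((hF.iota X).d D).add ((hF.d D).iota X)

theorem isAlt_covector (θ : κ → R) : IsAlt (covector θ) := by
  intro l₁ j k l₂
  rcases l₁ with _ | ⟨m, _ | ⟨m', l₁⟩⟩ <;> simp [covector]

theorem IsAlt.contr_iota {F : ListForm κ R} (hF : IsAlt F) (X : κ → R) (k : κ) :
    ListForm.contr k (ListForm.iota X F) = -ListForm.iota X (ListForm.contr k F) := by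
  simp only [iota_eq, map_sum, map_smul, ← Finset.sum_neg_distrib]
  exact Finset.sum_congr rfl fun j _ => by rw [hF.contr_contr k j, smul_neg]

/-- The extra term is the contraction with the bracket of the coordinate field `j` and `X`, whose
components are `D j (X k)`. -/
theorem IsAlt.contr_lie {F : ListForm κ R} (hF : IsAlt F) (X : κ → R) (j : κ) :
    ListForm.contr j (ListForm.lie D X F) = ListForm.lie D X (ListForm.contr j F) +
      ListForm.iota (fun k => D j (X k)) F := by
  rw [lie_eq, lie_eq, iota_eq, map_sum, ← Finset.sum_add_distrib]
  refine Finset.sum_congr rfl fun k _ => ?_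
  rw [map_add, map_smul, contr_deriv, contr_mul, d_const_eq_covector, contr_covector, const_mul,
    grade_covector, hF.contr_contr j k, neg_mul_neg]
  abel

/-- Commuting vector fields have commuting Lie derivatives and contractions. -/
theorem IsAlt.iota_lie {F : ListForm κ R} (hF : IsAlt F) {X Y : κ → R}
    (hXY : ∀ k, ∑ j, X j * D j (Y k) = ∑ j, Y j * D j (X k)) :
    ListForm.iota Y (ListForm.lie D X F) = ListForm.lie D X (ListForm.iota Y F) := by
  have h1 : ∑ j, Y j • ListForm.iota (fun k => D j (X k)) F =
      ∑ j, (∑ k, X k * D k (Y j)) • ListForm.contr j F := by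
    simp only [iota_eq, Finset.smul_sum, smul_smul]
    rw [Finset.sum_comm]
    refine Finset.sum_congr rfl fun k _ => ?_
    rw [hXY, Finset.sum_smul]
  rw [iota_eq, iota_eq, map_sum]
  simp only [hF.contr_lie, smul_add, Finset.sum_add_distrib, lie_smul]
  rw [h1, add_comm]

/-- The Lie derivative along `X` commutes with both ingredients of Cartan's formula for `Y`, namely
`d` and the contraction with `Y`. -/
theorem lie_lie (hD : ∀ j k r, D j (D k r) = D k (D j r)) {F : ListForm κ R} (hF : IsAlt F)
    {X Y : κ → R} (hXY : ∀ k, ∑ j, X j * D j (Y k) = ∑ j, Y j * D j (X k)) :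
    lie D X (lie D Y F) = lie D Y (lie D X F) := by
  rw [lie_apply D Y (lie D X F), hF.iota_lie D hXY, ← lie_d D hD X F, (hF.d D).iota_lie D hXY,
    ← lie_d D hD, ← map_add, ← lie_apply]

/-! ### Pull-back along an endomorphism -/

/-- Pull-back along the endomorphism whose value on the `k`-th vector has components `P k`. -/
def pullAux (P : κ → κ → R) : List κ → ListForm κ R → R
  | [], F => F []
  | k :: l, F => pullAux P l (iota (P k) F)

/-- Pull-back along the endomorphism whose value on the `k`-th vector has components `P k`. -/
def pull (P : κ → κ → R) : ListForm κ R →ₗ[R] ListForm κ R where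
  toFun F l := pullAux P l F
  map_add' F G := by
    ext l
    change pullAux P l (F + G) = pullAux P l F + pullAux P l G
    induction l generalizing F G with
    | nil => rfl
    | cons k l ih => simp only [pullAux, map_add, ih]
  map_smul' r F := by
    ext l
    change pullAux P l (r • F) = r * pullAux P l F
    induction l generalizing F with
    | nil => rfl
    | cons k l ih => simp only [pullAux, map_smul, ih]

theorem pull_nil (P : κ → κ → R) (F : ListForm κ R) : pull P F [] = F [] := rfl

theorem contr_pull (P : κ → κ → R) (k : κ) (F : ListForm κ R) :
    contr k (pull P F) = pull P (iota (P k) F) := rfl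

theorem pull_grade (P : κ → κ → R) (F : ListForm κ R) : pull P (grade F) = grade (pull P F) := by
  ext l
  induction l generalizing F with
  | nil => rfl
  | cons k l ih =>
    change contr k (pull P (grade F)) l = contr k (grade (pull P F)) l
    rw [contr_pull, contr_grade, contr_pull, iota_grade, map_neg, neg_apply, neg_apply, ih]

theorem pull_mul (P : κ → κ → R) (F G : ListForm κ R) :
    pull P (F * G) = pull P F * pull P G := by
  ext l
  induction l generalizing F G with
  | nil => rfl
  | cons k l ih =>
    change contr k (pull P (F * G)) l = _
    rw [contr_pull, iota_mul, map_add, add_apply, ih, ih, mul_cons, contr_pull, contr_pull,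
      pull_grade]

end Fintype
end ListForm

end

section

/-! ### Reindexing of fourfold sums, inverse matrices and flat frames. -/

theorem sum_sum_sum_sum_eq {ι M : Type*} [Fintype ι] [AddCommMonoid M] (f : ι → ι → ι → ι → M) :
    ∑ a, ∑ b, ∑ c, ∑ d, f a b c d = ∑ x : ι × ι × ι × ι, f x.1 x.2.1 x.2.2.1 x.2.2.2 := by
  simp only [Fintype.sum_prod_type]

theorem sum_sum_sum_sum_swap {ι M : Type*} [Fintype ι] [AddCommMonoid M] (f : ι → ι → ι → ι → M) :
    ∑ a, ∑ b, ∑ c, ∑ d, f c d a b = ∑ a, ∑ b, ∑ c, ∑ d, f a b c d := by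
  rw [sum_sum_sum_sum_eq f, sum_sum_sum_sum_eq fun a b c d => f c d a b]
  exact Fintype.sum_equiv ⟨fun x => (x.2.2.1, x.2.2.2, x.1, x.2.1),
    fun x => (x.2.2.1, x.2.2.2, x.1, x.2.1), fun _ => rfl, fun _ => rfl⟩ _ _ fun _ => rfl

theorem sum_sum_sum_sum_cycle {ι M : Type*} [Fintype ι] [AddCommMonoid M]
    (f : ι → ι → ι → ι → M) :
    ∑ a, ∑ b, ∑ c, ∑ d, f d c a b = ∑ a, ∑ b, ∑ c, ∑ d, f a b c d := by
  rw [sum_sum_sum_sum_eq f, sum_sum_sum_sum_eq fun a b c d => f d c a b]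
  exact Fintype.sum_equiv ⟨fun x => (x.2.2.2, x.2.2.1, x.1, x.2.1),
    fun x => (x.2.2.1, x.2.2.2, x.2.1, x.1), fun _ => rfl, fun _ => rfl⟩ _ _ fun _ => rfl

theorem eq_zero_of_add_self {R M : Type*} [CommRing R] [Algebra ℝ R] [AddCommGroup M] [Module R M]
    {m : M} (h : m + m = 0) : m = 0 := by
  have h2 : (algebraMap ℝ R (1 / 2)) • ((2 : R) • m) = m := by
    rw [smul_smul, show (2 : R) = algebraMap ℝ R 2 from (map_ofNat _ 2).symm, ← map_mul]
    norm_num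
  rw [← h2, two_smul, h, smul_zero]

/-- The derivative of the inverse of a matrix. -/
theorem derivation_inverse {R M ι : Type*} [CommRing R] [AddCommGroup M] [Module R M] [Fintype ι]
    [DecidableEq ι] (δ : R →+ M) (hδ : ∀ r s, δ (r * s) = r • δ s + s • δ r)
    {W μ : Matrix ι ι R} (h : W * μ = 1) (a d : ι) :
    δ (W a d) = -∑ b, ∑ c, (W a b * W c d) • δ (μ b c) := by
  have h1 : δ 1 = 0 := by simpa using hδ 1 1
  have h' : μ * W = 1 := mul_eq_one_comm.mp h
  have h2 : ∀ c, ∑ b, (W a b • δ (μ b c) + μ b c • δ (W a b)) = 0 := fun c => by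
    have := congrArg δ (congrFun (congrFun h a) c)
    rw [Matrix.mul_apply, map_sum] at this
    simp only [hδ] at this
    rw [this, Matrix.one_apply]
    split_ifs <;> simp [h1]
  -- The differentiated identity `W * μ = 1` is multiplied by `W` on the right; `μ * W = 1` then
  -- isolates `δ (W a d)`. The values of `δ` lie in a module, so that it can be a derivative of
  -- functions as well as the leafwise differential.
  have h3 : ∑ c, W c d • ∑ b, (W a b • δ (μ b c) + μ b c • δ (W a b)) = 0 := by simp [h2]
  simp only [Finset.sum_add_distrib, smul_add, Finset.smul_sum, smul_smul] at h3
  have h4 : ∑ c, ∑ b, (W c d * μ b c) • δ (W a b) = δ (W a d) := by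
    rw [Finset.sum_comm]
    simp only [← Finset.sum_smul, mul_comm (W _ d)]
    simp only [← Matrix.mul_apply, h', Matrix.one_apply, ite_smul, one_smul, zero_smul]
    simp
  rw [h4] at h3
  rw [eq_neg_of_add_eq_zero_right h3, Finset.sum_comm]
  simp only [mul_comm (W a _)]

open ListForm

/-- A commuting frame `e` of a complement of the kernel of a closed `2`-form `Ω`, together with the
dual coframe `ε` vanishing on the kernel, and the inverse `W` of the matrix `μ a b = Ω(e a, e b)`,
all written in components. -/
structure FlatFrame {κ R : Type*} [Fintype κ] [DecidableEq κ] [CommRing R] [Algebra ℝ R]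
    (D : κ → Derivation ℝ R R) (ι : Type*) [Fintype ι] [DecidableEq ι] where
  D_comm : ∀ j k r, D j (D k r) = D k (D j r)
  e : ι → κ → R
  ε : ι → κ → R
  Ω : ListForm κ R
  μ : Matrix ι ι R
  W : Matrix ι ι R
  /-- The projection onto the kernel of `Ω`. -/
  P : κ → κ → R
  P_eq : ∀ k j, P k j + ∑ a, ε a k * e a j = Pi.single (M := fun _ => R) k 1 j
  e_comm : ∀ a b k, ∑ j, e a j * D j (e b k) = ∑ j, e b j * D j (e a k)
  ε_e : ∀ a b, ∑ k, e b k * ε a k = Pi.single (M := fun _ => R) a 1 b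
  Ω_alt : IsAlt Ω
  d_Ω : d D Ω = 0
  pull_Ω : pull P Ω = 0
  iota_Ω : ∀ a, iota (e a) Ω = covector fun k => ∑ b, μ a b * ε b k
  μ_swap : ∀ a b, μ b a = -μ a b
  W_mul : W * μ = 1

/-! ### The calculus of horizontal forms in a flat frame. -/

namespace FlatFrame

variable {κ R : Type*} [Fintype κ] [DecidableEq κ] [CommRing R] [Algebra ℝ R]
  {D : κ → Derivation ℝ R R} {ι : Type*} [Fintype ι] [DecidableEq ι] (S : FlatFrame D ι)

/-- The coframe as `1`-forms. -/
def eps (a : ι) : ListForm κ R := covector (S.ε a)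

/-- The derivative along the frame. -/
def L (a : ι) : ListForm κ R →+ ListForm κ R := lie D (S.e a)

/-- The derivative of functions along the frame. -/
def Lf (a : ι) (r : R) : R := ∑ k, S.e a k * D k r

/-- The Bott connection forms of the frame. -/
def θ (b a : ι) : ListForm κ R := S.L b (S.eps a)

/-- The alternating forms that vanish when one argument is in the span of the frame. -/
def Hor (F : ListForm κ R) : Prop := IsAlt F ∧ ∀ a, iota (S.e a) F = 0

/-- The leafwise differential. -/
def dF (F : ListForm κ R) : ListForm κ R := d D F - ∑ a, S.eps a * S.L a F

/-- Twice the bracket. -/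
def brk (F G : ListForm κ R) : ListForm κ R := ∑ a, ∑ b, S.W a b • (S.L a F * S.L b G)

variable {S}

theorem W_swap (a b : ι) : S.W b a = -S.W a b := by
  have h1 : S.μ.transpose = -S.μ := by
    ext a b
    simp [S.μ_swap a b]
  have h2 : S.μ * (-S.W.transpose) = 1 := by
    have := congrArg Matrix.transpose S.W_mul
    rw [Matrix.transpose_mul, h1, Matrix.transpose_one] at this
    rw [mul_neg, ← neg_mul, this]
  have h3 : S.W = -S.W.transpose := by
    calc S.W = S.W * (S.μ * (-S.W.transpose)) := by rw [h2, mul_one]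
      _ = -S.W.transpose := by rw [← mul_assoc, S.W_mul, one_mul]
  simpa using congrFun (congrFun h3 b) a

theorem L_mul (a : ι) (F G : ListForm κ R) : S.L a (F * G) = S.L a F * G + F * S.L a G :=
  lie_mul _ _ _ _

theorem L_smul (a : ι) (r : R) (F : ListForm κ R) : S.L a (r • F) = S.Lf a r • F + r • S.L a F :=
  lie_smul _ _ _ _

theorem L_const (a : ι) (r : R) : S.L a (const r) = const (S.Lf a r) := lie_const _ _ _

theorem L_grade (a : ι) (F : ListForm κ R) : S.L a (grade F) = grade (S.L a F) := lie_grade _ _ _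

theorem L_d (a : ι) (F : ListForm κ R) : S.L a (d D F) = d D (S.L a F) := lie_d _ S.D_comm _ _

theorem L_L (a b : ι) {F : ListForm κ R} (hF : IsAlt F) : S.L a (S.L b F) = S.L b (S.L a F) :=
  ListForm.lie_lie D S.D_comm hF (S.e_comm a b)

theorem iota_L (a b : ι) {F : ListForm κ R} (hF : IsAlt F) :
    iota (S.e b) (S.L a F) = S.L a (iota (S.e b) F) :=
  hF.iota_lie D (S.e_comm a b)

theorem iota_eps (a b : ι) :
    iota (S.e b) (S.eps a) = const (Pi.single (M := fun _ => R) a 1 b) := by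
  rw [eps, iota_covector, S.ε_e]

theorem Lf_single (a b c : ι) : S.Lf c (Pi.single (M := fun _ => R) a 1 b) = 0 := by
  rcases eq_or_ne b a with rfl | h <;> simp [Lf, *]

theorem d_const_single (a b : ι) : d D (const (Pi.single (M := fun _ => R) a 1 b)) = 0 := by
  rw [d_const_eq_covector]
  refine ext_contr rfl fun k => ?_
  rw [contr_covector]
  ext l
  rcases eq_or_ne b a with rfl | h <;> cases l <;> simp [const, *]

theorem grade_eps (a : ι) : grade (S.eps a) = -S.eps a := grade_covector _

theorem grade_θ (a b : ι) : grade (S.θ b a) = -S.θ b a := by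
  rw [θ, ← L_grade, grade_eps, map_neg]

theorem eps_alt (a : ι) : IsAlt (S.eps a) := isAlt_covector _

theorem Hor.L {F : ListForm κ R} (hF : S.Hor F) (a : ι) : S.Hor (S.L a F) :=
  ⟨hF.1.lie D _, fun b => by rw [iota_L a b hF.1, hF.2, map_zero]⟩

/-- Contractions with the frame commute with `L b`, and the pairings of the coframe with the frame
are constants, which `L b` kills. -/
theorem θ_hor (a b : ι) : S.Hor (S.θ b a) :=
  ⟨(eps_alt a).lie D _, fun c => by
    rw [θ, iota_L b c (eps_alt a), iota_eps, L_const, Lf_single]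
    ext l
    cases l <;> rfl⟩

/-- One term of Cartan's formula vanishes on horizontal forms. This identifies `L a` with the
covariant derivative `nabla`, defined by inserting a vector of `G` into the exterior derivative. -/
theorem Hor.iota_d {F : ListForm κ R} (hF : S.Hor F) (a : ι) :
    iota (S.e a) (d D F) = S.L a F := by
  rw [FlatFrame.L, lie_apply, hF.2, map_zero, zero_add]

theorem sum_single_mul {M : Type*} [AddCommGroup M] [Module R M] (b : ι) (f : ι → M) :
    ∑ a, (Pi.single (M := fun _ => R) a 1 b : R) • f a = f b := by
  rw [Finset.sum_eq_single b] <;> simp +contextual [eq_comm]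

theorem Hor.dF {F : ListForm κ R} (hF : S.Hor F) : S.Hor (S.dF F) := by
  refine ⟨(hF.1.d D).sub (IsAlt.sum fun a _ => (eps_alt a).mul (hF.L a).1), fun b => ?_⟩
  rw [FlatFrame.dF, map_sub, hF.iota_d, map_sum]
  simp only [iota_mul, iota_eps, const_mul, (hF.L _).2, mul_zero, add_zero]
  rw [sum_single_mul, sub_self]

theorem iota_P (k : κ) (F : ListForm κ R) :
    iota (S.P k) F = contr k F - ∑ a, S.ε a k • iota (S.e a) F := by
  have h : ∀ j, S.P k j = Pi.single (M := fun _ => R) k 1 j - ∑ a, S.ε a k * S.e a j :=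
    fun j => eq_sub_of_add_eq (S.P_eq k j)
  simp only [iota_eq, h, sub_smul, Finset.sum_sub_distrib, Finset.sum_smul, Finset.smul_sum,
    smul_smul]
  congr 1
  · rw [Finset.sum_eq_single k] <;> simp +contextual
  · exact Finset.sum_comm

/-- The projection differs from the identity by a combination of the frame vectors, which a
horizontal form does not see. Hence a horizontal form with vanishing pull-back is zero; `two_Ω` and
`d_eps` rely on this. -/
theorem Hor.pull_eq {F : ListForm κ R} (hF : S.Hor F) : pull S.P F = F := by
  ext l
  induction l generalizing F with
  | nil => rfl
  | cons k l ih =>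
    change contr k (pull S.P F) l = contr k F l
    have hk : S.Hor (contr k F) :=
      ⟨hF.1.contr k, fun a => by rw [← neg_inj, ← hF.1.contr_iota, hF.2, map_zero, neg_zero]⟩
    rw [contr_pull, iota_P]
    simp only [hF.2, smul_zero, Finset.sum_const_zero, sub_zero]
    exact ih hk

theorem pull_eps (a : ι) : pull S.P (S.eps a) = 0 := by
  refine ext_contr rfl fun k => ?_
  rw [contr_pull, iota_P]
  simp only [iota_eps]
  rw [eps, contr_covector]
  have : ∑ b, S.ε b k • (const (Pi.single (M := fun _ => R) a 1 b) : ListForm κ R) =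
      const (S.ε a k) := by
    rw [Finset.sum_eq_single a] <;> simp +contextual [smul_const]
    intros
    ext l
    cases l <;> rfl
  rw [this, sub_self, map_zero, map_zero]

/-- The correction terms in `dF` contain a factor of the coframe, which pulls back to zero. Thus
`dF` is `d` followed by restriction to the leaves, which is the definition of `leafD`. -/
theorem Hor.pull_d {F : ListForm κ R} (hF : S.Hor F) : pull S.P (d D F) = S.dF F := by
  rw [← hF.dF.pull_eq, FlatFrame.dF, map_sub, map_sum]
  simp [pull_mul, pull_eps]

/-- `L b` commutes with `d` and with every `L a`; what remains is its action on the coframe in `∑ ε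
a ∧ L a`. -/
theorem dF_L {F : ListForm κ R} (hF : S.Hor F) (b : ι) :
    S.dF (S.L b F) = S.L b (S.dF F) + ∑ a, S.θ b a * S.L a F := by
  rw [dF, dF, map_sub, map_sum, L_d]
  simp only [L_mul, Finset.sum_add_distrib, L_L _ b hF.1, θ]
  abel

/-! ### Consequences of the closedness of `Ω` -/

theorem iota_Ω_eq (a : ι) : iota (S.e a) S.Ω = ∑ b, S.μ a b • S.eps b := by
  rw [S.iota_Ω]
  refine ext_contr ?_ fun k => ?_
  · rw [ListForm.sum_apply]
    exact (Finset.sum_eq_zero fun b _ => mul_zero _).symm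
  · simp [eps, const_sum, smul_const]

theorem iota_iota_Ω (a b : ι) : iota (S.e b) (iota (S.e a) S.Ω) = const (S.μ a b) := by
  rw [iota_Ω_eq, map_sum]
  simp only [map_smul, iota_eps, smul_const]
  rw [← const_sum, Finset.sum_eq_single b] <;> simp +contextual [eq_comm]

/-- The difference of the two sides is horizontal, and it pulls back to zero because both `Ω` and
the coframe do. Doubling avoids the factor `½`. -/
theorem two_Ω : S.Ω + S.Ω = ∑ a, ∑ b, S.μ a b • (S.eps a * S.eps b) := by
  have h : S.Hor (S.Ω + S.Ω - ∑ a, ∑ b, S.μ a b • (S.eps a * S.eps b)) := by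
    refine ⟨(S.Ω_alt.add S.Ω_alt).sub (IsAlt.sum fun a _ => IsAlt.sum fun b _ =>
      ((eps_alt a).mul (eps_alt b)).smul _), fun c => ?_⟩
    simp only [map_sub, map_add, map_sum, map_smul, iota_mul, iota_eps, grade_eps, const_mul,
      mul_const, neg_mul, smul_add, smul_neg, Finset.sum_add_distrib]
    have h1 : ∑ a, ∑ b, S.μ a b • Pi.single (M := fun _ => R) a 1 c • S.eps b =
        ∑ b, S.μ c b • S.eps b := by
      rw [Finset.sum_comm]
      simp only [smul_comm (S.μ _ _), sum_single_mul]
    have h2 : ∑ a, ∑ b, -(S.μ a b • Pi.single (M := fun _ => R) b 1 c • S.eps a) =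
        ∑ b, S.μ c b • S.eps b := by
      simp only [smul_comm (S.μ _ _), Finset.sum_neg_distrib, sum_single_mul]
      rw [← Finset.sum_neg_distrib]
      exact Finset.sum_congr rfl fun a _ => by rw [S.μ_swap c a, neg_smul, neg_neg]
    rw [h1, h2, iota_Ω_eq, sub_self]
  have h0 := h.pull_eq
  rw [map_sub, map_add, S.pull_Ω] at h0
  simp only [map_sum, map_smul, pull_mul, pull_eps, zero_mul, smul_zero, Finset.sum_const_zero,
    add_zero, sub_zero] at h0
  exact sub_eq_zero.mp h0.symm

theorem L_Ω (a : ι) : S.L a S.Ω = d D (iota (S.e a) S.Ω) := by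
  rw [L, lie_apply, S.d_Ω, map_zero, add_zero]

/-- `μ a b` is the double contraction of `Ω`. Cartan's formula moves `d` inside, and closedness
turns `d` of a contraction of `Ω` into a Lie derivative of `Ω`. -/
theorem d_const_μ (a b : ι) : d D (const (S.μ a b)) =
    S.L b (iota (S.e a) S.Ω) - S.L a (iota (S.e b) S.Ω) := by
  rw [← iota_iota_Ω, ← iota_L a b S.Ω_alt, L_Ω, L, lie_apply]
  abel

theorem L_iota_Ω (a b : ι) : S.L b (iota (S.e a) S.Ω) =
    ∑ c, (S.Lf b (S.μ a c) • S.eps c + S.μ a c • S.θ b c) := by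
  rw [iota_Ω_eq, map_sum]
  simp only [L_smul, θ]

/-- Closedness of `Ω` evaluated on three frame vectors; the bracket terms are absent because the
frame commutes. -/
theorem Lf_μ (a b c : ι) : S.Lf c (S.μ a b) = S.Lf b (S.μ a c) - S.Lf a (S.μ b c) := by
  have h := congrArg (iota (S.e c)) (S.d_const_μ a b)
  rw [map_sub, iota_L _ _ (S.Ω_alt.iota _), iota_L _ _ (S.Ω_alt.iota _), iota_iota_Ω, iota_iota_Ω,
    L_const, L_const, d_const_eq_covector, iota_covector] at h
  exact congrFun h []

/-- The leafwise differential of functions. -/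
theorem dF_const (r : R) : S.dF (const r) = d D (const r) - ∑ a, S.Lf a r • S.eps a := by
  simp only [dF, L_const, mul_const]

/-- The coframe components of `d_const_μ` drop out by `Lf_μ`, which leaves those containing `θ`. -/
theorem dF_const_μ (a b : ι) : S.dF (const (S.μ a b)) =
    ∑ c, (S.μ a c • S.θ b c - S.μ b c • S.θ a c) := by
  rw [dF_const, d_const_μ, L_iota_Ω, L_iota_Ω]
  simp only [Lf_μ a b, sub_smul, Finset.sum_add_distrib, Finset.sum_sub_distrib]
  abel

theorem dF_add (F G : ListForm κ R) : S.dF (F + G) = S.dF F + S.dF G := by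
  simp only [dF, map_add, mul_add, Finset.sum_add_distrib]
  abel

theorem dF_mul (F G : ListForm κ R) : S.dF (F * G) = S.dF F * G + grade F * S.dF G := by
  have h : ∀ a, S.eps a * F = grade F * S.eps a := fun a => mul_comm_of_odd (grade_eps a) F
  simp only [dF, d_mul, L_mul, mul_add, sub_mul, mul_sub, Finset.sum_mul, Finset.mul_sum,
    Finset.sum_add_distrib, ← mul_assoc, h]
  abel

theorem dF_smul (r : R) (F : ListForm κ R) :
    S.dF (r • F) = S.dF (const r) * F + r • S.dF F := by
  rw [← const_mul, dF_mul, grade_const, const_mul]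

theorem dF_sum {α : Type*} (s : Finset α) (F : α → ListForm κ R) :
    S.dF (∑ a ∈ s, F a) = ∑ a ∈ s, S.dF (F a) :=
  map_sum (AddMonoidHom.mk' S.dF dF_add) F s

/-- The bivector `W` is parallel along the leaves for the connection forms `θ`. This is the
derivative of an inverse matrix combined with `dF_const_μ`. -/
theorem dF_const_W (a d : ι) : S.dF (const (S.W a d)) =
    -∑ c, (S.W c d • S.θ c a + S.W a c • S.θ c d) := by
  have h := derivation_inverse (M := ListForm κ R)
    (AddMonoidHom.mk' (fun r => S.dF (const r)) fun r s => by
      rw [← dF_add]; congr 1; ext l; cases l <;> simp [const])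
    (fun r s => by
      simp only [AddMonoidHom.mk'_apply]
      rw [← smul_const, dF_smul, mul_const, add_comm]) S.W_mul a d
  simp only [AddMonoidHom.mk'_apply, dF_const_μ] at h
  rw [h, neg_inj]
  simp only [Finset.smul_sum, smul_sub, smul_smul, Finset.sum_sub_distrib, Finset.sum_add_distrib]
  have h1 : ∀ g, ∑ c, S.W c d * S.μ c g = -(1 : Matrix ι ι R) d g := fun g => by
    rw [← S.W_mul, Matrix.mul_apply, ← Finset.sum_neg_distrib]
    exact Finset.sum_congr rfl fun c _ => by rw [W_swap d c]; ring
  have h2 : ∀ g, ∑ b, S.W a b * S.μ b g = (1 : Matrix ι ι R) a g := fun g => by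
    rw [← S.W_mul, Matrix.mul_apply]
  have e1 : ∑ b, ∑ c, ∑ g, (S.W a b * S.W c d * S.μ b g) • S.θ c g = ∑ c, S.W c d • S.θ c a := by
    rw [Finset.sum_comm]
    refine Finset.sum_congr rfl fun c _ => ?_
    rw [Finset.sum_comm]
    have : ∀ g, ∑ b, (S.W a b * S.W c d * S.μ b g) • S.θ c g =
        (S.W c d * (1 : Matrix ι ι R) a g) • S.θ c g := fun g => by
      rw [← Finset.sum_smul, ← h2, Finset.mul_sum]
      congr 1
      exact Finset.sum_congr rfl fun b _ => by ring
    simp [this, Matrix.one_apply]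
  have e2 : ∑ b, ∑ c, ∑ g, (S.W a b * S.W c d * S.μ c g) • S.θ b g =
      -∑ c, S.W a c • S.θ c d := by
    rw [← Finset.sum_neg_distrib]
    refine Finset.sum_congr rfl fun b _ => ?_
    rw [Finset.sum_comm]
    have : ∀ g, ∑ c, (S.W a b * S.W c d * S.μ c g) • S.θ b g =
        -((S.W a b * (1 : Matrix ι ι R) d g) • S.θ b g) := fun g => by
      rw [← Finset.sum_smul, ← neg_smul, ← mul_neg, ← h1, Finset.mul_sum]
      congr 1
      exact Finset.sum_congr rfl fun b _ => by ring
    simp [this, Matrix.one_apply]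
  rw [e1, e2, sub_neg_eq_add]

theorem Lf_mul (a : ι) (r s : R) : S.Lf a (r * s) = r * S.Lf a s + s * S.Lf a r := by
  simp only [Lf, Derivation.leibniz, smul_eq_mul, mul_add, Finset.mul_sum, Finset.sum_add_distrib]
  congr 1 <;> exact Finset.sum_congr rfl fun _ _ => by ring

theorem Lf_add (a : ι) (r s : R) : S.Lf a (r + s) = S.Lf a r + S.Lf a s := by
  simp only [Lf, map_add, mul_add, Finset.sum_add_distrib]

theorem Lf_W (e a d : ι) : S.Lf e (S.W a d) = -∑ b, ∑ c, S.W a b * S.W c d * S.Lf e (S.μ b c) :=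
  derivation_inverse (M := R) (AddMonoidHom.mk' (S.Lf e) (Lf_add e)) (Lf_mul e) S.W_mul a d

/-- The Jacobi identity for the Poisson bivector `W`. -/
theorem poisson_jacobi (p q r : ι) : ∑ b, S.W p b * S.Lf b (S.W q r) =
    ∑ b, S.W b r * S.Lf b (S.W p q) + ∑ b, S.W q b * S.Lf b (S.W p r) := by
  -- Each of the three sums becomes a sum of products of three entries of `W` with a derivative of
  -- `μ`. After renaming of indices the identity holds term by term, by the cyclic relation `Lf_μ`.
  have key : ∀ p q r, ∑ b, S.W p b * S.Lf b (S.W q r) =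
      ∑ b, ∑ s, ∑ t, S.W p b * S.W q s * S.W r t * S.Lf b (S.μ s t) := fun p q r => by
    refine Finset.sum_congr rfl fun b _ => ?_
    rw [Lf_W, mul_neg, Finset.mul_sum, ← Finset.sum_neg_distrib]
    refine Finset.sum_congr rfl fun s _ => ?_
    rw [Finset.mul_sum, ← Finset.sum_neg_distrib]
    refine Finset.sum_congr rfl fun t _ => ?_
    rw [W_swap r t]
    ring
  have h1 : ∑ b, S.W b r * S.Lf b (S.W p q) =
      -∑ b, ∑ s, ∑ t, S.W p b * S.W q s * S.W r t * S.Lf t (S.μ b s) := by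
    have : ∑ b, S.W b r * S.Lf b (S.W p q) = -∑ b, S.W r b * S.Lf b (S.W p q) := by
      rw [← Finset.sum_neg_distrib]
      exact Finset.sum_congr rfl fun b _ => by rw [W_swap r b]; ring
    rw [this, key, Finset.sum_comm, neg_inj]
    refine Finset.sum_congr rfl fun b _ => ?_
    rw [Finset.sum_comm]
    exact Finset.sum_congr rfl fun s _ => Finset.sum_congr rfl fun t _ => by ring
  have h2 : ∑ b, S.W q b * S.Lf b (S.W p r) =
      ∑ b, ∑ s, ∑ t, S.W p b * S.W q s * S.W r t * S.Lf s (S.μ b t) := by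
    rw [key, Finset.sum_comm]
    exact Finset.sum_congr rfl fun b _ => Finset.sum_congr rfl fun s _ =>
      Finset.sum_congr rfl fun t _ => by ring
  rw [key, h1, h2, ← Finset.sum_neg_distrib, ← Finset.sum_add_distrib]
  refine Finset.sum_congr rfl fun b _ => ?_
  rw [← Finset.sum_neg_distrib, ← Finset.sum_add_distrib]
  refine Finset.sum_congr rfl fun s _ => ?_
  rw [← Finset.sum_neg_distrib, ← Finset.sum_add_distrib]
  refine Finset.sum_congr rfl fun t _ => ?_
  have h := S.Lf_μ b s t
  have hs : S.Lf b (S.μ s t) = S.Lf s (S.μ b t) - S.Lf t (S.μ b s) := by rw [h]; ring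
  rw [hs]
  ring

/-- The structure equation of the coframe. -/
theorem d_eps (a : ι) : d D (S.eps a) = ∑ b, S.eps b * S.θ b a := by
  have hor : S.Hor (d D (S.eps a) - ∑ b, S.eps b * S.θ b a) := by
    refine ⟨((eps_alt a).d D).sub (IsAlt.sum fun b _ => (eps_alt b).mul (θ_hor a b).1),
      fun c => ?_⟩
    have : iota (S.e c) (d D (S.eps a)) = S.θ c a := by
      rw [θ, L, lie_apply, iota_eps, d_const_single, zero_add]
    simp only [map_sub, this, map_sum, iota_mul, iota_eps, (θ_hor _ _).2, mul_zero, add_zero,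
      const_mul, sum_single_mul, sub_self]
  -- By closedness this form is `L b Ω`. As `2 Ω` is quadratic in the coframe, every term of its Lie
  -- derivative keeps an undifferentiated factor `eps`, which pulls back to zero. This is the
  -- involutivity of the kernel of a closed form.
  have hΩ : ∀ b, pull S.P (d D (iota (S.e b) S.Ω)) = 0 := fun b => by
    rw [← L_Ω]
    refine eq_zero_of_add_self (R := R) ?_
    rw [← map_add, ← map_add, two_Ω]
    simp [L_smul, L_mul, pull_mul, pull_eps]
  -- Nondegeneracy on `G` recovers the coframe from the contractions of `Ω`, so the previous step
  -- applies to `d (eps a)`.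
  have hε : S.eps a = ∑ b, S.W a b • iota (S.e b) S.Ω := by
    simp only [iota_Ω_eq, Finset.smul_sum, smul_smul]
    rw [Finset.sum_comm]
    simp only [← Finset.sum_smul, ← Matrix.mul_apply, S.W_mul, Matrix.one_apply]
    simp
  have h := hor.pull_eq
  have h0 : pull S.P (d D (S.eps a)) = 0 := by
    rw [hε, map_sum, map_sum]
    refine Finset.sum_eq_zero fun b _ => ?_
    rw [d_smul, map_add, pull_mul, map_smul, hΩ, iota_Ω_eq]
    simp [pull_eps]
  rw [map_sub, h0, map_sum] at h
  simp only [pull_mul, pull_eps, zero_mul, Finset.sum_const_zero, sub_zero] at h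
  exact sub_eq_zero.mp h.symm

/-! ### The identities of a differential graded Lie algebra -/

/-- In the expansion the terms with `d (L a F)` cancel; those with `d (eps a)` cancel those with `L
b (eps a)` by the structure equation; and the double sum of `eps b * eps a * L b (L a F)` pairs an
antisymmetric factor with a symmetric one. -/
theorem dF_dF {F : ListForm κ R} (hF : S.Hor F) : S.dF (S.dF F) = 0 := by
  have hanti : ∑ b, ∑ a, S.eps b * (S.eps a * S.L b (S.L a F)) = 0 := by
    refine eq_zero_of_add_self (R := R) ?_
    conv_lhs => rhs; rw [Finset.sum_comm]
    rw [← Finset.sum_add_distrib]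
    refine Finset.sum_eq_zero fun b _ => ?_
    rw [← Finset.sum_add_distrib]
    refine Finset.sum_eq_zero fun a _ => ?_
    rw [L_L a b hF.1, ← mul_assoc, ← mul_assoc, mul_comm_of_odd (grade_eps b), grade_eps]
    simp
  have h1 : ∑ a, d D (S.eps a) * S.L a F = ∑ b, ∑ a, S.eps b * (S.θ b a * S.L a F) := by
    rw [Finset.sum_comm]
    simp only [d_eps, Finset.sum_mul, mul_assoc]
  rw [dF]
  nth_rw 1 [dF]
  rw [map_sub, d_d D S.D_comm, map_sum]
  simp only [dF, map_sub, map_sum, L_mul, L_d, d_mul, grade_eps, mul_sub, mul_add,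
    Finset.mul_sum, Finset.sum_add_distrib, Finset.sum_sub_distrib, neg_mul,
    Finset.sum_neg_distrib]
  rw [hanti, h1]
  simp only [θ]
  abel

theorem brk_symm {F G : ListForm κ R} {i j : ℕ} (hF : grade F = (-1 : R) ^ i • F)
    (hG : grade G = (-1 : R) ^ j • G) : S.brk F G = -((-1 : R) ^ (i * j) • S.brk G F) := by
  have hL : ∀ a b, S.L a F * S.L b G = (-1 : R) ^ (i * j) • (S.L b G * S.L a F) := fun a b =>
    mul_comm_of_grade (by rw [← L_grade, hF]; rcases neg_one_pow_eq_or R i with h | h <;> simp [h])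
      (by rw [← L_grade, hG]; rcases neg_one_pow_eq_or R j with h | h <;> simp [h])
  rw [brk, brk, Finset.sum_comm, Finset.smul_sum, ← Finset.sum_neg_distrib]
  refine Finset.sum_congr rfl fun a _ => ?_
  rw [Finset.smul_sum, ← Finset.sum_neg_distrib]
  refine Finset.sum_congr rfl fun b _ => ?_
  rw [hL, W_swap, neg_smul, smul_comm]

/-- Commuting `dF` past `L a` and `L b` produces one sum with `θ` for each factor. The two terms of
`dF_const_W` are their negatives. -/
theorem dF_brk {F G : ListForm κ R} (hF : S.Hor F) (hG : S.Hor G) :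
    S.dF (S.brk F G) = S.brk (S.dF F) G + S.brk (grade F) (S.dF G) := by
  -- The odd form `θ` is moved to the front; the sign this costs is absorbed by the grading on `F`.
  have hθ : ∀ a b c d, S.L a (grade F) * (S.θ b c * S.L d G) =
      S.θ b c * (S.L a F * S.L d G) := fun a b c d => by
    rw [← mul_assoc, ← mul_assoc, L_grade, mul_comm_of_odd (grade_θ c b)]
  have h1 : ∑ a, ∑ b, S.W a b • (∑ c, S.θ a c * S.L c F) * S.L b G =
      ∑ a, ∑ b, (∑ c, S.W c b • S.θ c a) * (S.L a F * S.L b G) := by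
    have : ∀ a b, S.W a b • (∑ c, S.θ a c * S.L c F) * S.L b G =
        ∑ c, S.W a b • S.θ a c * (S.L c F * S.L b G) := fun a b => by
      simp only [Finset.smul_sum, Finset.sum_mul, smul_mul_assoc, mul_assoc]
    simp only [this, Finset.sum_mul]
    rw [Finset.sum_comm]
    conv_rhs => rw [Finset.sum_comm]
    exact Finset.sum_congr rfl fun b _ => Finset.sum_comm
  have h2 : ∑ a, ∑ b, S.W a b • (S.L a (grade F) * ∑ c, S.θ b c * S.L c G) =
      ∑ a, ∑ b, (∑ c, S.W a c • S.θ c b) * (S.L a F * S.L b G) := by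
    refine Finset.sum_congr rfl fun a _ => ?_
    simp only [Finset.mul_sum, hθ, Finset.smul_sum, Finset.sum_mul, smul_mul_assoc]
    exact Finset.sum_comm
  have e : ∀ a b, S.dF (S.W a b • (S.L a F * S.L b G)) =
      S.W a b • (S.L a (S.dF F) * S.L b G) + S.W a b • (S.L a (grade F) * S.L b (S.dF G)) +
      (S.W a b • (∑ c, S.θ a c * S.L c F) * S.L b G +
        S.W a b • (S.L a (grade F) * ∑ c, S.θ b c * S.L c G) -
        ((∑ c, S.W c b • S.θ c a) * (S.L a F * S.L b G) +
        (∑ c, S.W a c • S.θ c b) * (S.L a F * S.L b G))) := fun a b => by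
    rw [dF_smul, dF_mul, dF_L hF, dF_L hG, dF_const_W, L_grade, Finset.sum_add_distrib, neg_mul,
      add_mul, add_mul, mul_add, smul_add, smul_add, smul_add, smul_mul_assoc]
    abel
  rw [brk, dF_sum]
  simp only [dF_sum, e, Finset.sum_add_distrib, Finset.sum_sub_distrib]
  rw [h1, h2, brk, brk]
  abel

/-- Each double bracket splits into terms with a derivative of `W` and terms with a second
derivative of one argument. The former match by `poisson_jacobi`; the latter match because the `L a`
commute and `W` is antisymmetric. -/
theorem jacobi_brk {F G H : ListForm κ R} {i j : ℕ} (hF : S.Hor F) (hG : S.Hor G) (hH : S.Hor H)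
    (hi : grade F = (-1 : R) ^ i • F) (hj : grade G = (-1 : R) ^ j • G) :
    S.brk F (S.brk G H) =
      S.brk (S.brk F G) H + (-1 : R) ^ (i * j) • S.brk G (S.brk F H) := by
  have hpow : ∀ (a : ι) (n : ℕ) (F : ListForm κ R), S.L a ((-1 : R) ^ n • F) =
      (-1 : R) ^ n • S.L a F := fun a n F => by
    rcases neg_one_pow_eq_or R n with h | h <;> simp [h]
  have comm : ∀ {F' : ListForm κ R}, grade F' = (-1 : R) ^ i • F' → ∀ a,
      (-1 : R) ^ (i * j) • (S.L a G * F') = F' * S.L a G := fun {F'} h a => by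
    rw [mul_comm_of_grade h (by rw [← L_grade, hj, hpow] : grade (S.L a G) = _)]
  have g1 : ∀ a, grade (S.L a F) = (-1 : R) ^ i • S.L a F := fun a => by
    rw [← L_grade, hi, hpow]
  have g2 : ∀ a b, grade (S.L a (S.L b F)) = (-1 : R) ^ i • S.L a (S.L b F) := fun a b => by
    rw [← L_grade, g1, hpow]
  have e1 : S.brk F (S.brk G H) =
      ∑ a, ∑ b, ∑ c, ∑ d, (S.W a b * S.Lf b (S.W c d)) • (S.L a F * S.L c G * S.L d H) +
      (∑ a, ∑ b, ∑ c, ∑ d, (S.W a b * S.W c d) • (S.L a F * S.L b (S.L c G) * S.L d H) +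
      ∑ a, ∑ b, ∑ c, ∑ d, (S.W a b * S.W c d) • (S.L a F * S.L c G * S.L b (S.L d H))) := by
    simp only [brk, map_sum, L_smul, L_mul, Finset.mul_sum, Finset.smul_sum, mul_add, smul_add,
      mul_smul_comm, smul_smul, Finset.sum_add_distrib, mul_assoc]
  have e2 : S.brk (S.brk F G) H =
      ∑ a, ∑ b, ∑ c, ∑ d, (S.W a b * S.Lf a (S.W c d)) • (S.L c F * S.L d G * S.L b H) +
      (∑ a, ∑ b, ∑ c, ∑ d, (S.W a b * S.W c d) • (S.L a (S.L c F) * S.L d G * S.L b H) +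
      ∑ a, ∑ b, ∑ c, ∑ d, (S.W a b * S.W c d) • (S.L c F * S.L a (S.L d G) * S.L b H)) := by
    simp only [brk, map_sum, L_smul, L_mul, Finset.sum_mul, Finset.smul_sum, add_mul, smul_add,
      smul_mul_assoc, smul_smul, Finset.sum_add_distrib]
  -- The sign is spent on moving the derivatives of `F` in front of those of `G`, so that all three
  -- expansions list `F`, `G`, `H` in this order.
  have e3 : (-1 : R) ^ (i * j) • S.brk G (S.brk F H) =
      ∑ a, ∑ b, ∑ c, ∑ d, (S.W a b * S.Lf b (S.W c d)) • (S.L c F * S.L a G * S.L d H) +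
      (∑ a, ∑ b, ∑ c, ∑ d, (S.W a b * S.W c d) • (S.L b (S.L c F) * S.L a G * S.L d H) +
      ∑ a, ∑ b, ∑ c, ∑ d, (S.W a b * S.W c d) • (S.L c F * S.L a G * S.L b (S.L d H))) := by
    simp only [← comm (g1 _), ← comm (g2 _ _), smul_mul_assoc, smul_comm _ ((-1 : R) ^ (i * j)),
      ← Finset.smul_sum, ← smul_add]
    congr 1
    simp only [brk, map_sum, L_smul, L_mul, Finset.mul_sum, Finset.smul_sum, mul_add, smul_add,
      mul_smul_comm, smul_smul, Finset.sum_add_distrib, mul_assoc]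
  have c1 : ∑ a, ∑ b, ∑ c, ∑ d, (S.W a b * S.W c d) • (S.L c F * S.L a (S.L d G) * S.L b H) =
      ∑ a, ∑ b, ∑ c, ∑ d, (S.W a b * S.W c d) • (S.L a F * S.L b (S.L c G) * S.L d H) := by
    rw [← sum_sum_sum_sum_swap]
    exact Finset.sum_congr rfl fun a _ => Finset.sum_congr rfl fun b _ => Finset.sum_congr rfl
      fun c _ => Finset.sum_congr rfl fun d _ => by rw [mul_comm, L_L c b hG.1]
  have c2 : ∑ a, ∑ b, ∑ c, ∑ d, (S.W a b * S.W c d) • (S.L c F * S.L a G * S.L b (S.L d H)) =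
      ∑ a, ∑ b, ∑ c, ∑ d, (S.W a b * S.W c d) • (S.L a F * S.L c G * S.L b (S.L d H)) := by
    rw [← sum_sum_sum_sum_swap]
    exact Finset.sum_congr rfl fun a _ => Finset.sum_congr rfl fun b _ => Finset.sum_congr rfl
      fun c _ => Finset.sum_congr rfl fun d _ => by rw [mul_comm, L_L d b hH.1]
  -- Second derivatives of `F` occur only on the right-hand side; the antisymmetry of `W` makes the
  -- two sums cancel. Those of `G` and of `H` occur once on each side.
  have c3 : ∑ a, ∑ b, ∑ c, ∑ d, (S.W a b * S.W c d) • (S.L b (S.L c F) * S.L a G * S.L d H) =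
      -∑ a, ∑ b, ∑ c, ∑ d, (S.W a b * S.W c d) • (S.L a (S.L c F) * S.L d G * S.L b H) := by
    rw [← sum_sum_sum_sum_cycle]
    simp only [← Finset.sum_neg_distrib]
    exact Finset.sum_congr rfl fun a _ => Finset.sum_congr rfl fun b _ => Finset.sum_congr rfl
      fun c _ => Finset.sum_congr rfl fun d _ => by
        rw [W_swap c d, L_L c a hF.1, neg_mul, neg_smul, mul_comm]
  have c4 : ∑ a, ∑ b, ∑ c, ∑ d, (S.W a b * S.Lf b (S.W c d)) • (S.L a F * S.L c G * S.L d H) =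
      ∑ a, ∑ b, ∑ c, ∑ d, (S.W a b * S.Lf a (S.W c d)) • (S.L c F * S.L d G * S.L b H) +
      ∑ a, ∑ b, ∑ c, ∑ d, (S.W a b * S.Lf b (S.W c d)) • (S.L c F * S.L a G * S.L d H) := by
    have t1 : ∑ a, ∑ b, ∑ c, ∑ d, (S.W a b * S.Lf b (S.W c d)) •
        (S.L a F * S.L c G * S.L d H) = ∑ p, ∑ q, ∑ r, (∑ b, S.W p b * S.Lf b (S.W q r)) •
          (S.L p F * S.L q G * S.L r H) := by
      simp only [Finset.sum_smul]
      refine Finset.sum_congr rfl fun p _ => ?_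
      rw [Finset.sum_comm]
      exact Finset.sum_congr rfl fun q _ => Finset.sum_comm
    have t2 : ∑ a, ∑ b, ∑ c, ∑ d, (S.W a b * S.Lf a (S.W c d)) •
        (S.L c F * S.L d G * S.L b H) = ∑ p, ∑ q, ∑ r, (∑ b, S.W b r * S.Lf b (S.W p q)) •
          (S.L p F * S.L q G * S.L r H) := by
      rw [← sum_sum_sum_sum_swap]
      simp only [Finset.sum_smul]
      exact Finset.sum_congr rfl fun p _ => Finset.sum_congr rfl fun q _ => Finset.sum_comm
    have t3 : ∑ a, ∑ b, ∑ c, ∑ d, (S.W a b * S.Lf b (S.W c d)) •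
        (S.L c F * S.L a G * S.L d H) = ∑ p, ∑ q, ∑ r, (∑ b, S.W q b * S.Lf b (S.W p r)) •
          (S.L p F * S.L q G * S.L r H) := by
      simp only [Finset.sum_smul]
      conv_rhs => rw [Finset.sum_comm]
      refine Finset.sum_congr rfl fun p _ => ?_
      rw [Finset.sum_comm]
      exact Finset.sum_congr rfl fun q _ => Finset.sum_comm
    rw [t1, t2, t3]
    simp only [← Finset.sum_add_distrib, ← add_smul]
    exact Finset.sum_congr rfl fun p _ => Finset.sum_congr rfl fun q _ => Finset.sum_congr rfl
      fun r _ => by rw [poisson_jacobi, Finset.sum_add_distrib]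
  rw [e1, e2, e3, c1, c2, c3, c4]
  abel

end FlatFrame

end

section

/-! ### Explicit formulas on lists of given length -/

namespace ListForm

variable {κ R : Type*} [CommRing R]

theorem removeNth_succ_eq {α : Type*} {n : ℕ} (v : Fin (n + 2) → α) (j : Fin (n + 1)) :
    (Fin.succ j).removeNth v = Fin.cons (v 0) (j.removeNth (Fin.tail v)) := by
  funext i
  refine Fin.cases ?_ (fun i => ?_) i
  · simp [Fin.removeNth]
  · simp [Fin.removeNth, Fin.tail]

theorem ofFn_cons {α : Type*} {n : ℕ} (x : α) (v : Fin n → α) :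
    List.ofFn (Fin.cons x v : Fin (n + 1) → α) = x :: List.ofFn v := by
  simp [List.ofFn_succ]

/-- The unrolled recursion has the shape of `extDeriv_apply`, with which `d_locForm` compares it. -/
theorem d_ofFn [Algebra ℝ R] (D : κ → Derivation ℝ R R) {n : ℕ} (F : ListForm κ R)
    (v : Fin (n + 1) → κ) :
    d D F (List.ofFn v) = ∑ j : Fin (n + 1), (-1) ^ (j : ℕ) * D (v j) (F (List.ofFn (j.removeNth v))) := by
  induction n generalizing F with
  | zero =>
    rw [List.ofFn_succ, d_cons]
    simp
  | succ n ih =>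
    rw [List.ofFn_succ, d_cons, Fin.sum_univ_succ]
    rw [show (fun i : Fin (n + 1) => v i.succ) = Fin.tail v from rfl, ih]
    simp only [removeNth_succ_eq, ofFn_cons, contr_apply, Fin.val_succ, pow_succ, Fin.val_zero,
      pow_zero, one_mul, mul_neg_one, neg_mul, Finset.sum_neg_distrib, sub_eq_add_neg]
    rfl

theorem covector_mul_ofFn (θ : κ → R) (H : ListForm κ R) {n : ℕ} (v : Fin (n + 1) → κ) :
    (covector θ * H) (List.ofFn v) =
      ∑ j : Fin (n + 1), (-1) ^ (j : ℕ) * (θ (v j) * H (List.ofFn (j.removeNth v))) := by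
  induction n generalizing H with
  | zero =>
    rw [List.ofFn_succ, mul_cons, contr_covector, const_mul]
    simp [mul_nil, grade_apply]
  | succ n ih =>
    rw [List.ofFn_succ, mul_cons, Fin.sum_univ_succ, contr_covector, const_mul, grade_covector,
      neg_mul, neg_apply, show (fun i : Fin (n + 1) => v i.succ) = Fin.tail v from rfl, ih]
    simp only [removeNth_succ_eq, ofFn_cons, contr_apply, Fin.val_succ, pow_succ, Fin.val_zero,
      pow_zero, one_mul, mul_neg_one, neg_mul, Finset.sum_neg_distrib]
    rfl

/-- Multiplication by one covector is Laplace expansion along the first row. The absence of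
factorials fixes the normalisation of the shuffle product. -/
theorem prod_covector_ofFn {n : ℕ} (h : Fin n → κ → R) (v : Fin n → κ) :
    (List.ofFn fun i => (covector (h i) : ListForm κ R)).prod (List.ofFn v) =
      (Matrix.of fun i j => h i (v j)).det := by
  induction n with
  | zero =>
    simp only [List.ofFn_zero, List.prod_nil, Matrix.det_fin_zero]
    rfl
  | succ n ih =>
    rw [List.ofFn_succ, List.prod_cons, covector_mul_ofFn, Matrix.det_succ_row_zero]
    refine Finset.sum_congr rfl fun j _ => ?_
    rw [ih, mul_assoc]
    rfl

/-- Functions on lists supported on the lists of length `n`. -/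
def IsHomogeneous (n : ℕ) (F : ListForm κ R) : Prop := ∀ l, l.length ≠ n → F l = 0

theorem IsHomogeneous.contr {n : ℕ} {F : ListForm κ R} (hF : IsHomogeneous (n + 1) F) (k : κ) :
    IsHomogeneous n (contr k F) :=
  fun l hl => hF _ fun h => hl (by simpa using h)

theorem IsHomogeneous.grade_eq {n : ℕ} {F : ListForm κ R} (hF : IsHomogeneous n F) :
    grade F = (-1 : R) ^ n • F := by
  ext l
  rw [grade_apply, smul_apply]
  by_cases hl : l.length = n
  · rw [hl]
  · rw [hF l hl, mul_zero, mul_zero]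

theorem IsHomogeneous.grade {n : ℕ} {F : ListForm κ R} (hF : IsHomogeneous n F) :
    IsHomogeneous n (grade F) :=
  fun l hl => by rw [grade_apply, hF l hl, mul_zero]

theorem IsHomogeneous.ext {n : ℕ} {F G : ListForm κ R} (hF : IsHomogeneous n F)
    (hG : IsHomogeneous n G) (h : ∀ v : Fin n → κ, F (List.ofFn v) = G (List.ofFn v)) : F = G := by
  ext l
  by_cases hl : l.length = n
  · subst hl
    simpa using h l.get
  · rw [hF l hl, hG l hl]

theorem IsHomogeneous.mul {p q : ℕ} {F G : ListForm κ R} (hF : IsHomogeneous p F)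
    (hG : IsHomogeneous q G) : IsHomogeneous (p + q) (F * G) := by
  intro l hl
  induction l generalizing p q F G with
  | nil =>
    rw [mul_nil]
    by_cases hp : p = 0
    · rw [hG [] (by simp at hl ⊢; omega), mul_zero]
    · rw [hF [] (by simp; omega), zero_mul]
  | cons k l ih =>
    rw [mul_cons]
    have h1 : (ListForm.contr k F * G) l = 0 := by
      cases p with
      | zero =>
        have : ListForm.contr k F = 0 := by
          ext l
          exact hF _ (by simp)
        rw [this, zero_mul, zero_apply]
      | succ p => exact ih (hF.contr k) hG (by simp at hl; omega)
    have h2 : (ListForm.grade F * ListForm.contr k G) l = 0 := by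
      cases q with
      | zero =>
        have : ListForm.contr k G = 0 := by
          ext l
          exact hG _ (by simp)
        rw [this, mul_zero, zero_apply]
      | succ q => exact ih hF.grade (hG.contr k) (by simp at hl; omega)
    rw [h1, h2, add_zero]

theorem isHomogeneous_covector (θ : κ → R) : IsHomogeneous 1 (covector θ) := by
  intro l hl
  rcases l with _ | ⟨k, _ | ⟨k', l⟩⟩
  · rfl
  · simp at hl
  · rfl

theorem isHomogeneous_prod_covector {n : ℕ} (h : Fin n → κ → R) :
    IsHomogeneous n (List.ofFn fun i => (covector (h i) : ListForm κ R)).prod := by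
  induction n with
  | zero =>
    intro l hl
    cases l with
    | nil => simp at hl
    | cons k l => rfl
  | succ n ih =>
    rw [List.ofFn_succ, List.prod_cons]
    exact fun l hl => (isHomogeneous_covector _).mul (ih _) l fun h => hl (h.trans (add_comm 1 n))

theorem IsHomogeneous.add {n : ℕ} {F G : ListForm κ R} (hF : IsHomogeneous n F)
    (hG : IsHomogeneous n G) : IsHomogeneous n (F + G) :=
  fun l hl => by rw [add_apply, hF l hl, hG l hl, add_zero]

theorem IsHomogeneous.smul {n : ℕ} {F : ListForm κ R} (r : R) (hF : IsHomogeneous n F) :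
    IsHomogeneous n (r • F) :=
  fun l hl => by rw [smul_apply, hF l hl, mul_zero]

end ListForm

/-! ### Alternating maps as functions on lists of vectors -/

open ListForm

section ToListForm

variable {W : Type*} [AddCommGroup W] [Module ℝ W]

theorem alternatingMap_sum_apply {ι α : Type*} (s : Finset α) (f : α → W [⋀^ι]→ₗ[ℝ] ℝ)
    (v : ι → W) : (∑ x ∈ s, f x) v = ∑ x ∈ s, f x v :=
  map_sum (AddMonoidHom.mk' (fun g : W [⋀^ι]→ₗ[ℝ] ℝ => g v) fun _ _ => rfl) f s

/-- The function on lists of vectors given by an alternating map. -/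
def toListForm {n : ℕ} (a : W [⋀^Fin n]→ₗ[ℝ] ℝ) : ListForm W ℝ := fun l =>
  if h : l.length = n then a fun i => l.get (i.cast h.symm) else 0

theorem toListForm_ofFn {n : ℕ} (a : W [⋀^Fin n]→ₗ[ℝ] ℝ) (v : Fin n → W) :
    toListForm a (List.ofFn v) = a v := by
  rw [toListForm, dif_pos (List.length_ofFn (f := v))]
  congr 1
  funext i
  simp

theorem isHomogeneous_toListForm {n : ℕ} (a : W [⋀^Fin n]→ₗ[ℝ] ℝ) :
    IsHomogeneous n (toListForm a) := fun _ hl => dif_neg hl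

theorem toListForm_add {n : ℕ} (a b : W [⋀^Fin n]→ₗ[ℝ] ℝ) :
    toListForm (a + b) = toListForm a + toListForm b :=
  (isHomogeneous_toListForm _).ext ((isHomogeneous_toListForm _).add (isHomogeneous_toListForm _))
    fun v => by simp [toListForm_ofFn]

theorem toListForm_smul {n : ℕ} (r : ℝ) (a : W [⋀^Fin n]→ₗ[ℝ] ℝ) :
    toListForm (r • a) = r • toListForm a :=
  (isHomogeneous_toListForm _).ext ((isHomogeneous_toListForm _).smul r)
    fun v => by simp [toListForm_ofFn]

theorem toListForm_zero {n : ℕ} : toListForm (0 : W [⋀^Fin n]→ₗ[ℝ] ℝ) = 0 := by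
  simpa using toListForm_smul 0 (0 : W [⋀^Fin n]→ₗ[ℝ] ℝ)

theorem contr_toListForm {n : ℕ} (a : W [⋀^Fin (n + 1)]→ₗ[ℝ] ℝ) (w : W) :
    contr w (toListForm a) = toListForm (AlternatingMap.curryLeft a w) :=
  ((isHomogeneous_toListForm _).contr w).ext (isHomogeneous_toListForm _) fun v => by
    rw [contr_apply, ← ofFn_cons, toListForm_ofFn, toListForm_ofFn]
    rfl

theorem wedge_add_left {p q : ℕ} (a a' : W [⋀^Fin p]→ₗ[ℝ] ℝ) (b : W [⋀^Fin q]→ₗ[ℝ] ℝ) :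
    wedge (a + a') b = wedge a b + wedge a' b := by
  ext v
  simp only [wedge, ← AlternatingMap.domCoprod'_apply, TensorProduct.add_tmul, map_add]
  simp

theorem wedge_add_right {p q : ℕ} (a : W [⋀^Fin p]→ₗ[ℝ] ℝ) (b b' : W [⋀^Fin q]→ₗ[ℝ] ℝ) :
    wedge a (b + b') = wedge a b + wedge a b' := by
  ext v
  simp only [wedge, ← AlternatingMap.domCoprod'_apply, TensorProduct.tmul_add, map_add]
  simp

theorem wedge_smul_left {p q : ℕ} (r : ℝ) (a : W [⋀^Fin p]→ₗ[ℝ] ℝ) (b : W [⋀^Fin q]→ₗ[ℝ] ℝ) :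
    wedge (r • a) b = r • wedge a b := by
  ext v
  simp only [wedge, ← AlternatingMap.domCoprod'_apply, ← TensorProduct.smul_tmul', map_smul]
  simp

theorem wedge_smul_right {p q : ℕ} (r : ℝ) (a : W [⋀^Fin p]→ₗ[ℝ] ℝ) (b : W [⋀^Fin q]→ₗ[ℝ] ℝ) :
    wedge a (r • b) = r • wedge a b := by
  ext v
  simp only [wedge, ← AlternatingMap.domCoprod'_apply, TensorProduct.tmul_smul, map_smul]
  simp

/-- The alternating form `v ↦ det (h i (v j))`. -/
def detForm {ι : Type*} [Fintype ι] [DecidableEq ι] (h : ι → W →ₗ[ℝ] ℝ) : W [⋀^ι]→ₗ[ℝ] ℝ :=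
  MultilinearMap.alternatization ((MultilinearMap.mkPiAlgebra ℝ ι ℝ).compLinearMap h)

theorem detForm_apply {ι : Type*} [Fintype ι] [DecidableEq ι] (h : ι → W →ₗ[ℝ] ℝ) (v : ι → W) :
    detForm h v = (Matrix.of fun i j => h i (v j)).det := by
  rw [detForm, MultilinearMap.alternatization_apply, ← Matrix.det_transpose, Matrix.det_apply]
  refine Finset.sum_congr rfl fun σ _ => ?_
  simp

/-- Both determinants are alternatizations of products of covectors, and alternatization turns the
plain product of multilinear maps into the shuffle product. -/
theorem domCoprod_detForm {ι ι' : Type*} [Fintype ι] [DecidableEq ι] [Fintype ι'] [DecidableEq ι']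
    (f : ι → W →ₗ[ℝ] ℝ) (g : ι' → W →ₗ[ℝ] ℝ) :
    (LinearMap.mul' ℝ ℝ).compAlternatingMap ((detForm f).domCoprod (detForm g)) =
      detForm (Sum.elim f g) := by
  rw [detForm, detForm, ← MultilinearMap.domCoprod_alternization]
  ext v
  rw [LinearMap.compAlternatingMap_apply, detForm, MultilinearMap.alternatization_apply,
    MultilinearMap.alternatization_apply, map_sum]
  refine Finset.sum_congr rfl fun σ _ => ?_
  rw [LinearMap.map_smul_of_tower]
  simp [Fintype.prod_sum_type]

theorem wedge_detForm {p q : ℕ} (f : Fin p → W →ₗ[ℝ] ℝ) (g : Fin q → W →ₗ[ℝ] ℝ) :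
    wedge (detForm f) (detForm g) = detForm (Fin.append f g) := by
  rw [wedge, domCoprod_detForm]
  ext v
  rw [AlternatingMap.domDomCongr_apply, detForm_apply, detForm_apply,
    ← Matrix.det_submatrix_equiv_self finSumFinEquiv]
  congr 1
  ext i j
  cases i <;> simp

theorem toListForm_detForm {n : ℕ} (h : Fin n → W →ₗ[ℝ] ℝ) :
    toListForm (detForm h) = (List.ofFn fun i => (covector (h i) : ListForm W ℝ)).prod :=
  (isHomogeneous_toListForm _).ext (isHomogeneous_prod_covector _) fun v => by
    rw [toListForm_ofFn, detForm_apply, prod_covector_ofFn fun i w => h i w]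

theorem alternatingMap_apply_eq_sum {n : ℕ} {κ : Type*} [Fintype κ] (b : Module.Basis κ ℝ W)
    (a : W [⋀^Fin n]→ₗ[ℝ] ℝ) (v : Fin n → W) : a v = ∑ r : Fin n → κ,
      (∏ i, b.coord (r i) (v i)) * a (fun i => b (r i)) := by
  classical
  have hv : v = fun i => ∑ k, b.repr (v i) k • b k := by
    funext i
    exact (b.sum_repr (v i)).symm
  calc a v = a.toMultilinearMap (fun i => ∑ k, b.repr (v i) k • b k) := by
        rw [← hv]; rfl
    _ = _ := by
        rw [MultilinearMap.map_sum]
        refine Finset.sum_congr rfl fun r _ => ?_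
        rw [MultilinearMap.map_smul_univ]
        rfl

/-- Alternatizing a form that is already alternating multiplies it by `n!`; applied to its expansion
in coordinates this gives the determinants. The sum runs over all index tuples, not only increasing
ones, hence the factor. -/
theorem eq_sum_detForm {n : ℕ} {κ : Type*} [Fintype κ] (b : Module.Basis κ ℝ W)
    (a : W [⋀^Fin n]→ₗ[ℝ] ℝ) :
    a = ((n.factorial : ℝ)⁻¹) • ∑ r : Fin n → κ,
      a (fun i => b (r i)) • detForm fun i => b.coord (r i) := by
  have hn : (n.factorial : ℝ) ≠ 0 := by positivity
  rw [eq_inv_smul_iff₀ hn]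
  have h := AlternatingMap.coe_alternatization a
  rw [Fintype.card_fin] at h
  rw [Nat.cast_smul_eq_nsmul, ← h]
  ext v
  rw [MultilinearMap.alternatization_apply, alternatingMap_sum_apply]
  have : ∀ σ : Equiv.Perm (Fin n), Equiv.Perm.sign σ •
      (MultilinearMap.domDomCongr σ (a : MultilinearMap ℝ (fun _ : Fin n => W) ℝ)) v =
      ∑ r : Fin n → κ, a (fun i => b (r i)) *
        (Equiv.Perm.sign σ • ∏ i, b.coord (r i) (v (σ i))) := fun σ => by
    rw [MultilinearMap.domDomCongr_apply]
    change Equiv.Perm.sign σ • a (fun i => v (σ i)) = _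
    rw [alternatingMap_apply_eq_sum b, Finset.smul_sum]
    refine Finset.sum_congr rfl fun r _ => ?_
    rw [mul_comm, mul_smul_comm]
  simp only [this]
  rw [Finset.sum_comm]
  refine Finset.sum_congr rfl fun r _ => ?_
  rw [AlternatingMap.smul_apply, detForm, MultilinearMap.alternatization_apply, smul_eq_mul,
    Finset.mul_sum]
  simp

/-- Both sides are bilinear and the determinant forms span. On these, both products concatenate the
lists of covectors. -/
theorem toListForm_wedge [FiniteDimensional ℝ W] {p q : ℕ} (a : W [⋀^Fin p]→ₗ[ℝ] ℝ)
    (b : W [⋀^Fin q]→ₗ[ℝ] ℝ) : toListForm (wedge a b) = toListForm a * toListForm b := by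
  have hspan : ∀ {n : ℕ} (a : W [⋀^Fin n]→ₗ[ℝ] ℝ), a ∈ Submodule.span ℝ (Set.range detForm) := by
    intro n a
    rw [eq_sum_detForm (Module.finBasis ℝ W) a]
    exact Submodule.smul_mem _ _ (Submodule.sum_mem _ fun r _ => Submodule.smul_mem _ _
      (Submodule.subset_span ⟨_, rfl⟩))
  induction hspan a using Submodule.span_induction with
  | mem a ha =>
    obtain ⟨f, rfl⟩ := ha
    induction hspan b using Submodule.span_induction with
    | mem b hb =>
      obtain ⟨g, rfl⟩ := hb
      rw [wedge_detForm, toListForm_detForm, toListForm_detForm, toListForm_detForm,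
        ← List.prod_append, ← List.ofFn_fin_append]
      congr 2
      funext i
      refine Fin.addCases (fun i => ?_) (fun i => ?_) i <;> simp
    | zero =>
      have : wedge (detForm f) (0 : W [⋀^Fin q]→ₗ[ℝ] ℝ) = 0 := by
        simpa using wedge_smul_right 0 (detForm f) (0 : W [⋀^Fin q]→ₗ[ℝ] ℝ)
      rw [this, toListForm_zero, toListForm_zero, mul_zero]
    | add b b' _ _ hb hb' =>
      rw [wedge_add_right, toListForm_add, hb, hb', toListForm_add, mul_add]
    | smul r b _ hb =>
      rw [wedge_smul_right, toListForm_smul, hb, toListForm_smul, mul_smul_comm]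
  | zero =>
    have : wedge (0 : W [⋀^Fin p]→ₗ[ℝ] ℝ) b = 0 := by
      simpa using wedge_smul_left 0 (0 : W [⋀^Fin p]→ₗ[ℝ] ℝ) b
    rw [this, toListForm_zero, toListForm_zero, zero_mul]
  | add a a' _ _ ha ha' =>
    rw [wedge_add_left, toListForm_add, ha, ha', toListForm_add, add_mul]
  | smul r a _ ha =>
    rw [wedge_smul_left, toListForm_smul, ha, toListForm_smul, smul_mul_assoc]

theorem isAlt_toListForm {n : ℕ} (a : W [⋀^Fin n]→ₗ[ℝ] ℝ) (l₁ : List W) (v w : W) (l₂ : List W) :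
    toListForm a (l₁ ++ v :: w :: l₂) = -toListForm a (l₁ ++ w :: v :: l₂) := by
  induction l₁ generalizing n with
  | nil =>
    rcases n with _ | _ | n
    · rw [isHomogeneous_toListForm a _ (by simp), isHomogeneous_toListForm a _ (by simp), neg_zero]
    · rw [isHomogeneous_toListForm a _ (by simp), isHomogeneous_toListForm a _ (by simp), neg_zero]
    · by_cases hl : l₂.length = n
      · subst hl
        have : ∀ x y : W, toListForm a ([] ++ x :: y :: l₂) =
            a (Fin.cons x (Fin.cons y l₂.get : Fin (l₂.length + 1) → W)) := fun x y => by
          rw [← toListForm_ofFn, ofFn_cons, ofFn_cons, List.ofFn_get]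
          rfl
        rw [this, this, ← a.map_swap _ (show (0 : Fin (l₂.length + 2)) ≠ 1 by simp)]
        congr 1
        funext i
        refine Fin.cases ?_ (fun i => ?_) i
        · simp
        · refine Fin.cases ?_ (fun i => ?_) i
          · simp
          · rw [Function.comp_apply, Equiv.swap_apply_of_ne_of_ne]
            · simp
            · simp
            · simp [Fin.ext_iff]
      · rw [isHomogeneous_toListForm a _ (by simpa using hl),
          isHomogeneous_toListForm a _ (by simpa using hl), neg_zero]
  | cons u l₁ ih =>
    rcases n with _ | n
    · rw [isHomogeneous_toListForm a _ (by simp), isHomogeneous_toListForm a _ (by simp), neg_zero]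
    · change contr u (toListForm a) _ = -contr u (toListForm a) _
      rw [contr_toListForm]
      exact ih _

end ToListForm

end

section

/-! ### Commuting frames of flat distributions -/

section Frame

variable {V : Type*} [NormedAddCommGroup V] [NormedSpace ℝ V] [FiniteDimensional ℝ V]

/-- If `q₀`, `q` are idempotents such that `q₀ q q₀ + (1 - q₀)` and `q q₀ + (1 - q) (1 - q₀)` are
invertible, then `q₀` is injective on the range of `q`. -/
theorem eq_zero_of_idempotents {q₀ q : V →L[ℝ] V} (h₀ : q₀ * q₀ = q₀) (h : q * q = q)
    (hC : IsUnit (q₀ * q * q₀ + (1 - q₀))) (hA : IsUnit (q * q₀ + (1 - q) * (1 - q₀))) {z : V}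
    (hz : q z = z) (hz₀ : q₀ z = 0) : z = 0 := by
  obtain ⟨A, hA⟩ := hA
  obtain ⟨C, hC⟩ := hC
  -- `A` intertwines the idempotents, so `y = A⁻¹ z` lies in the range of `q₀`. There `A` acts as
  -- `q` and `C` as `q₀ q`, whence `z = q y`, `C y = q₀ z = 0` and `y = 0`.
  have hcomm : q * (A : V →L[ℝ] V) = A * q₀ := by
    rw [hA]
    have e1 : q * (q * q₀ + (1 - q) * (1 - q₀)) = q * q * q₀ + (q - q * q) * (1 - q₀) := by
      noncomm_ring
    have e2 : (q * q₀ + (1 - q) * (1 - q₀)) * q₀ = q * (q₀ * q₀) + (1 - q) * (q₀ - q₀ * q₀) := by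
      noncomm_ring
    rw [e1, e2, h, h₀]
    simp
  set y : V := (↑A⁻¹ : V →L[ℝ] V) z with hy
  have hAy : (A : V →L[ℝ] V) y = z := by
    rw [hy, ← mul_apply_eq_comp, A.mul_inv, one_apply_eq_self]
  have hq₀y : q₀ y = y := by
    have : (A : V →L[ℝ] V) (q₀ y) = (A : V →L[ℝ] V) y := by
      rw [← mul_apply_eq_comp, ← hcomm, mul_apply_eq_comp, hAy, hz]
    have h2 := congrArg (↑A⁻¹ : V →L[ℝ] V) this
    simpa only [← mul_apply_eq_comp, A.inv_mul, one_apply_eq_self,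
      one_mul, ← mul_assoc] using h2
  have hzy : z = q y := by
    rw [← hAy, hA]
    simp [hq₀y]
  have hCy : (C : V →L[ℝ] V) y = 0 := by
    rw [hC]
    simp [hq₀y, ← hzy, hz₀]
  have hy0 : y = 0 := by
    have h2 := congrArg (↑C⁻¹ : V →L[ℝ] V) hCy
    simpa only [← mul_apply_eq_comp, C.inv_mul, one_apply_eq_self,
      map_zero] using h2
  rw [hzy, hy0, map_zero]

/-- The kernels of a smooth field of projections `P` that are involutive have a local frame
consisting of commuting vector fields. -/
theorem exists_commuting_frame {U₀ : Set V} (hU₀ : IsOpen U₀) {x : V} (hx : x ∈ U₀)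
    {P : V → V →L[ℝ] V} (hP : ContDiffOn ℝ ∞ P U₀) (hPP : ∀ u ∈ U₀, P u * P u = P u)
    (flat : ∀ u ∈ U₀, ∀ X Y : V → V, ContDiffAt ℝ ∞ X u → ContDiffAt ℝ ∞ Y u →
      (∀ᶠ z in 𝓝 u, P z (X z) = 0) → (∀ᶠ z in 𝓝 u, P z (Y z) = 0) →
      P u (VectorField.lieBracket ℝ X Y u) = 0) :
    ∃ U : Set V, IsOpen U ∧ x ∈ U ∧ U ⊆ U₀ ∧ ∃ (m : ℕ) (e : Fin m → V → V)
      (ε : Fin m → V → V →L[ℝ] ℝ), (∀ a, ContDiffOn ℝ ∞ (e a) U) ∧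
      (∀ a, ContDiffOn ℝ ∞ (ε a) U) ∧
      (∀ u ∈ U, ∀ a, P u (e a u) = 0) ∧
      (∀ u ∈ U, ∀ a b, ε a u (e b u) = if a = b then 1 else 0) ∧
      (∀ u ∈ U, ∀ v, P u v + ∑ a, ε a u v • e a u = v) ∧
      ∀ u ∈ U, ∀ a b, VectorField.lieBracket ℝ (e a) (e b) u = 0 := by
  have : CompleteSpace V := FiniteDimensional.complete ℝ V
  set Q : V → V →L[ℝ] V := fun u => 1 - P u with hQdef
  have hQ : ContDiffOn ℝ ∞ Q U₀ := contDiffOn_const.sub hP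
  have hQQ : ∀ u ∈ U₀, Q u * Q u = Q u := fun u hu => by
    have : Q u * Q u = 1 - P u - P u + P u * P u := by
      simp only [hQdef]
      noncomm_ring
    rw [this, hPP u hu]
    simp [hQdef]
  have hPQ : ∀ u ∈ U₀, P u * Q u = 0 := fun u hu => by
    simp only [hQdef, mul_sub, mul_one, hPP u hu, sub_self]
  -- Both operators equal `1` at `x`, hence are invertible nearby. `C` inverts `Q x` on the range of
  -- `Q u`, and `A` carries the range of `Q x` to that of `Q u`.
  set C : V → V →L[ℝ] V := fun u => Q x * Q u * Q x + (1 - Q x) with hCdef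
  set A : V → V →L[ℝ] V := fun u => Q u * Q x + (1 - Q u) * (1 - Q x) with hAdef
  have mulD : ∀ {f g : V → V →L[ℝ] V}, ContDiffOn ℝ ∞ f U₀ → ContDiffOn ℝ ∞ g U₀ →
      ContDiffOn ℝ ∞ (fun u => f u * g u) U₀ := fun hf hg => hf.clm_comp hg
  have hC : ContDiffOn ℝ ∞ C U₀ :=
    (mulD (mulD contDiffOn_const hQ) contDiffOn_const).add contDiffOn_const
  have hA : ContDiffOn ℝ ∞ A U₀ :=
    (mulD hQ contDiffOn_const).add (mulD (contDiffOn_const.sub hQ) contDiffOn_const)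
  have hCx : C x = 1 := by
    simp only [hCdef, hQQ x hx]
    abel
  have hAx : A x = 1 := by
    have : A x = 1 - Q x - Q x + Q x * Q x + Q x * Q x := by
      simp only [hAdef]
      noncomm_ring
    rw [this, hQQ x hx]
    abel
  set U : Set V := (U₀ ∩ C ⁻¹' {c | IsUnit c}) ∩ (U₀ ∩ A ⁻¹' {c | IsUnit c}) with hUdef
  have hU : IsOpen U :=
    (hC.continuousOn.isOpen_inter_preimage hU₀ Units.isOpen).inter
      (hA.continuousOn.isOpen_inter_preimage hU₀ Units.isOpen)
  have hxU : x ∈ U := ⟨⟨hx, by simp [hCx]⟩, ⟨hx, by simp [hAx]⟩⟩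
  have hUU₀ : U ⊆ U₀ := fun u hu => hu.1.1
  have hinj : ∀ u ∈ U, ∀ z, Q u z = z → Q x z = 0 → z = 0 := fun u hu z hz hz₀ =>
    eq_zero_of_idempotents (hQQ x hx) (hQQ u (hUU₀ hu)) hu.1.2 hu.2.2 hz hz₀
  let G : Submodule ℝ V := LinearMap.ker (P x : V →ₗ[ℝ] V)
  let g := Module.finBasis ℝ G
  let Dinv : V → V →L[ℝ] V := fun u => Ring.inverse (C u)
  -- The frame is normalised by `Q x (e a u) = g a`, a constant vector. It is this choice that makes
  -- the frame commute.
  let e : Fin (Module.finrank ℝ G) → V → V := fun a u => Q u (Dinv u (g a : V))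
  let lam : Fin (Module.finrank ℝ G) → V →L[ℝ] ℝ := fun a => LinearMap.toContinuousLinearMap
    (g.coord a ∘ₗ (Q x : V →ₗ[ℝ] V).codRestrict G fun v => by
      have := hPQ x hx
      exact congrFun (congrArg DFunLike.coe this) v)
  let ε : Fin (Module.finrank ℝ G) → V → V →L[ℝ] ℝ := fun a u => lam a ∘L Q u
  have hDinv : ContDiffOn ℝ ∞ Dinv U := fun u hu => by
    obtain ⟨c, hc⟩ := hu.1.2
    have h1 : ContDiffAt ℝ ∞ Ring.inverse (C u) := hc ▸ contDiffAt_ringInverse ℝ c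
    exact h1.comp_contDiffWithinAt u ((hC u hu.1.1).mono hUU₀)
  have he : ∀ a, ContDiffOn ℝ ∞ (e a) U := fun a =>
    (hQ.mono hUU₀).clm_apply (hDinv.clm_apply contDiffOn_const)
  have hQg : ∀ a, Q x (g a : V) = g a := fun a => by
    have : P x (g a : V) = 0 := (g a).2
    simp [hQdef, this]
  have hQxe : ∀ u ∈ U, ∀ a, Q x (e a u) = g a := fun u hu a => by
    obtain ⟨c, hc⟩ := hu.1.2
    have hD : Dinv u = (↑c⁻¹ : V →L[ℝ] V) := by
      simp only [Dinv, ← hc, Ring.inverse_unit]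
    have h1 : C u * Q x = Q x * C u := by
      have e1 : C u * Q x = Q x * Q u * (Q x * Q x) + (Q x - Q x * Q x) := by
        simp only [hCdef]
        noncomm_ring
      have e2 : Q x * C u = (Q x * Q x) * Q u * Q x + (Q x - Q x * Q x) := by
        simp only [hCdef]
        noncomm_ring
      rw [e1, e2, hQQ x hx]
    have h1' : C u * Q x = Q x * Q u * Q x := by
      have e1 : C u * Q x = Q x * Q u * (Q x * Q x) + (Q x - Q x * Q x) := by
        simp only [hCdef]
        noncomm_ring
      rw [e1, hQQ x hx, sub_self, add_zero]
    have h2 : Q x * (↑c⁻¹ : V →L[ℝ] V) = ↑c⁻¹ * Q x := by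
      rw [Units.mul_inv_eq_iff_eq_mul, mul_assoc, hc, ← h1, ← hc, ← mul_assoc, c.inv_mul, one_mul]
    have h3 : Q x (Dinv u (g a : V)) = Dinv u (g a : V) := by
      rw [hD, ← mul_apply_eq_comp, h2, mul_apply_eq_comp, hQg]
    have h4 : Q x (Q u (Q x (Dinv u (g a : V)))) = C u (Q x (Dinv u (g a : V))) := by
      simpa only [mul_apply_eq_comp] using
        (congrFun (congrArg DFunLike.coe h1') (Dinv u (g a : V))).symm
    calc Q x (e a u) = Q x (Q u (Q x (Dinv u (g a : V)))) := by rw [h3]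
      _ = C u (Dinv u (g a : V)) := by rw [h4, h3]
      _ = g a := by
        rw [hD, ← hc, ← mul_apply_eq_comp, c.mul_inv, one_apply_eq_self]
  have hlam : ∀ a v, lam a v = g.coord a ⟨Q x v, congrFun (congrArg DFunLike.coe (hPQ x hx)) v⟩ :=
    fun a v => rfl
  have hQe : ∀ u ∈ U, ∀ a, Q u (e a u) = e a u := fun u hu a => by
    change (Q u * Q u) _ = _
    rw [hQQ u (hUU₀ hu)]
  have hPe : ∀ u ∈ U, ∀ a, P u (e a u) = 0 := fun u hu a =>
    congrFun (congrArg DFunLike.coe (hPQ u (hUU₀ hu))) _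
  refine ⟨U, hU, hxU, hUU₀, _, e, ε, he, fun a => contDiffOn_const.clm_comp (hQ.mono hUU₀),
    hPe, fun u hu a b => ?_, fun u hu v => ?_, fun u hu a b => ?_⟩
  · change lam a (Q u (e b u)) = _
    rw [hQe u hu, hlam]
    have : (⟨Q x (e b u), congrFun (congrArg DFunLike.coe (hPQ x hx)) (e b u)⟩ : G) = g b :=
      Subtype.ext (hQxe u hu b)
    rw [this, Module.Basis.coord_apply, Module.Basis.repr_self, Finsupp.single_apply]
    simp [eq_comm]
  · set w := Q u v with hw
    have hQw : Q u w = w := by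
      change (Q u * Q u) v = _
      rw [hQQ u (hUU₀ hu)]
    -- The difference lies in the range of `Q u` and is killed by `Q x`, which is injective there.
    have key : w - ∑ a, lam a w • e a u = 0 := by
      refine hinj u hu _ ?_ ?_
      · simp only [map_sub, map_sum, map_smul, hQw, hQe u hu]
      · simp only [map_sub, map_sum, map_smul, hQxe u hu, hlam]
        have := congrArg (Subtype.val : G → V)
          (g.sum_repr ⟨Q x w, congrFun (congrArg DFunLike.coe (hPQ x hx)) w⟩)
        rw [sub_eq_zero]
        rw [AddSubmonoidClass.coe_finsetSum] at this
        simpa only [Submodule.coe_smul, Module.Basis.coord_apply] using this.symm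
    have h2 : ∑ a, ε a u v • e a u = w := (sub_eq_zero.mp key).symm
    rw [h2, hw]
    simp [hQdef]
  · have hnear : ∀ᶠ z in 𝓝 u, z ∈ U := hU.mem_nhds hu
    have hdiff : ∀ a, DifferentiableAt ℝ (e a) u := fun a =>
      ((he a).contDiffAt hnear).differentiableAt (by simp)
    have hfd : ∀ a v, Q x (fderiv ℝ (e a) u v) = 0 := fun a v => by
      have h1 : (fun z => Q x (e a z)) =ᶠ[𝓝 u] fun _ => (g a : V) :=
        hnear.mono fun z hz => hQxe z hz a
      have h2 : fderiv ℝ (fun z => Q x (e a z)) u = (Q x).comp (fderiv ℝ (e a) u) :=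
        ((Q x).hasFDerivAt.comp u (hdiff a).hasFDerivAt).fderiv
      have h3 := congrFun (congrArg DFunLike.coe (h2.symm.trans h1.fderiv_eq)) v
      simpa using h3
    -- The bracket lies in the range of `Q u` by flatness, and `Q x` kills it because `Q x (e a)`
    -- and `Q x (e b)` are constant.
    refine hinj u hu _ ?_ ?_
    · have := flat u (hUU₀ hu) (e a) (e b) ((he a).contDiffAt hnear) ((he b).contDiffAt hnear)
        (hnear.mono fun z hz => hPe z hz a) (hnear.mono fun z hz => hPe z hz b)
      simp [hQdef, this]
    · rw [VectorField.lieBracket, map_sub, hfd, hfd, sub_zero]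

end Frame

end

section

/-! ### The algebra of smooth functions on an open set -/

section SmoothFn

variable {V : Type*} [NormedAddCommGroup V] [NormedSpace ℝ V]

/-- The algebra of smooth functions on an open subset of a normed space. -/
def SmoothFn (U : TopologicalSpace.Opens V) : Subalgebra ℝ (U → ℝ) where
  carrier := {f | ∃ g : V → ℝ, ContDiffOn ℝ ∞ g U ∧ ∀ u : U, f u = g u}
  mul_mem' := by
    rintro _ _ ⟨g, hg, h⟩ ⟨g', hg', h'⟩
    exact ⟨fun u => g u * g' u, hg.mul hg', fun u => by rw [Pi.mul_apply, h, h']⟩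
  add_mem' := by
    rintro _ _ ⟨g, hg, h⟩ ⟨g', hg', h'⟩
    exact ⟨fun u => g u + g' u, hg.add hg', fun u => by rw [Pi.add_apply, h, h']⟩
  algebraMap_mem' r := ⟨fun _ => r, contDiffOn_const, fun _ => rfl⟩

namespace SmoothFn

variable {U : TopologicalSpace.Opens V}

/-- The restriction to `U` of a function that is smooth on `U`. -/
def ofFun (g : V → ℝ) (hg : ContDiffOn ℝ ∞ g U) : SmoothFn U := ⟨fun u => g u, g, hg, fun _ => rfl⟩

@[simp] theorem ofFun_apply (g : V → ℝ) (hg : ContDiffOn ℝ ∞ g U) (u : U) :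
    (ofFun g hg).1 u = g u := rfl

@[ext] theorem ext {f g : SmoothFn U} (h : ∀ u : U, f.1 u = g.1 u) : f = g :=
  Subtype.ext (funext h)

/-- A function on the whole space that restricts to `f`. -/
def extension (f : SmoothFn U) : V → ℝ := f.2.choose

theorem contDiffOn_extension (f : SmoothFn U) : ContDiffOn ℝ ∞ (extension f) U := f.2.choose_spec.1

theorem extension_apply (f : SmoothFn U) {u : V} (hu : u ∈ U) : extension f u = f.1 ⟨u, hu⟩ :=
  (f.2.choose_spec.2 ⟨u, hu⟩).symm

/-- `extension` is a choice, arbitrary outside `U`. Since `U` is open, its germ at a point of `U`,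
and hence its derivative there, does not depend on the choice. -/
theorem extension_eventuallyEq (f : SmoothFn U) {g : V → ℝ} (h : ∀ u : U, f.1 u = g u) {u : V}
    (hu : u ∈ U) : (extension f) =ᶠ[𝓝 u] g := by
  filter_upwards [U.2.mem_nhds hu] with z hz
  rw [extension_apply f hz, h]

theorem contDiffAt_extension (f : SmoothFn U) {u : V} (hu : u ∈ U) :
    ContDiffAt ℝ ∞ (extension f) u := (contDiffOn_extension f).contDiffAt (U.2.mem_nhds hu)

theorem differentiableAt_extension (f : SmoothFn U) {u : V} (hu : u ∈ U) :
    DifferentiableAt ℝ (extension f) u := (contDiffAt_extension f hu).differentiableAt (by simp)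

theorem contDiffOn_fderiv_apply {g : V → ℝ} (hg : ContDiffOn ℝ ∞ g U) (v : V) :
    ContDiffOn ℝ ∞ (fun z => fderiv ℝ g z v) U :=
  (hg.fderiv_of_isOpen U.2 (m := ∞) (by simp)).clm_apply contDiffOn_const

/-- The derivative in the direction of a vector. -/
def pd (v : V) : Derivation ℝ (SmoothFn U) (SmoothFn U) :=
  Derivation.mk'
    { toFun := fun f => ofFun (fun z => fderiv ℝ (extension f) z v)
        (contDiffOn_fderiv_apply (contDiffOn_extension f) v)
      map_add' := fun f g => by
        ext u
        have h := extension_eventuallyEq (f + g) (g := fun z => extension f z + extension g z)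
          (fun u => by rw [extension_apply _ u.2, extension_apply _ u.2]; rfl) u.2
        change fderiv ℝ (extension (f + g)) u v =
          fderiv ℝ (extension f) u v + fderiv ℝ (extension g) u v
        rw [h.fderiv_eq, fderiv_fun_add (differentiableAt_extension f u.2)
          (differentiableAt_extension g u.2)]
        rfl
      map_smul' := fun r f => by
        ext u
        have h := extension_eventuallyEq (r • f) (g := fun z => r * extension f z)
          (fun u => by rw [extension_apply _ u.2]; rfl) u.2
        change fderiv ℝ (extension (r • f)) u v = r * fderiv ℝ (extension f) u v
        rw [h.fderiv_eq, fderiv_const_mul (differentiableAt_extension f u.2)]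
        rfl }
    fun f g => by
      ext u
      have h := extension_eventuallyEq (f * g) (g := fun z => extension f z * extension g z)
        (fun u => by rw [extension_apply _ u.2, extension_apply _ u.2]; rfl) u.2
      change fderiv ℝ (extension (f * g)) u v =
        f.1 u * fderiv ℝ (extension g) u v + g.1 u * fderiv ℝ (extension f) u v
      rw [h.fderiv_eq, fderiv_fun_mul (differentiableAt_extension f u.2)
        (differentiableAt_extension g u.2), extension_apply _ u.2, extension_apply _ u.2]
      rfl

theorem pd_apply (v : V) (f : SmoothFn U) {g : V → ℝ} (h : ∀ u : U, f.1 u = g u) (u : U) :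
    (pd v f).1 u = fderiv ℝ g u v :=
  by
  rw [← (extension_eventuallyEq f h u.2).fderiv_eq]
  rfl

theorem pd_pd (v w : V) (f : SmoothFn U) : pd v (pd w f) = pd w (pd v f) := by
  ext u
  have hs : ContDiffAt ℝ ∞ (extension f) (u : V) := contDiffAt_extension f u.2
  have key : ∀ a c : V, (pd a (pd c f)).1 u = fderiv ℝ (fderiv ℝ (extension f)) (u : V) a c := fun a c => by
    rw [pd_apply a (pd c f) (g := fun z => fderiv ℝ (extension f) z c) (fun _ => rfl) u,
      fderiv_clm_apply ((hs.fderiv_right (m := 1) (by rw [one_add_one_eq_two]; exact ENat.LEInfty.out)).differentiableAt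
        one_ne_zero) (differentiableAt_const c)]
    simp
  rw [key, key]
  exact hs.isSymmSndFDerivAt (by
    rw [minSmoothness_of_isRCLikeNormedField]
    exact ENat.LEInfty.out) v w

theorem isUnit_of_ne_zero (f : SmoothFn U) (h : ∀ u, f.1 u ≠ 0) : IsUnit f :=
  IsUnit.of_mul_eq_one (ofFun (fun z => (extension f z)⁻¹) ((contDiffOn_extension f).inv fun z hz => by
    rw [extension_apply _ hz]; exact h _)) (by
      ext u
      change f.1 u * (extension f u)⁻¹ = 1
      rw [extension_apply _ u.2]
      exact mul_inv_cancel₀ (h u))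

/-- Evaluation at a point. -/
def ev (u : U) : SmoothFn U →+* ℝ := (Pi.evalRingHom (fun _ : U => ℝ) u).comp (SmoothFn U).val.toRingHom

@[simp] theorem ev_apply (u : U) (f : SmoothFn U) : ev u f = f.1 u := rfl

end SmoothFn

end SmoothFn

/-! ### Change of coefficients and of index sets -/

namespace ListForm

variable {κ κ' R R' : Type*} [CommRing R] [CommRing R']

/-- Change of coefficients. -/
def map (φ : R →+* R') (F : ListForm κ R) : ListForm κ R' := fun l => φ (F l)

/-- Change of index sets. -/
def comap (b : κ → κ') (F : ListForm κ' R) : ListForm κ R := fun l => F (l.map b)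

theorem map_mul (φ : R →+* R') (F G : ListForm κ R) : map φ (F * G) = map φ F * map φ G := by
  ext l
  induction l generalizing F G with
  | nil => exact _root_.map_mul φ _ _
  | cons k l ih =>
    have h : grade (map φ F) = map φ (grade F) := by
      ext l
      simp [grade_apply, map]
    rw [mul_cons, h]
    change φ ((F * G) (k :: l)) = (map φ (contr k F) * map φ G) l +
      (map φ (grade F) * map φ (contr k G)) l
    rw [← ih, ← ih, mul_cons, map_add]
    rfl

theorem comap_mul (b : κ → κ') (F G : ListForm κ' R) : comap b (F * G) = comap b F * comap b G := by
  ext l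
  induction l generalizing F G with
  | nil => rfl
  | cons k l ih =>
    have h : grade (comap b F) = comap b (grade F) := by
      ext l
      simp [grade_apply, comap]
    rw [mul_cons, h]
    change (F * G) (b k :: l.map b) = (comap b (contr (b k) F) * comap b G) l +
      (comap b (grade F) * comap b (contr (b k) G)) l
    rw [← ih, ← ih, mul_cons]
    rfl

theorem map_add' (φ : R →+* R') (F G : ListForm κ R) : map φ (F + G) = map φ F + map φ G := by
  ext l; exact map_add φ _ _

theorem map_smul' (φ : R →+* R') (r : R) (F : ListForm κ R) : map φ (r • F) = φ r • map φ F := by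
  ext l; exact _root_.map_mul φ _ _

theorem map_sum' (φ : R →+* R') {α : Type*} (s : Finset α) (F : α → ListForm κ R) :
    map φ (∑ a ∈ s, F a) = ∑ a ∈ s, map φ (F a) :=
  map_sum (AddMonoidHom.mk' (map φ) (map_add' φ)) F s

theorem map_iota [Algebra ℝ R] [Algebra ℝ R'] [Fintype κ] (φ : R →+* R') (X : κ → R) (F : ListForm κ R) :
    map φ (iota X F) = iota (fun k => φ (X k)) (map φ F) := by
  ext l
  rw [iota_apply]
  simp only [map]
  rw [iota_apply, map_sum]
  exact Finset.sum_congr rfl fun k _ => _root_.map_mul φ _ _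

theorem map_pull [Algebra ℝ R] [Algebra ℝ R'] [Fintype κ] (φ : R →+* R') (P : κ → κ → R) (F : ListForm κ R) :
    map φ (pull P F) = pull (fun k j => φ (P k j)) (map φ F) := by
  ext l
  induction l generalizing F with
  | nil => rfl
  | cons k l ih =>
    change map φ (pull P (iota (P k) F)) l = pull _ (iota (fun j => φ (P k j)) (map φ F)) l
    rw [ih, map_iota]

end ListForm

open ListForm

/-! ### Components of alternating maps with respect to a family of vectors. -/

section Components

variable {W κ : Type*} [AddCommGroup W] [Module ℝ W] [Fintype κ]

/-- The components of an alternating map on a family of vectors. -/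
def components (b : κ → W) {n : ℕ} (a : W [⋀^Fin n]→ₗ[ℝ] ℝ) : ListForm κ ℝ :=
  comap b (toListForm a)

theorem isHomogeneous_components (b : κ → W) {n : ℕ} (a : W [⋀^Fin n]→ₗ[ℝ] ℝ) :
    IsHomogeneous n (components b a) :=
  fun l hl => isHomogeneous_toListForm a _ (by simpa using hl)

theorem components_ofFn (b : κ → W) {n : ℕ} (a : W [⋀^Fin n]→ₗ[ℝ] ℝ) (r : Fin n → κ) :
    components b a (List.ofFn r) = a (b ∘ r) := by
  rw [components, comap, List.map_ofFn, toListForm_ofFn]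

theorem contr_components (b : κ → W) {n : ℕ} (a : W [⋀^Fin (n + 1)]→ₗ[ℝ] ℝ) (k : κ) :
    contr k (components b a) = components b (AlternatingMap.curryLeft a (b k)) := by
  rw [components, components, ← contr_toListForm]
  rfl

theorem components_add (b : κ → W) {n : ℕ} (a a' : W [⋀^Fin n]→ₗ[ℝ] ℝ) :
    components b (a + a') = components b a + components b a' := by
  rw [components, toListForm_add]; rfl

theorem components_smul (b : κ → W) {n : ℕ} (r : ℝ) (a : W [⋀^Fin n]→ₗ[ℝ] ℝ) :
    components b (r • a) = r • components b a := by
  rw [components, toListForm_smul]; rfl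

theorem components_sum (b : κ → W) {n : ℕ} {α : Type*} (s : Finset α)
    (a : α → W [⋀^Fin n]→ₗ[ℝ] ℝ) :
    components b (∑ x ∈ s, a x) = ∑ x ∈ s, components b (a x) :=
  map_sum (AddMonoidHom.mk' (components b) (components_add b)) a s

theorem components_wedge [FiniteDimensional ℝ W] (b : κ → W) {p q : ℕ} (a : W [⋀^Fin p]→ₗ[ℝ] ℝ)
    (a' : W [⋀^Fin q]→ₗ[ℝ] ℝ) :
    components b (wedge a a') = components b a * components b a' := by
  rw [components, toListForm_wedge, comap_mul]
  rfl

theorem components_injective (b : Module.Basis κ ℝ W) {n : ℕ} {a a' : W [⋀^Fin n]→ₗ[ℝ] ℝ}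
    (h : components b a = components b a') : a = a' :=
  b.ext_alternating fun r _ => by
    have := congrFun h (List.ofFn r)
    rwa [components_ofFn, components_ofFn] at this

theorem isAlt_components (b : κ → W) {n : ℕ} (a : W [⋀^Fin n]→ₗ[ℝ] ℝ) : IsAlt (components b a) :=
  fun l₁ j k l₂ => by
    simp only [components, comap, List.map_append, List.map_cons]
    exact isAlt_toListForm a _ _ _ _

theorem iota_components (b : Module.Basis κ ℝ W) {n : ℕ} (a : W [⋀^Fin (n + 1)]→ₗ[ℝ] ℝ) (w : W) :
    iota (fun k => b.repr w k) (components b a) = components b (AlternatingMap.curryLeft a w) := by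
  conv_rhs => rw [← b.sum_repr w, map_sum, components_sum]
  rw [iota_eq]
  exact Finset.sum_congr rfl fun k _ => by rw [map_smul, components_smul, contr_components]

theorem iota_components_zero (b : κ → W) (a : W [⋀^Fin 0]→ₗ[ℝ] ℝ) (X : κ → ℝ) :
    iota X (components b a) = 0 := by
  ext l
  rw [iota_apply]
  exact Finset.sum_eq_zero fun k _ => by
    rw [isHomogeneous_components b a _ (by simp), mul_zero]

theorem pull_components (b : Module.Basis κ ℝ W) {n : ℕ} (a : W [⋀^Fin n]→ₗ[ℝ] ℝ) (p : W →ₗ[ℝ] W) :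
    pull (fun k j => b.repr (p (b k)) j) (components b a) = components b (a.compLinearMap p) := by
  ext l
  induction l generalizing n with
  | nil =>
    rcases n with _ | n
    · change components b a (List.ofFn Fin.elim0) = components b (a.compLinearMap p) (List.ofFn Fin.elim0)
      rw [components_ofFn, components_ofFn]
      exact congrArg a (Subsingleton.elim _ _)
    · rw [pull_nil, isHomogeneous_components _ _ _ (by simp), isHomogeneous_components _ _ _ (by simp)]
  | cons k l ih =>
    change pull _ (iota (fun j => b.repr (p (b k)) j) (components b a)) l =
      contr k (components b (a.compLinearMap p)) l
    rcases n with _ | n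
    · rw [iota_components_zero, map_zero, contr_apply,
        isHomogeneous_components _ _ _ (by simp)]
      rfl
    · rw [iota_components, ih, contr_components]
      congr 2
      ext v
      change a _ = a _
      congr 1
      funext i
      refine Fin.cases rfl (fun i => rfl) i

end Components

end

section

open ListForm SmoothFn

/-! ### Differential forms on open subsets of a vector space -/

theorem ListForm.IsHomogeneous.d {κ R : Type*} [CommRing R] [Algebra ℝ R]
    (D : κ → Derivation ℝ R R) {n : ℕ} {F : ListForm κ R} (hF : IsHomogeneous n F) :
    IsHomogeneous (n + 1) (ListForm.d D F) := by
  intro l hl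
  induction l generalizing n F with
  | nil => rw [d_nil]
  | cons k l ih =>
    have h1 : F l = 0 := hF l fun h => hl (by simp [h])
    rw [d_cons, h1, map_zero, zero_sub, neg_eq_zero]
    rcases n with _ | n
    · have h2 : ListForm.contr k F = 0 := by
        ext l
        exact hF _ (by simp)
      rw [h2, map_zero]
      rfl
    · exact ih (hF.contr k) (by simpa using hl)

section Local

variable {V : Type*} [NormedAddCommGroup V] [NormedSpace ℝ V] [FiniteDimensional ℝ V]
  {κ : Type*} [Fintype κ]

theorem contDiffAt_of_components (b : Module.Basis κ ℝ V) {n : ℕ} {η : V → V [⋀^Fin n]→L[ℝ] ℝ}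
    {u : V} (h : ∀ r : Fin n → κ, ContDiffAt ℝ ∞ (fun z => η z (b ∘ r)) u) :
    ContDiffAt ℝ ∞ η u := by
  have key : η = fun z => ((n.factorial : ℝ)⁻¹) • ∑ r : Fin n → κ,
      η z (b ∘ r) • toContinuousForm (detForm fun i => b.coord (r i)) := by
    funext z
    ext v
    have := congrArg (fun a : V [⋀^Fin n]→ₗ[ℝ] ℝ => a v) (eq_sum_detForm b (η z).toAlternatingMap)
    simp only [AlternatingMap.smul_apply, alternatingMap_sum_apply] at this
    simp only [ContinuousAlternatingMap.smul_apply, ContinuousAlternatingMap.sum_apply]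
    exact this
  rw [key]
  exact (contDiff_const_smul ((n.factorial : ℝ)⁻¹)).contDiffAt.comp u
    (ContDiffAt.sum fun r _ => (h r).smul contDiffAt_const)

theorem contDiffAt_form_apply_const {n : ℕ} {η : V → V [⋀^Fin n]→L[ℝ] ℝ} {u : V}
    (hη : ContDiffAt ℝ ∞ η u) (v : Fin n → V) : ContDiffAt ℝ ∞ (fun z => η z v) u :=
  (ContinuousAlternatingMap.apply ℝ V ℝ v).contDiff.contDiffAt.comp u hη

theorem contDiffAt_form_apply {n : ℕ} {η : V → V [⋀^Fin n]→L[ℝ] ℝ} {u : V}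
    (hη : ContDiffAt ℝ ∞ η u) {X : Fin n → V → V} (hX : ∀ i, ContDiffAt ℝ ∞ (X i) u) :
    ContDiffAt ℝ ∞ (fun z => η z fun i => X i z) u := by
  let b := Module.finBasis ℝ V
  have key : (fun z => η z fun i => X i z) = fun z => ∑ r : Fin n → Fin (Module.finrank ℝ V),
      (∏ i, b.coord (r i) (X i z)) * η z (fun i => b (r i)) :=
    funext fun z => alternatingMap_apply_eq_sum b (η z).toAlternatingMap _
  rw [key]
  refine ContDiffAt.sum fun r _ => (contDiffAt_prod fun i _ => ?_).mul
    (contDiffAt_form_apply_const hη _)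
  exact (LinearMap.toContinuousLinearMap (b.coord (r i))).contDiff.contDiffAt.comp u (hX i)

theorem contDiffAt_compContinuousLinearMap {n : ℕ} {η : V → V [⋀^Fin n]→L[ℝ] ℝ} {A : V → V →L[ℝ] V}
    {u : V} (hη : ContDiffAt ℝ ∞ η u) (hA : ContDiffAt ℝ ∞ A u) :
    ContDiffAt ℝ ∞ (fun z => (η z).compContinuousLinearMap (A z)) u :=
  contDiffAt_of_components (Module.finBasis ℝ V) fun _ =>
    contDiffAt_form_apply hη fun _ => hA.clm_apply contDiffAt_const

theorem contDiffAt_extDeriv {n : ℕ} {η : V → V [⋀^Fin n]→L[ℝ] ℝ} {u : V}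
    (hη : ContDiffAt ℝ ∞ η u) : ContDiffAt ℝ ∞ (extDeriv η) u := by
  have h : extDeriv η = ⇑(ContinuousAlternatingMap.alternatizeUncurryFinCLM ℝ V ℝ (n := n)) ∘
      fderiv ℝ η := rfl
  rw [h]
  exact (ContinuousLinearMap.contDiff _).contDiffAt.comp u (hη.fderiv_right (m := ∞) (by simp))

variable {U : TopologicalSpace.Opens V} (b : Module.Basis κ ℝ V)

/-- The components of a smooth form on `U`. -/
def locForm {n : ℕ} (η : V → V [⋀^Fin n]→L[ℝ] ℝ) (hη : ∀ u ∈ U, ContDiffAt ℝ ∞ η u) :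
    ListForm κ (SmoothFn U) := fun l =>
  ofFun (fun z => components b (η z).toAlternatingMap l) fun u hu => by
    by_cases hl : l.length = n
    · subst hl
      have h : ∀ z, components b (η z).toAlternatingMap l = η z (b ∘ l.get) := fun z => by
        have := components_ofFn b (η z).toAlternatingMap l.get
        rwa [List.ofFn_get l] at this
      simp only [h]
      exact (contDiffAt_form_apply_const (hη u hu) _).contDiffWithinAt
    · have h : ∀ z, components b (η z).toAlternatingMap l = 0 := fun z =>
        isHomogeneous_components _ _ _ hl
      simp only [h]
      exact contDiffWithinAt_const

theorem map_ev_locForm {n : ℕ} (η : V → V [⋀^Fin n]→L[ℝ] ℝ) (hη : ∀ u ∈ U, ContDiffAt ℝ ∞ η u)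
    (u : U) : map (ev u) (locForm b η hη) = components b (η u).toAlternatingMap := rfl

theorem listForm_ext_ev {F G : ListForm κ (SmoothFn U)} (h : ∀ u : U, map (ev u) F = map (ev u) G) :
    F = G := by
  ext l u
  exact congrFun (h u) l

theorem smoothFn_ext_ev {f g : SmoothFn U} (h : ∀ u : U, ev u f = ev u g) : f = g := SmoothFn.ext h

theorem ev_single [DecidableEq κ] (u : U) (k j : κ) :
    ev u (Pi.single (M := fun _ => SmoothFn U) k 1 j) = if k = j then 1 else 0 := by
  rw [Pi.single_apply, apply_ite (ev u), map_one, map_zero]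
  simp only [eq_comm]

theorem isHomogeneous_locForm {n : ℕ} (η : V → V [⋀^Fin n]→L[ℝ] ℝ)
    (hη : ∀ u ∈ U, ContDiffAt ℝ ∞ η u) : IsHomogeneous n (locForm b η hη) := fun l hl => by
  ext u
  exact isHomogeneous_components b (η u).toAlternatingMap l hl

theorem isAlt_locForm {n : ℕ} (η : V → V [⋀^Fin n]→L[ℝ] ℝ)
    (hη : ∀ u ∈ U, ContDiffAt ℝ ∞ η u) : IsAlt (locForm b η hη) := fun l₁ j k l₂ => by
  ext u
  exact isAlt_components b (η u).toAlternatingMap l₁ j k l₂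

/-- The basis vectors are constant fields, so the exterior derivative is the alternating sum of
directional derivatives, without bracket terms. -/
theorem d_locForm {n : ℕ} (η : V → V [⋀^Fin n]→L[ℝ] ℝ) (hη : ∀ u ∈ U, ContDiffAt ℝ ∞ η u) :
    d (fun k => pd (U := U) (b k)) (locForm b η hη) =
      locForm b (extDeriv η) fun u hu => contDiffAt_extDeriv (hη u hu) := by
  refine ((isHomogeneous_locForm b η hη).d _).ext (isHomogeneous_locForm b _ _) fun v => ?_
  rw [d_ofFn]
  ext u
  change ev u _ = components b (extDeriv η u).toAlternatingMap _
  rw [components_ofFn]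
  change _ = extDeriv η u _
  rw [extDeriv_apply ((hη u u.2).differentiableAt (by simp)), map_sum]
  refine Finset.sum_congr rfl fun j _ => ?_
  rw [_root_.map_mul, map_pow, map_neg, map_one, zsmul_eq_mul]
  push_cast
  congr 1
  rw [ev_apply, pd_apply (g := fun z => η z (j.removeNth (b ∘ v)))]
  · rfl
  · intro u
    exact components_ofFn b (η u).toAlternatingMap _

theorem contDiffOn_coord {X : V → V} (hX : ContDiffOn ℝ ∞ X U) (k : κ) :
    ContDiffOn ℝ ∞ (fun z => b.repr (X z) k) U :=
  (LinearMap.toContinuousLinearMap (b.coord k)).contDiff.comp_contDiffOn hX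

theorem exists_bilinear_of_form_two (om : V [⋀^Fin 2]→L[ℝ] ℝ) :
    ∃ B : V →ₗ[ℝ] V →ₗ[ℝ] ℝ, (∀ v w, om ![v, w] = B v w) ∧ ∀ v w, B w v = -B v w := by
  have hswap : ∀ v w, om ![w, v] = -om ![v, w] := fun v w => by
    have := om.toAlternatingMap.map_swap ![v, w] (i := 0) (j := 1) (by decide)
    have h : (![v, w] ∘ Equiv.swap (0 : Fin 2) 1) = ![w, v] := by
      funext i
      fin_cases i <;> rfl
    rw [h] at this
    exact this
  have hadd : ∀ v v' w, om ![v + v', w] = om ![v, w] + om ![v', w] := fun v v' w =>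
    om.toAlternatingMap.map_vecCons_add ![w] v v'
  have hsmul : ∀ (r : ℝ) v w, om ![r • v, w] = r • om ![v, w] := fun r v w =>
    om.toAlternatingMap.map_vecCons_smul ![w] r v
  refine ⟨LinearMap.mk₂ ℝ (fun v w => om ![v, w]) hadd hsmul (fun v w w' => ?_) fun r v w => ?_,
    fun _ _ => rfl, hswap⟩
  · rw [hswap (w + w') v, hadd, hswap v w, hswap v w']
    ring
  · rw [hswap (r • w) v, hsmul, hswap v w, smul_neg, neg_neg]

/-- The component `P w` lies in the kernel of the form, so only the frame components of `w`
contribute. -/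
theorem form_two_apply_frame {m : ℕ} {om : V [⋀^Fin 2]→L[ℝ] ℝ} {P : V →L[ℝ] V} {e : Fin m → V}
    {ε : Fin m → V →L[ℝ] ℝ} (hker : ∀ v, (∀ w, om ![v, w] = 0) ↔ P v = v)
    (hP : ∀ v, P (P v) = P v) (hε : ∀ v, P v + ∑ a, ε a v • e a = v) (v w : V) :
    om ![v, w] = ∑ c, om ![v, e c] * ε c w := by
  obtain ⟨B, hB, hswap⟩ := exists_bilinear_of_form_two om
  have h : B v (P w) = 0 := by
    rw [hswap, ← hB, (hker (P w)).2 (hP w), neg_zero]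
  simp only [hB]
  conv_lhs => rw [← hε w, map_add, h, zero_add, map_sum]
  exact Finset.sum_congr rfl fun c _ => by rw [map_smul, smul_eq_mul, mul_comm]

/-- A null vector of the matrix gives a combination of the frame in the kernel of the form. The
projection fixes it and also kills it, so it is zero. -/
theorem det_form_two_ne_zero {m : ℕ} {om : V [⋀^Fin 2]→L[ℝ] ℝ} {P : V →L[ℝ] V} {e : Fin m → V}
    {ε : Fin m → V →L[ℝ] ℝ} (hker : ∀ v, (∀ w, om ![v, w] = 0) ↔ P v = v)
    (hP : ∀ v, P (P v) = P v) (hε : ∀ v, P v + ∑ a, ε a v • e a = v) (hPe : ∀ a, P (e a) = 0)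
    (hεe : ∀ a c, ε a (e c) = if a = c then 1 else 0) :
    (Matrix.of fun a c => om ![e a, e c]).det ≠ 0 := by
  intro h
  obtain ⟨v, hv, h⟩ := Matrix.exists_vecMul_eq_zero_iff.2 h
  refine hv ?_
  set x := ∑ a, v a • e a with hx
  have h1 : ∀ c, om ![x, e c] = 0 := fun c => by
    obtain ⟨B, hB, -⟩ := exists_bilinear_of_form_two om
    have := congrFun h c
    simp only [Matrix.vecMul, dotProduct, Matrix.of_apply, hB, Pi.zero_apply] at this
    rw [hB, hx, map_sum, LinearMap.sum_apply, ← this]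
    simp
  have h2 : P x = x := (hker x).1 fun w => by
    rw [form_two_apply_frame hker hP hε]
    simp [h1]
  have h3 : x = 0 := by
    rw [← h2, hx, map_sum]
    simp [hPe]
  funext a
  have := congrArg (ε a) h3
  rw [hx, map_sum] at this
  simpa [hεe] using this

/-- The flat frame given by a closed `2`-form on `U`, a projection onto its kernel and a commuting
frame of the kernel of the projection. -/
theorem exists_flatFrame [DecidableEq κ] {om : V → V [⋀^Fin 2]→L[ℝ] ℝ} {P : V → V →L[ℝ] V}
    (hom : ∀ u ∈ U, ContDiffAt ℝ ∞ om u) (hP : ContDiffOn ℝ ∞ P U)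
    (closed : ∀ u ∈ U, extDeriv om u = 0)
    (hPP : ∀ u ∈ U, ∀ v, P u (P u v) = P u v)
    (hker : ∀ u ∈ U, ∀ v, (∀ w, om u ![v, w] = 0) ↔ P u v = v)
    {m : ℕ} {e : Fin m → V → V} {ε : Fin m → V → V →L[ℝ] ℝ} (he : ∀ a, ContDiffOn ℝ ∞ (e a) U)
    (hε : ∀ a, ContDiffOn ℝ ∞ (ε a) U) (hPe : ∀ u ∈ U, ∀ a, P u (e a u) = 0)
    (hεe : ∀ u ∈ U, ∀ a c, ε a u (e c u) = if a = c then 1 else 0)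
    (hdec : ∀ u ∈ U, ∀ v, P u v + ∑ a, ε a u v • e a u = v)
    (hcomm : ∀ u ∈ U, ∀ a c, VectorField.lieBracket ℝ (e a) (e c) u = 0) :
    ∃ S : FlatFrame (fun k => pd (U := U) (b k)) (Fin m),
      (∀ a k (u : U), (S.e a k).1 u = b.repr (e a u) k) ∧
      (∀ k j (u : U), (S.P k j).1 u = b.repr (P u (b k)) j) ∧
      ∀ (u : U) a c, (S.W a c).1 u = (Matrix.of fun a c => om u ![e a u, e c u])⁻¹ a c := by
  have hμs : ∀ a c, ContDiffOn ℝ ∞ (fun u => om u ![e a u, e c u]) U := fun a c u hu => by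
    have := contDiffAt_form_apply (hom u hu) (X := ![e a, e c]) fun i => by
      fin_cases i
      · exact (he a).contDiffAt (U.2.mem_nhds hu)
      · exact (he c).contDiffAt (U.2.mem_nhds hu)
    refine (this.congr_of_eventuallyEq (Filter.Eventually.of_forall fun z => ?_)).contDiffWithinAt
    simp only
    congr 1
    funext i
    fin_cases i <;> rfl
  set μ : Matrix (Fin m) (Fin m) (SmoothFn U) := Matrix.of fun a c => ofFun _ (hμs a c) with hμ
  have hμu : ∀ u : U, μ.map (ev u) = Matrix.of fun a c => om u ![e a u, e c u] := fun u => rfl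
  have hdet : IsUnit μ.det := by
    refine isUnit_of_ne_zero _ fun u => ?_
    rw [← ev_apply, RingHom.map_det, RingHom.mapMatrix_apply, hμu]
    exact det_form_two_ne_zero (hker u u.2) (hPP u u.2) (hdec u u.2) (hPe u u.2) (hεe u u.2)
  have hW : μ⁻¹ * μ = 1 := Matrix.nonsing_inv_mul _ hdet
  refine ⟨⟨fun j k r => pd_pd _ _ r, fun a k => ofFun _ (contDiffOn_coord b (he a) k),
    fun a k => ofFun (fun z => ε a z (b k)) ((hε a).clm_apply contDiffOn_const),
    locForm b om hom, μ, μ⁻¹,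
    fun k j => ofFun _ (contDiffOn_coord b (hP.clm_apply (contDiffOn_const (c := b k))) j),
    fun k j => ?_, fun a c k => ?_, fun a c => ?_, isAlt_locForm _ _ _, ?_, ?_, fun a => ?_,
    fun a c => ?_, hW⟩, fun _ _ _ => rfl, fun _ _ _ => rfl, fun u a c => ?_⟩
  · refine smoothFn_ext_ev fun u => ?_
    have h := congrArg (fun v => b.repr v j) (hdec u u.2 (b k))
    simp only [map_add, map_sum, map_smul, Finsupp.add_apply, Finsupp.finsetSum_apply,
      Finsupp.smul_apply, smul_eq_mul] at h
    rw [map_add, map_sum, ev_single]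
    simp only [_root_.map_mul, ev_apply, ofFun_apply]
    rw [h, Module.Basis.repr_self, Finsupp.single_apply]
  · refine smoothFn_ext_ev fun u => ?_
    rw [map_sum, map_sum]
    simp only [_root_.map_mul, ev_apply, ofFun_apply]
    have hX : ∀ a, DifferentiableAt ℝ (e a) u := fun a =>
      ((he a).contDiffAt (U.2.mem_nhds u.2)).differentiableAt (by simp)
    have key : ∀ a c, ∑ j, b.repr (e a u) j *
        (pd (b j) (ofFun _ (contDiffOn_coord b (he c) k)) : SmoothFn U).1 u =
        b.repr (fderiv ℝ (e c) u (e a u)) k := fun a c => by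
      have h1 : ∀ v, fderiv ℝ (fun z => b.repr (e c z) k) u v = b.repr (fderiv ℝ (e c) u v) k :=
        fun v => by
          have := ((LinearMap.toContinuousLinearMap (b.coord k)).hasFDerivAt.comp (u : V)
            (hX c).hasFDerivAt).fderiv
          exact congrArg (fun A : V →L[ℝ] ℝ => A v) this
      conv_rhs => rw [← b.sum_repr (e a u)]
      simp only [map_sum, map_smul, Finsupp.finsetSum_apply, Finsupp.smul_apply, smul_eq_mul]
      refine Finset.sum_congr rfl fun j _ => ?_
      rw [pd_apply (g := fun z => b.repr (e c z) k) _ _ (fun _ => rfl), h1]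
    rw [key, key]
    have := hcomm u u.2 a c
    rw [VectorField.lieBracket, sub_eq_zero] at this
    rw [this]
  · refine smoothFn_ext_ev fun u => ?_
    rw [map_sum, ev_single]
    simp only [_root_.map_mul, ev_apply, ofFun_apply]
    have h := congrArg (ε a u) (b.sum_repr (e c u))
    rw [map_sum, hεe u u.2] at h
    simp only [map_smul, smul_eq_mul] at h
    exact h
  · rw [d_locForm]
    ext l u
    change components b (extDeriv om u).toAlternatingMap l = 0
    rw [closed u u.2]
    exact congrFun (congrArg (comap b) toListForm_zero) l
  · refine listForm_ext_ev fun u => ?_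
    rw [map_pull, map_ev_locForm]
    refine (pull_components b (om u).toAlternatingMap (P u).toLinearMap).trans ?_
    have : (om u).toAlternatingMap.compLinearMap (P u).toLinearMap = 0 := by
      ext v
      have h := (hker u u.2 (P u (v 0))).2 (hPP u u.2 _) (P u (v 1))
      refine Eq.trans (congrArg (om u) ?_) h
      funext i
      fin_cases i <;> rfl
    rw [this]
    exact congrArg (comap b) toListForm_zero
  · have hhom : IsHomogeneous 1 (iota (fun k => ofFun _ (contDiffOn_coord b (he a) k))
        (locForm (U := U) b om hom)) := by
      intro l hl
      rw [iota_apply]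
      exact Finset.sum_eq_zero fun k _ => by
        rw [isHomogeneous_locForm b om hom _ (by simpa using hl), mul_zero]
    refine hhom.ext (isHomogeneous_covector _) fun v => smoothFn_ext_ev fun u => ?_
    have h := iota_components b (om u).toAlternatingMap (e a u)
    have h2 := congrFun h (List.ofFn v)
    rw [components_ofFn] at h2
    have h3 := map_iota (ev u) (fun k => ofFun _ (contDiffOn_coord b (he a) k)) (locForm b om hom)
    refine (congrFun h3 (List.ofFn v)).trans (h2.trans ?_)
    have h4 := form_two_apply_frame (hker u u.2) (hPP u u.2) (hdec u u.2) (e a u) (b (v 0))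
    have h5 : covector (fun k => ∑ c, μ a c * ofFun (fun z => ε c z (b k))
        ((hε c).clm_apply contDiffOn_const)) (List.ofFn v) = ∑ c, μ a c *
          ofFun (fun z => ε c z (b (v 0))) ((hε c).clm_apply contDiffOn_const) := by
      simp [covector]
    rw [h5, map_sum]
    simp only [_root_.map_mul, ev_apply, ofFun_apply]
    refine Eq.trans (congrArg (om u) ?_) h4
    funext i
    fin_cases i <;> rfl
  · ext u
    obtain ⟨B, hB, hswap⟩ := exists_bilinear_of_form_two (om u)
    change om u ![e c u, e a u] = -om u ![e a u, e c u]
    rw [hB, hB, hswap]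
  · have : (μ⁻¹).map (ev u) * μ.map (ev u) = 1 := by
      rw [← RingHom.mapMatrix_apply, ← RingHom.mapMatrix_apply, ← _root_.map_mul, hW, map_one]
    rw [← hμu, Matrix.inv_eq_left_inv this]
    rfl

end Local

end

section

/-! ### Charts -/

section Chart

variable {V : Type*} [NormedAddCommGroup V] [NormedSpace ℝ V]
  {Y : Type*} [TopologicalSpace Y] [ChartedSpace V Y] [IsManifold 𝓘(ℝ, V) ∞ Y]

/-- The derivative of the inverse of the preferred chart at `x`. -/
def chartD (x : Y) (u : V) : V →L[ℝ] Tan V ((extChartAt 𝓘(ℝ, V) x).symm u) :=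
  mfderiv 𝓘(ℝ, V) 𝓘(ℝ, V) (extChartAt 𝓘(ℝ, V) x).symm u ∘L
    ((NormedSpace.fromTangentSpace (𝕜 := ℝ) u).symm : V →L[ℝ] TangentSpace 𝓘(ℝ, V) u)

/-- The derivative of the preferred chart at `x`. -/
def chartE (x y : Y) : Tan V y →L[ℝ] V :=
  (NormedSpace.fromTangentSpace (𝕜 := ℝ) (extChartAt 𝓘(ℝ, V) x y) :
      TangentSpace 𝓘(ℝ, V) (extChartAt 𝓘(ℝ, V) x y) →L[ℝ] V) ∘L
    mfderiv 𝓘(ℝ, V) 𝓘(ℝ, V) (extChartAt 𝓘(ℝ, V) x) y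

theorem inChart_apply {n : ℕ} (η : FormField V Y n) (x : Y) (u : V) (v : Fin n → V) :
    η.inChart x u v = η ((extChartAt 𝓘(ℝ, V) x).symm u) fun i => chartD x u (v i) := rfl

theorem chartE_chartD {x : Y} {u : V} (hu : u ∈ (extChartAt 𝓘(ℝ, V) x).target) (v : V) :
    chartE x _ (chartD x u v) = v := by
  have h := mfderiv_extChartAt_comp_mfderivWithin_extChartAt_symm (I := 𝓘(ℝ, V)) hu
  rw [ModelWithCorners.range_eq_univ, mfderivWithin_univ] at h
  exact congrFun (congrArg DFunLike.coe h) v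

theorem chartD_chartE {x : Y} {u : V} (hu : u ∈ (extChartAt 𝓘(ℝ, V) x).target)
    (v : Tan V ((extChartAt 𝓘(ℝ, V) x).symm u)) :
    chartD x u (chartE x _ v) = v := by
  have h := mfderivWithin_extChartAt_symm_comp_mfderiv_extChartAt (I := 𝓘(ℝ, V)) hu
  rw [ModelWithCorners.range_eq_univ, mfderivWithin_univ] at h
  exact congrFun (congrArg DFunLike.coe h) v

theorem formField_congr {n : ℕ} (η : FormField V Y n) {p q : Y} (h : p = q) (v : Fin n → V) :
    η p (v : Fin n → Tan V p) = η q (v : Fin n → Tan V q) := by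
  subst h
  rfl

/-- The transition map between the preferred charts at `x` and `y`. -/
def transition (x y : Y) (u : V) : V := extChartAt 𝓘(ℝ, V) y ((extChartAt 𝓘(ℝ, V) x).symm u)

theorem contDiffAt_transition {x y : Y} {u : V} (hu : u ∈ (extChartAt 𝓘(ℝ, V) x).target)
    (hy : (extChartAt 𝓘(ℝ, V) x).symm u ∈ (extChartAt 𝓘(ℝ, V) y).source) :
    ContDiffAt ℝ ∞ (transition x y : V → V) u := by
  have h := contDiffWithinAt_ext_coord_change (I := 𝓘(ℝ, V)) (n := ∞) y x (y := u)
    (by rw [PartialEquiv.trans_source]; exact ⟨hu, hy⟩)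
  rw [ModelWithCorners.range_eq_univ, contDiffWithinAt_univ] at h
  exact h

theorem eventually_symm_mem {x y : Y} {u : V} (hu : u ∈ (extChartAt 𝓘(ℝ, V) x).target)
    (hy : (extChartAt 𝓘(ℝ, V) x).symm u ∈ (extChartAt 𝓘(ℝ, V) y).source) :
    ∀ᶠ z in 𝓝 u, z ∈ (extChartAt 𝓘(ℝ, V) x).target ∧
      (extChartAt 𝓘(ℝ, V) x).symm z ∈ (extChartAt 𝓘(ℝ, V) y).source :=
  Filter.Eventually.and ((isOpen_extChartAt_target x).mem_nhds hu)
    ((continuousAt_extChartAt_symm'' hu).eventually ((isOpen_extChartAt_source y).mem_nhds hy))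

theorem chartE_chartD_transition {x y : Y} {u : V} (hu : u ∈ (extChartAt 𝓘(ℝ, V) x).target)
    (hy : (extChartAt 𝓘(ℝ, V) x).symm u ∈ (extChartAt 𝓘(ℝ, V) y).source) (v : V) :
    chartE y _ (chartD x u v) = fderiv ℝ (transition x y) u v := by
  have h1 : MDifferentiableAt 𝓘(ℝ, V) 𝓘(ℝ, V) (extChartAt 𝓘(ℝ, V) x).symm u := by
    have := mdifferentiableWithinAt_extChartAt_symm hu
    rwa [ModelWithCorners.range_eq_univ, mdifferentiableWithinAt_univ] at this
  have h2 : MDifferentiableAt 𝓘(ℝ, V) 𝓘(ℝ, V) (extChartAt 𝓘(ℝ, V) y)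
      ((extChartAt 𝓘(ℝ, V) x).symm u) :=
    mdifferentiableAt_extChartAt (by rwa [extChartAt_source] at hy)
  have h3 := mfderiv_comp u h2 h1
  rw [← mfderiv_eq_fderiv]
  exact (congrFun (congrArg DFunLike.coe h3) v).symm

theorem chartE_congr (y : Y) {p q : Y} (h : p = q) (v : V) :
    chartE y p (v : Tan V p) = chartE y q (v : Tan V q) := by
  subst h
  rfl

theorem chartD_transition {x y : Y} {u : V} (hu : u ∈ (extChartAt 𝓘(ℝ, V) x).target)
    (hy : (extChartAt 𝓘(ℝ, V) x).symm u ∈ (extChartAt 𝓘(ℝ, V) y).source) (v : V) :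
    (chartD x u v : V) = (chartD y (transition x y u) (fderiv ℝ (transition x y) u v) : V) := by
  have h : (extChartAt 𝓘(ℝ, V) x).symm u = (extChartAt 𝓘(ℝ, V) y).symm (transition x y u) :=
    ((extChartAt 𝓘(ℝ, V) y).left_inv hy).symm
  have h2 := chartD_chartE ((extChartAt 𝓘(ℝ, V) y).map_source hy) (chartD x u v : V)
  rw [← chartE_chartD_transition hu hy]
  exact h2.symm.trans (congrArg (chartD y (transition x y u)) (chartE_congr y h _).symm)

theorem inChart_transition {n : ℕ} (η : FormField V Y n) {x y : Y} {u : V}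
    (hu : u ∈ (extChartAt 𝓘(ℝ, V) x).target)
    (hy : (extChartAt 𝓘(ℝ, V) x).symm u ∈ (extChartAt 𝓘(ℝ, V) y).source) :
    η.inChart x u = (η.inChart y (transition x y u)).compContinuousLinearMap
      (fderiv ℝ (transition x y) u) := by
  ext v
  change η ((extChartAt 𝓘(ℝ, V) x).symm u) _ = η ((extChartAt 𝓘(ℝ, V) y).symm (transition x y u)) _
  have h : (extChartAt 𝓘(ℝ, V) x).symm u = (extChartAt 𝓘(ℝ, V) y).symm (transition x y u) :=
    ((extChartAt 𝓘(ℝ, V) y).left_inv hy).symm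
  refine Eq.trans ?_ (formField_congr η h _)
  congr 1
  funext i
  exact chartD_transition hu hy (v i)

/-- The trivialisation at `x` of the bundle of forms is pull-back by the derivative of the inverse
chart, so it reads off `inChart`. Smoothness is tested at each point in the chart centred there. -/
theorem isSmooth_iff {n : ℕ} (η : FormField V Y n) :
    η.IsSmooth ↔ ∀ x, ContDiffAt ℝ ∞ (η.inChart x) (extChartAt 𝓘(ℝ, V) x x) := by
  refine forall_congr' fun x => ?_
  have h0 : ∀ u ∈ (extChartAt 𝓘(ℝ, V) x).target,
      (trivializationAt (V [⋀^Fin n]→L[ℝ] ℝ)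
        (fun y : Y => Tan V y [⋀^Fin n]→L[ℝ] Bundle.Trivial Y ℝ y) x
          ⟨(extChartAt 𝓘(ℝ, V) x).symm u, η ((extChartAt 𝓘(ℝ, V) x).symm u)⟩).2 =
        η.inChart x u := fun u hu => by
    rw [FiberBundle.trivializationAt_continuousAlternatingMap_apply]
    ext v
    have hs := (extChartAt 𝓘(ℝ, V) x).map_target hu
    have h1 := TangentBundle.symmL_trivializationAt (I := 𝓘(ℝ, V))
      (by rwa [extChartAt_source] at hs)
    rw [(extChartAt 𝓘(ℝ, V) x).right_inv hu] at h1
    simp only [ContinuousAlternatingMap.inCoordinates]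
    rw [h1]
    have hid : ∀ y : Y, ∀ r : ℝ, Bundle.Trivialization.continuousLinearMapAt ℝ
        (trivializationAt ℝ (Bundle.Trivial Y ℝ) x) y r = r := fun y r =>
      congrFun (congrArg DFunLike.coe (Bundle.Trivial.continuousLinearMapAt_trivialization ℝ Y ℝ y)) r
    refine (hid _ _).trans ?_
    rw [ModelWithCorners.range_eq_univ, mfderivWithin_univ]
    rfl
  rw [Bundle.contMDiffAt_section, contMDiffAt_iff_source, contMDiffWithinAt_iff_contDiffWithinAt,
    ModelWithCorners.range_eq_univ, contDiffWithinAt_univ]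
  have h1 := Filter.eventuallyEq_of_mem (extChartAt_target_mem_nhds (I := 𝓘(ℝ, V)) x) h0
  exact ⟨fun h => h.congr_of_eventuallyEq h1.symm, fun h => h.congr_of_eventuallyEq h1⟩

theorem FormField.IsSmooth.contDiffAt_inChart [FiniteDimensional ℝ V] {n : ℕ} {η : FormField V Y n}
    (hη : η.IsSmooth) {x : Y} {u : V} (hu : u ∈ (extChartAt 𝓘(ℝ, V) x).target) :
    ContDiffAt ℝ ∞ (η.inChart x) u := by
  set y := (extChartAt 𝓘(ℝ, V) x).symm u with hy
  have hys := mem_extChartAt_source (I := 𝓘(ℝ, V)) y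
  have h1 := (isSmooth_iff η).1 hη y
  have hτ := contDiffAt_transition hu hys
  have h2 : ContDiffAt ℝ ∞ (fun z => (η.inChart y (transition x y z)).compContinuousLinearMap
      (fderiv ℝ (transition x y : V → V) z)) u :=
    contDiffAt_compContinuousLinearMap
      (ContDiffAt.comp (g := η.inChart y) (f := transition x y) u h1 hτ)
      (hτ.fderiv_right (m := ∞) (by simp))
  exact h2.congr_of_eventuallyEq ((eventually_symm_mem hu hys).mono fun z hz =>
    inChart_transition η hz.1 hz.2)

/-- `FormField.d` uses a different chart at each point. Naturality of `extDeriv` under the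
transition map shows that in one fixed chart it is the ordinary exterior derivative. -/
theorem inChart_d [FiniteDimensional ℝ V] {n : ℕ} {η : FormField V Y n}
    (hη : η.IsSmooth) {x : Y} {u : V} (hu : u ∈ (extChartAt 𝓘(ℝ, V) x).target) :
    η.d.inChart x u = extDeriv (η.inChart x) u := by
  set y := (extChartAt 𝓘(ℝ, V) x).symm u with hy
  have hys := mem_extChartAt_source (I := 𝓘(ℝ, V)) y
  have hτ := contDiffAt_transition hu hys
  have h1 : extDeriv (η.inChart x) u = extDeriv (fun z =>
      (η.inChart y (transition x y z)).compContinuousLinearMap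
        (fderiv ℝ (transition x y : V → V) z)) u :=
    (Filter.EventuallyEq.extDeriv ((eventually_symm_mem hu hys).mono fun z hz =>
      inChart_transition η hz.1 hz.2)).self_of_nhds
  have h2 : DifferentiableAt ℝ (η.inChart y) (transition x y u) :=
    ((isSmooth_iff η).1 hη y).differentiableAt (by simp)
  rw [h1, extDeriv_pullback h2 hτ (by rw [minSmoothness_of_isRCLikeNormedField]; exact ENat.LEInfty.out)]
  ext v
  change extDeriv (η.inChart y) (extChartAt 𝓘(ℝ, V) y y) _ = extDeriv (η.inChart y) _ _
  congr 1
  funext i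
  exact chartE_chartD_transition hu hys (v i)

end Chart

end

section

open ListForm SmoothFn

/-! ### Splittings in charts -/

theorem mem_kernel_iff {V : Type*} [NormedAddCommGroup V] [NormedSpace ℝ V]
    {Y : Type*} [TopologicalSpace Y] [ChartedSpace V Y] (om : FormField V Y 2) (y : Y)
    (v : Tan V y) : v ∈ om.kernel y ↔ ∀ w, om y ![v, w] = 0 := by
  rw [FormField.kernel, LinearMap.mem_ker]
  constructor
  · intro h w
    exact congrArg (fun a : Tan V y [⋀^Fin 1]→ₗ[ℝ] ℝ => a ![w]) h
  · intro h
    ext w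
    have := h (w 0)
    refine Eq.trans (congrArg (om y) ?_) this
    funext i
    fin_cases i <;> rfl

variable {V : Type*} [NormedAddCommGroup V] [NormedSpace ℝ V]
  {Y : Type*} [TopologicalSpace Y] [ChartedSpace V Y] [IsManifold 𝓘(ℝ, V) ∞ Y]

namespace Splitting

variable {om : PreSymplecticForm V Y} (S : Splitting om)

/-- The expression of the projection of a splitting in the preferred chart at `x`. -/
def Pc (x : Y) (u : V) : V →L[ℝ] V :=
  chartE x _ ∘L S.P ((extChartAt 𝓘(ℝ, V) x).symm u) ∘L chartD x u

variable {S} {x : Y} {u : V}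

theorem chartD_Pc (hu : u ∈ (extChartAt 𝓘(ℝ, V) x).target) (v : V) :
    chartD x u (S.Pc x u v) = S.P _ (chartD x u v) :=
  chartD_chartE hu _

theorem Pc_Pc (hu : u ∈ (extChartAt 𝓘(ℝ, V) x).target) (v : V) :
    S.Pc x u (S.Pc x u v) = S.Pc x u v := by
  change chartE x _ (S.P _ (chartD x u (S.Pc x u v))) = chartE x _ (S.P _ (chartD x u v))
  rw [chartD_Pc hu, S.idem]

theorem chartD_injective (hu : u ∈ (extChartAt 𝓘(ℝ, V) x).target) :
    Function.Injective (chartD x u) :=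
  Function.LeftInverse.injective (chartE_chartD hu)

theorem P_apply_eq_self_iff (y : Y) (v : Tan V y) : S.P y v = v ↔ v ∈ om.E y :=
  ⟨fun h => h ▸ S.apply_mem y v, S.apply_of_mem⟩

theorem kernel_inChart (hu : u ∈ (extChartAt 𝓘(ℝ, V) x).target) (v : V) :
    (∀ w, om.form.inChart x u ![v, w] = 0) ↔ S.Pc x u v = v := by
  rw [← (chartD_injective hu).eq_iff, chartD_Pc hu, P_apply_eq_self_iff, mem_kernel_iff]
  have h : ∀ w, om.form.inChart x u ![v, w] =
      om.form ((extChartAt 𝓘(ℝ, V) x).symm u) ![chartD x u v, chartD x u w] := fun w => by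
    rw [inChart_apply]
    congr 1
    funext i
    fin_cases i <;> rfl
  simp only [h]
  refine ⟨fun h w => ?_, fun h w => h _⟩
  rw [← chartD_chartE hu w]
  exact h _

theorem contDiffOn_Pc : ContDiffOn ℝ ∞ (S.Pc x) (extChartAt 𝓘(ℝ, V) x).target := by
  intro u hu
  have hs := (extChartAt 𝓘(ℝ, V) x).map_target hu
  have hs' : (extChartAt 𝓘(ℝ, V) x).symm u ∈ (chartAt V x).source := by
    rwa [extChartAt_source] at hs
  have h := (S.smooth ((extChartAt 𝓘(ℝ, V) x).symm u))
  rw [Bundle.Trivialization.contMDiffAt_section_iff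
    (trivializationAt (V →L[ℝ] V) (fun y : Y => Tan V y →L[ℝ] Tan V y) x) (by
      rw [hom_trivializationAt_baseSet]
      exact ⟨hs', hs'⟩), contMDiffAt_iff_source_of_mem_source (x := x) hs',
    contMDiffWithinAt_iff_contDiffWithinAt, ModelWithCorners.range_eq_univ, contDiffWithinAt_univ,
    (extChartAt 𝓘(ℝ, V) x).right_inv hu] at h
  refine (h.congr_of_eventuallyEq ?_).contDiffWithinAt
  filter_upwards [(isOpen_extChartAt_target x).mem_nhds hu] with z hz
  have hzs := (extChartAt 𝓘(ℝ, V) x).map_target hz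
  have hzs' : (extChartAt 𝓘(ℝ, V) x).symm z ∈ (chartAt V x).source := by
    rwa [extChartAt_source] at hzs
  simp only [Function.comp_apply, hom_trivializationAt_apply, ContinuousLinearMap.inCoordinates]
  rw [TangentBundle.symmL_trivializationAt hzs', TangentBundle.continuousLinearMapAt_trivializationAt hzs',
    (extChartAt 𝓘(ℝ, V) x).right_inv hz, ModelWithCorners.range_eq_univ, mfderivWithin_univ]
  rfl

theorem mpullback_extChartAt (hu : u ∈ (extChartAt 𝓘(ℝ, V) x).target)
    (X : (z : V) → TangentSpace 𝓘(ℝ, V) z) :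
    VectorField.mpullback 𝓘(ℝ, V) 𝓘(ℝ, V) (extChartAt 𝓘(ℝ, V) x) X
      ((extChartAt 𝓘(ℝ, V) x).symm u) = chartD x u (X u : V) := by
  have hs := (extChartAt 𝓘(ℝ, V) x).map_target hu
  rw [← chartD_chartE hu (VectorField.mpullback 𝓘(ℝ, V) 𝓘(ℝ, V) (extChartAt 𝓘(ℝ, V) x) X
      ((extChartAt 𝓘(ℝ, V) x).symm u))]
  congr 1
  have h1 : chartE x _ (VectorField.mpullback 𝓘(ℝ, V) 𝓘(ℝ, V) (extChartAt 𝓘(ℝ, V) x) X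
      ((extChartAt 𝓘(ℝ, V) x).symm u)) =
      (X (extChartAt 𝓘(ℝ, V) x ((extChartAt 𝓘(ℝ, V) x).symm u)) : V) :=
    congrFun (congrArg DFunLike.coe (isInvertible_mfderiv_extChartAt hs).self_comp_inverse) _
  rw [h1]
  exact congrArg (fun z => (X z : V)) ((extChartAt 𝓘(ℝ, V) x).right_inv hu)

/-- A field in the chart that takes values in `G` near `u` is, near the corresponding point, the
lift of its own class in the normal bundle. Flatness is stated for such lifts, and only germs
matter. -/
theorem lift_mpullback_eventuallyEq (hu : u ∈ (extChartAt 𝓘(ℝ, V) x).target)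
    {X : (z : V) → TangentSpace 𝓘(ℝ, V) z}
    (hPX : ∀ᶠ z in 𝓝 u, S.Pc x z (X z : V) = 0) :
    (fun y => S.lift y (Submodule.Quotient.mk
      (VectorField.mpullback 𝓘(ℝ, V) 𝓘(ℝ, V) (extChartAt 𝓘(ℝ, V) x) X y)))
    =ᶠ[𝓝 ((extChartAt 𝓘(ℝ, V) x).symm u)]
      VectorField.mpullback 𝓘(ℝ, V) 𝓘(ℝ, V) (extChartAt 𝓘(ℝ, V) x) X := by
  have hs := (extChartAt 𝓘(ℝ, V) x).map_target hu
  have h1 : ∀ᶠ z in 𝓝 u, S.P _ (VectorField.mpullback 𝓘(ℝ, V) 𝓘(ℝ, V) (extChartAt 𝓘(ℝ, V) x) X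
      ((extChartAt 𝓘(ℝ, V) x).symm z)) = 0 := by
    filter_upwards [hPX, (isOpen_extChartAt_target x).mem_nhds hu] with z hz hzt
    have h : S.P _ (chartD x z (X z : V)) = 0 :=
      (chartD_Pc hzt (X z : V)).symm.trans ((congrArg (chartD x z) hz).trans (map_zero _))
    exact (congrArg (S.P _) (mpullback_extChartAt hzt X)).trans h
  have h2 : Filter.Tendsto (extChartAt 𝓘(ℝ, V) x) (𝓝 ((extChartAt 𝓘(ℝ, V) x).symm u)) (𝓝 u) := by
    have := continuousAt_extChartAt' (I := 𝓘(ℝ, V)) hs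
    rwa [ContinuousAt, (extChartAt 𝓘(ℝ, V) x).right_inv hu] at this
  filter_upwards [h2.eventually h1, (isOpen_extChartAt_source x).mem_nhds hs] with y hy hys
  rw [(extChartAt 𝓘(ℝ, V) x).left_inv hys] at hy
  change VectorField.mpullback 𝓘(ℝ, V) 𝓘(ℝ, V) (extChartAt 𝓘(ℝ, V) x) X y - S.P y _ = _
  rw [hy, sub_zero]

theorem contMDiffAt_mpullback [FiniteDimensional ℝ V] (hu : u ∈ (extChartAt 𝓘(ℝ, V) x).target)
    {X : V → V} (hX : ContDiffAt ℝ ∞ X u) :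
    ContMDiffAt 𝓘(ℝ, V) 𝓘(ℝ, V).tangent ∞ (fun y => (⟨y, VectorField.mpullback 𝓘(ℝ, V) 𝓘(ℝ, V)
      (extChartAt 𝓘(ℝ, V) x) X y⟩ : TangentBundle 𝓘(ℝ, V) Y))
      ((extChartAt 𝓘(ℝ, V) x).symm u) := by
  have : CompleteSpace V := FiniteDimensional.complete ℝ V
  have hs := (extChartAt 𝓘(ℝ, V) x).map_target hu
  refine ContMDiffAt.mpullback_vectorField_preimage (n := ∞) ?_ (contMDiffAt_extChartAt' (by
    rwa [extChartAt_source] at hs)) (isInvertible_mfderiv_extChartAt hs) (by simp)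
  rw [(extChartAt 𝓘(ℝ, V) x).right_inv hu]
  exact contMDiffAt_vectorSpace_iff_contDiffAt.2 hX

theorem mlieBracket_eq_lieBracket (X Z : (z : V) → TangentSpace 𝓘(ℝ, V) z) (u : V) :
    VectorField.mlieBracket 𝓘(ℝ, V) X Z u = VectorField.lieBracket ℝ X Z u := by
  rw [← VectorField.mlieBracketWithin_univ, VectorField.mlieBracketWithin_eq_lieBracketWithin]
  exact congrFun (VectorField.lieBracketWithin_univ (V := X) (W := Z)) u

theorem flat_inChart [FiniteDimensional ℝ V] (hS : S.IsFlat)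
    (hu : u ∈ (extChartAt 𝓘(ℝ, V) x).target) {X Z : V → V}
    (hX : ContDiffAt ℝ ∞ X u) (hZ : ContDiffAt ℝ ∞ Z u) (hPX : ∀ᶠ z in 𝓝 u, S.Pc x z (X z) = 0)
    (hPZ : ∀ᶠ z in 𝓝 u, S.Pc x z (Z z) = 0) :
    S.Pc x u (VectorField.lieBracket ℝ X Z u) = 0 := by
  have : CompleteSpace V := FiniteDimensional.complete ℝ V
  have hs := (extChartAt 𝓘(ℝ, V) x).map_target hu
  have hr := (extChartAt 𝓘(ℝ, V) x).right_inv hu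
  have h2 : minSmoothness ℝ 2 ≤ ∞ := by
    rw [minSmoothness_of_isRCLikeNormedField]
    exact ENat.LEInfty.out
  have : IsManifold 𝓘(ℝ, V) (minSmoothness ℝ 2) Y := IsManifold.of_le h2
  set y := (extChartAt 𝓘(ℝ, V) x).symm u with hy
  have hlX := lift_mpullback_eventuallyEq (S := S) hu hPX
  have hlZ := lift_mpullback_eventuallyEq (S := S) hu hPZ
  have hcong : ∀ {A B : (y : Y) → Tan V y}, A =ᶠ[𝓝 y] B →
      (fun z => (⟨z, A z⟩ : TangentBundle 𝓘(ℝ, V) Y)) =ᶠ[𝓝 y] fun z => ⟨z, B z⟩ :=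
    fun h => h.mono fun z hz => by simp only [hz]
  have hc := hS y _ _ ((contMDiffAt_mpullback hu hX).congr_of_eventuallyEq (hcong hlX))
    ((contMDiffAt_mpullback hu hZ).congr_of_eventuallyEq (hcong hlZ))
  have hc' := congrArg Subtype.val hc
  change S.P y (VectorField.mlieBracket 𝓘(ℝ, V) _ _ y) = 0 at hc'
  rw [hlX.mlieBracket_vectorField_eq hlZ] at hc'
  have hmd : ∀ {A : V → V}, ContDiffAt ℝ ∞ A u → MDifferentiableAt 𝓘(ℝ, V) 𝓘(ℝ, V).tangent
      (fun z => (⟨z, A z⟩ : TangentBundle 𝓘(ℝ, V) V)) (extChartAt 𝓘(ℝ, V) x y) := fun hA => by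
    rw [hr]
    exact (contMDiffAt_vectorSpace_iff_contDiffAt.2 hA).mdifferentiableAt (by simp)
  have hbr := VectorField.mpullback_mlieBracket (n := ∞) (hmd hX) (hmd hZ)
    (contMDiffAt_extChartAt' (by rwa [extChartAt_source] at hs)) h2
  have h4 := hbr.symm.trans ((mpullback_extChartAt hu _).trans
    (congrArg (chartD x u) (mlieBracket_eq_lieBracket X Z u)))
  change chartE x _ (S.P _ (chartD x u (VectorField.lieBracket ℝ X Z u))) = 0
  exact (congrArg (chartE x _) ((congrArg (S.P _) h4).symm.trans hc')).trans (map_zero _)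

end Splitting

end

section

open ListForm SmoothFn

/-! ### Change of basis -/

/-- The Gram matrix transforms by congruence and its inverse contragrediently, so the contraction
with a bilinear map is independent of the basis. The definition of `bracket` uses an arbitrary basis
at each point; this permits the local frame instead. -/
theorem sum_inv_toMatrix₂_eq {W M ι ι' : Type*} [AddCommGroup W] [Module ℝ W] [AddCommGroup M]
    [Module ℝ M] [Fintype ι] [DecidableEq ι] [Fintype ι'] [DecidableEq ι']
    (e : Module.Basis ι ℝ W) (f : Module.Basis ι' ℝ W) (B : W →ₗ[ℝ] W →ₗ[ℝ] ℝ)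
    (T : W →ₗ[ℝ] W →ₗ[ℝ] M) (h : (LinearMap.toMatrix₂ e e B).det ≠ 0) :
    ∑ c, ∑ d, (LinearMap.toMatrix₂ f f B)⁻¹ c d • T (f c) (f d) =
      ∑ a, ∑ b, (LinearMap.toMatrix₂ e e B)⁻¹ a b • T (e a) (e b) := by
  set Q := f.toMatrix e with hQ
  set μ := LinearMap.toMatrix₂ e e B with hμ
  have hinv : (LinearMap.toMatrix₂ f f B)⁻¹ = Q * μ⁻¹ * Q.transpose := by
    refine Matrix.inv_eq_right_inv ?_
    rw [← LinearMap.toMatrix₂_mul_basis_toMatrix e e f f B]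
    calc _ = (e.toMatrix f).transpose * μ * (e.toMatrix f * Q) * μ⁻¹ * Q.transpose := by
          simp only [Matrix.mul_assoc, hμ]
      _ = 1 := by
        rw [hQ, Module.Basis.toMatrix_mul_toMatrix_flip, Matrix.mul_one,
          Matrix.mul_assoc _ μ, Matrix.mul_nonsing_inv _ (isUnit_iff_ne_zero.2 h), Matrix.mul_one,
          ← Matrix.transpose_mul, Module.Basis.toMatrix_mul_toMatrix_flip, Matrix.transpose_one]
  have he : ∀ a, e a = ∑ c, Q c a • f c := fun a => (f.sum_toMatrix_smul_self e a).symm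
  have hR : ∀ a b, μ⁻¹ a b • T (e a) (e b) =
      ∑ c, ∑ d, (Q c a * μ⁻¹ a b * Q d b) • T (f c) (f d) := fun a b => by
    rw [he a, he b]
    simp only [map_sum, map_smul, LinearMap.sum_apply, LinearMap.smul_apply, Finset.smul_sum,
      smul_smul]
    rw [Finset.sum_comm]
    exact Finset.sum_congr rfl fun c _ => Finset.sum_congr rfl fun d _ => by ring_nf
  have hL : ∀ c d, (Q * μ⁻¹ * Q.transpose) c d = ∑ b, ∑ a, Q c a * μ⁻¹ a b * Q d b := fun c d => by
    rw [Matrix.mul_apply]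
    refine Finset.sum_congr rfl fun b _ => ?_
    rw [Matrix.mul_apply, Finset.sum_mul, Matrix.transpose_apply]
  simp only [hinv, hR, hL, Finset.sum_smul]
  have h1 : ∀ g : ι' → ι' → ι → ι → M, ∑ c, ∑ d, ∑ b, ∑ a, g c d b a = ∑ a, ∑ b, ∑ c, ∑ d, g c d b a := by
    intro g
    calc _ = ∑ x : ι' × ι' × ι × ι, g x.1 x.2.1 x.2.2.1 x.2.2.2 := by
          simp only [Fintype.sum_prod_type]
      _ = ∑ x : ι × ι × ι' × ι', g x.2.2.1 x.2.2.2 x.2.1 x.1 :=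
          Fintype.sum_equiv ⟨fun x => (x.2.2.2, x.2.2.1, x.1, x.2.1),
            fun x => (x.2.2.1, x.2.2.2, x.2.1, x.1), fun _ => rfl, fun _ => rfl⟩ _ _ fun _ => rfl
      _ = _ := by simp only [Fintype.sum_prod_type]
  exact h1 fun c d b a => (Q c a * μ⁻¹ a b * Q d b) • T (f c) (f d)

section

variable {W W' κ : Type*} [AddCommGroup W] [Module ℝ W] [AddCommGroup W'] [Module ℝ W'] [Fintype κ]

theorem components_compLinearMap (b : κ → W') (f : W' →ₗ[ℝ] W) {n : ℕ} (a : W [⋀^Fin n]→ₗ[ℝ] ℝ) :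
    components b (a.compLinearMap f) = components (fun k => f (b k)) a :=
  (isHomogeneous_components _ _).ext (isHomogeneous_components _ _) fun v => by
    rw [components_ofFn, components_ofFn]
    rfl

theorem iota_components_eq_zero (b : κ → W) {n : ℕ} (a : W [⋀^Fin n]→ₗ[ℝ] ℝ) (X : κ → ℝ)
    (h : ∑ k, X k • b k = 0) : iota X (components b a) = 0 := by
  rcases n with _ | n
  · exact iota_components_zero b a X
  · have : iota X (components b a) = components b (AlternatingMap.curryLeft a (∑ k, X k • b k)) := by
      rw [map_sum, components_sum, iota_eq]
      exact Finset.sum_congr rfl fun k _ => by rw [map_smul, components_smul, contr_components]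
    rw [this, h, map_zero]
    exact congrArg (comap b) toListForm_zero

end

/-! ### Linearity of the operations of a flat frame -/

namespace FlatFrame

variable {κ R ι : Type*} [Fintype κ] [DecidableEq κ] [CommRing R] [Algebra ℝ R] [Fintype ι]
  [DecidableEq ι] {D : κ → Derivation ℝ R R} (S : FlatFrame D ι)

theorem Lf_algebraMap (a : ι) (c : ℝ) : S.Lf a (algebraMap ℝ R c) = 0 :=
  Finset.sum_eq_zero fun k _ => by rw [Derivation.map_algebraMap, mul_zero]

theorem L_smul_algebraMap (a : ι) (c : ℝ) (F : ListForm κ R) :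
    S.L a (algebraMap ℝ R c • F) = algebraMap ℝ R c • S.L a F := by
  rw [L_smul, Lf_algebraMap, zero_smul, zero_add]

theorem dF_smul_algebraMap (c : ℝ) (F : ListForm κ R) :
    S.dF (algebraMap ℝ R c • F) = algebraMap ℝ R c • S.dF F := by
  have h : S.dF (const (algebraMap ℝ R c)) = 0 := by
    rw [dF_const, d_const_eq_covector]
    simp only [Derivation.map_algebraMap, Lf_algebraMap, zero_smul, Finset.sum_const_zero, sub_zero]
    ext l
    rcases l with _ | ⟨k, _ | ⟨j, l⟩⟩ <;> rfl
  rw [dF_smul, h, zero_mul, zero_add]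

theorem brk_add_left (F F' G : ListForm κ R) : S.brk (F + F') G = S.brk F G + S.brk F' G := by
  simp only [brk, map_add, add_mul, smul_add, Finset.sum_add_distrib]

theorem brk_add_right (F G G' : ListForm κ R) : S.brk F (G + G') = S.brk F G + S.brk F G' := by
  simp only [brk, map_add, mul_add, smul_add, Finset.sum_add_distrib]

theorem brk_smul_left (c : ℝ) (F G : ListForm κ R) :
    S.brk (algebraMap ℝ R c • F) G = algebraMap ℝ R c • S.brk F G := by
  simp only [brk, L_smul_algebraMap, Finset.smul_sum, smul_mul_assoc]
  exact Finset.sum_congr rfl fun a _ => Finset.sum_congr rfl fun b _ => smul_comm _ _ _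

theorem brk_smul_right (c : ℝ) (F G : ListForm κ R) :
    S.brk F (algebraMap ℝ R c • G) = algebraMap ℝ R c • S.brk F G := by
  simp only [brk, L_smul_algebraMap, Finset.smul_sum, mul_smul_comm]
  exact Finset.sum_congr rfl fun a _ => Finset.sum_congr rfl fun b _ => smul_comm _ _ _

end FlatFrame

/-! ### Leafwise forms in charts -/

variable {V : Type*} [NormedAddCommGroup V] [NormedSpace ℝ V] [FiniteDimensional ℝ V]
  {Y : Type*} [TopologicalSpace Y] [ChartedSpace V Y] [IsManifold 𝓘(ℝ, V) ∞ Y]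

namespace Splitting

variable {om : PreSymplecticForm V Y} (S : Splitting om) {κ : Type*} [Fintype κ]
  (b : Module.Basis κ ℝ V)

/-- The map from `V` to a tangent space of the leaves given by a chart and the projection. -/
def leafMap (x : Y) (u : V) : V →ₗ[ℝ] om.E ((extChartAt 𝓘(ℝ, V) x).symm u) :=
  S.toE _ ∘ₗ (chartD x u : V →ₗ[ℝ] Tan V ((extChartAt 𝓘(ℝ, V) x).symm u))

/-- The components of a leafwise form in a chart. -/
def leafComp (x : Y) (u : V) {j : ℕ} (ξ : LeafField om j) : ListForm κ ℝ :=
  components (fun k => S.leafMap x u (b k)) (ξ ((extChartAt 𝓘(ℝ, V) x).symm u))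

theorem leafComp_add (x : Y) (u : V) {j : ℕ} (ξ ζ : LeafField om j) :
    S.leafComp b x u (ξ + ζ) = S.leafComp b x u ξ + S.leafComp b x u ζ := components_add _ _ _

theorem leafComp_smul (x : Y) (u : V) {j : ℕ} (r : ℝ) (ξ : LeafField om j) :
    S.leafComp b x u (r • ξ) = r • S.leafComp b x u ξ := components_smul _ _ _

theorem components_extend (x : Y) (u : V) {j : ℕ} (ξ : LeafField om j) :
    components b ((S.extend ξ).inChart x u).toAlternatingMap = S.leafComp b x u ξ :=
  components_compLinearMap b (S.leafMap x u) (ξ _)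

theorem toE_apply_coe {y : Y} (v : om.E y) : S.toE y v = v := Subtype.ext (S.apply_of_mem v.2)

theorem toLeaf_extend {j : ℕ} (ξ : LeafField om j) : (S.extend ξ).toLeaf om = ξ := by
  funext y
  ext v
  exact congrArg (ξ y) (funext fun i => S.toE_apply_coe (v i))

variable {S} {x : Y} {u : V}

theorem leafMap_surjective (hu : u ∈ (extChartAt 𝓘(ℝ, V) x).target) :
    Function.Surjective (S.leafMap x u) := fun v => ⟨chartE x _ v.1, by
  change S.toE _ (chartD x u (chartE x _ v.1)) = v
  rw [chartD_chartE hu, toE_apply_coe]⟩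

theorem eq_zero_of_leafComp (hu : u ∈ (extChartAt 𝓘(ℝ, V) x).target) {j : ℕ} {ξ : LeafField om j}
    (h : S.leafComp b x u ξ = 0) : ξ ((extChartAt 𝓘(ℝ, V) x).symm u) = 0 := by
  have h1 : (ξ ((extChartAt 𝓘(ℝ, V) x).symm u)).compLinearMap (S.leafMap x u) = 0 := by
    refine components_injective b ?_
    rw [components_compLinearMap]
    exact h.trans (congrArg (comap b) toListForm_zero).symm
  ext v
  choose w hw using fun i => leafMap_surjective (S := S) hu (v i)
  have := congrArg (fun a : V [⋀^Fin j]→ₗ[ℝ] ℝ => a w) h1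
  simp only [AlternatingMap.compLinearMap_apply, hw] at this
  exact this

/-- Each point is the centre of its own chart, so the centres suffice, and the leaf map is
surjective there. -/
theorem leafField_eq_zero {j : ℕ} {ξ : LeafField om j}
    (h : ∀ x, S.leafComp b x (extChartAt 𝓘(ℝ, V) x x) ξ = 0) : ξ = 0 := by
  funext y
  have h1 : ∀ z, z = y → ξ z = 0 → ξ y = 0 := by
    rintro _ rfl h
    exact h
  exact h1 _ (extChartAt_to_inv y) (eq_zero_of_leafComp b (mem_extChartAt_target y) (h y))

theorem leafField_ext {j : ℕ} {ξ ζ : LeafField om j}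
    (h : ∀ x, S.leafComp b x (extChartAt 𝓘(ℝ, V) x x) ξ =
      S.leafComp b x (extChartAt 𝓘(ℝ, V) x x) ζ) : ξ = ζ := by
  have : ξ + (-1 : ℝ) • ζ = 0 := leafField_eq_zero (S := S) b fun x => by
    rw [leafComp_add, leafComp_smul, h x, neg_one_smul, add_neg_cancel]
  funext y
  ext v
  have h1 : ξ y v + (-1 : ℝ) * ζ y v = 0 :=
    congrArg (fun a : om.E y [⋀^Fin j]→ₗ[ℝ] ℝ => a v) (congrFun this y)
  linarith

variable (S) in
/-- The components in a chart of a leafwise form of mixed degree. -/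
def mixedComp (x : Y) (u : V) : (DirectSum ℕ fun j => LeafField om j) →ₗ[ℝ] ListForm κ ℝ :=
  DirectSum.toModule ℝ ℕ _ fun _ =>
    { toFun := S.leafComp b x u
      map_add' := S.leafComp_add b x u
      map_smul' := S.leafComp_smul b x u }

theorem mixedComp_of {j : ℕ} (ξ : LeafField om j) :
    S.mixedComp b x u (DirectSum.of (fun j => LeafField om j) j ξ) = S.leafComp b x u ξ :=
  DirectSum.toModule_lof ℝ j ξ

/-- Lists of length `n` see the summand of degree `n` only. Components of all degrees can therefore
be added in `ListForm` without losing information, and equations in the direct sum are tested there.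
-/
theorem mixedComp_apply (s : DirectSum ℕ fun j => LeafField om j) {n : ℕ} {l : List κ}
    (hl : l.length = n) : S.mixedComp b x u s l = S.leafComp b x u (s n) l := by
  induction s using DirectSum.induction_on with
  | zero => 
    rw [map_zero]
    exact (congrFun (congrArg (comap _) toListForm_zero) l).symm
  | of j ξ =>
    rw [mixedComp_of]
    by_cases h : j = n
    · subst h
      rw [DirectSum.of_eq_same]
    · rw [DirectSum.of_eq_of_ne _ _ _ (Ne.symm h)]
      exact (isHomogeneous_components _ _ l (by omega)).trans
        (congrFun (congrArg (comap _) toListForm_zero) l).symm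
  | add s t hs ht =>
    rw [map_add, DirectSum.add_apply, leafComp_add]
    exact congrArg₂ (· + ·) hs ht

theorem directSum_ext {s t : DirectSum ℕ fun j => LeafField om j}
    (h : ∀ x, S.mixedComp b x (extChartAt 𝓘(ℝ, V) x x) s =
      S.mixedComp b x (extChartAt 𝓘(ℝ, V) x x) t) : s = t := by
  refine DFinsupp.ext fun n => leafField_ext (S := S) b fun x => ?_
  ext l
  by_cases hl : l.length = n
  · exact (mixedComp_apply b s hl).symm.trans ((congrFun (h x) l).trans (mixedComp_apply b t hl))
  · exact (isHomogeneous_components _ _ l hl).trans (isHomogeneous_components _ _ l hl).symm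

theorem extend_toLeaf_inChart (hu : u ∈ (extChartAt 𝓘(ℝ, V) x).target) {j : ℕ}
    (η : FormField V Y j) : (S.extend (η.toLeaf om)).inChart x u =
      (η.inChart x u).compContinuousLinearMap (S.Pc x u) := by
  ext v
  change η _ _ = η _ _
  exact congrArg (η _) (funext fun i => (chartD_Pc hu (v i)).symm)

/-- For any smooth form restricting to `ξ`, the extension is its pull-back along the smooth
projection. -/
theorem isSmooth_extend {j : ℕ} {ξ : LeafField om j} (hξ : ξ ∈ leafwiseForms om j) :
    (S.extend ξ).IsSmooth := by
  obtain ⟨η, hη, rfl⟩ := hξ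
  refine (isSmooth_iff _).2 fun x => ?_
  have ht := (isOpen_extChartAt_target (I := 𝓘(ℝ, V)) x).mem_nhds (mem_extChartAt_target x)
  refine (contDiffAt_compContinuousLinearMap ((isSmooth_iff η).1 hη x)
    ((contDiffOn_Pc (S := S)).contDiffAt ht)).congr_of_eventuallyEq ?_
  filter_upwards [ht] with z hz
  exact extend_toLeaf_inChart (S := S) hz η

theorem leafD_mem {j : ℕ} {ξ : LeafField om j} (hξ : ξ ∈ leafwiseForms om j) :
    S.leafD j ξ ∈ leafwiseForms om (j + 1) := by
  refine ⟨(S.extend ξ).d, (isSmooth_iff _).2 fun x => ?_, rfl⟩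
  have hs := isSmooth_extend (S := S) hξ
  refine (contDiffAt_extDeriv ((isSmooth_iff _).1 hs x)).congr_of_eventuallyEq ?_
  filter_upwards [(isOpen_extChartAt_target (I := 𝓘(ℝ, V)) x).mem_nhds (mem_extChartAt_target x)]
    with z hz
  exact inChart_d hs hz

theorem leafComp_leafD (hu : u ∈ (extChartAt 𝓘(ℝ, V) x).target) {j : ℕ} {ξ : LeafField om j}
    (hξ : ξ ∈ leafwiseForms om j) : S.leafComp b x u (S.leafD j ξ) =
      components b ((extDeriv ((S.extend ξ).inChart x) u).toAlternatingMap.compLinearMap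
        (S.Pc x u).toLinearMap) := by
  rw [← inChart_d (isSmooth_extend hξ) hu]
  refine (isHomogeneous_components (fun k => S.leafMap x u (b k)) (S.leafD j ξ _)).ext
    (isHomogeneous_components b _) fun v => ?_
  refine (components_ofFn (fun k => S.leafMap x u (b k)) (S.leafD j ξ _) v).trans
    (Eq.trans ?_ (components_ofFn b _ v).symm)
  change (S.extend ξ).d _ _ = (S.extend ξ).d _ _
  exact congrArg ((S.extend ξ).d _) (funext fun i => (chartD_Pc hu (b (v i))).symm)

theorem components_nabla (hu : u ∈ (extChartAt 𝓘(ℝ, V) x).target) {j : ℕ} {ξ : LeafField om j}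
    (hξ : ξ ∈ leafwiseForms om j) (w : V) (g : S.G ((extChartAt 𝓘(ℝ, V) x).symm u))
    (hg : (g : Tan V ((extChartAt 𝓘(ℝ, V) x).symm u)) = chartD x u w) :
    components (fun k => S.leafMap x u (b k)) (S.nabla ξ _ g) =
      components b ((AlternatingMap.curryLeft (extDeriv ((S.extend ξ).inChart x) u).toAlternatingMap
        w).compLinearMap (S.Pc x u).toLinearMap) := by
  rw [← inChart_d (isSmooth_extend hξ) hu]
  refine (isHomogeneous_components _ _).ext (isHomogeneous_components _ _) fun v => ?_
  rw [components_ofFn, components_ofFn]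
  change (S.extend ξ).d _ _ = (S.extend ξ).d _ _
  refine congrArg ((S.extend ξ).d _) (funext fun i => ?_)
  refine Fin.cases hg (fun i => ?_) i
  exact (chartD_Pc hu (b (v i))).symm

variable (S) in
/-- The covariant derivative as a linear map in the direction. -/
def nablaLinear {j : ℕ} (ξ : LeafField om j) (y : Y) : S.G y →ₗ[ℝ] om.E y [⋀^Fin j]→ₗ[ℝ] ℝ where
  toFun := S.nabla ξ y
  map_add' v w := by
    simp only [nabla, Submodule.coe_add, map_add]
    rfl
  map_smul' r v := by
    simp only [nabla, Submodule.coe_smul, map_smul]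
    rfl

theorem bracket_eq {y : Y} {ι : Type*} [Fintype ι] [DecidableEq ι] (e : Module.Basis ι ℝ (S.G y))
    (he : (S.omegaMatrix y e).det ≠ 0) {i j : ℕ} (ξ : LeafField om i) (ζ : LeafField om j) :
    S.bracket i j ξ ζ y = (1 / 2 : ℝ) • ∑ a, ∑ c, (S.omegaMatrix y e)⁻¹ a c •
      wedge (S.nabla ξ y (e a)) (S.nabla ζ y (e c)) := by
  obtain ⟨B, hB, -⟩ := exists_bilinear_of_form_two (V := V) (om.form y)
  let B' : S.G y →ₗ[ℝ] S.G y →ₗ[ℝ] ℝ := B.domRestrict₁₂ (S.G y) (S.G y)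
  let T : S.G y →ₗ[ℝ] S.G y →ₗ[ℝ] om.E y [⋀^Fin (i + j)]→ₗ[ℝ] ℝ :=
    LinearMap.mk₂ ℝ (fun v w => wedge (S.nablaLinear ξ y v) (S.nablaLinear ζ y w))
      (fun v v' w => by rw [map_add, wedge_add_left]) (fun r v w => by rw [map_smul, wedge_smul_left])
      (fun v w w' => by rw [map_add, wedge_add_right])
      (fun r v w => by rw [map_smul, wedge_smul_right])
  have hMf : S.omegaMatrix y (Module.finBasis ℝ (S.G y)) =
      LinearMap.toMatrix₂ (Module.finBasis ℝ (S.G y)) (Module.finBasis ℝ (S.G y)) B' := by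
    ext a c
    rw [LinearMap.toMatrix₂_apply]
    exact hB _ _
  have hMe : S.omegaMatrix y e = LinearMap.toMatrix₂ e e B' := by
    ext a c
    rw [LinearMap.toMatrix₂_apply]
    exact hB _ _
  have := sum_inv_toMatrix₂_eq e (Module.finBasis ℝ (S.G y)) B' T (hMe ▸ he)
  rw [← hMf, ← hMe] at this
  exact congrArg ((1 / 2 : ℝ) • ·) this

end Splitting

end

section

open ListForm SmoothFn

/-! ### Flat frames on charts of a manifold -/

variable {V : Type*} [NormedAddCommGroup V] [NormedSpace ℝ V] [FiniteDimensional ℝ V]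
  {Y : Type*} [TopologicalSpace Y] [ChartedSpace V Y] [IsManifold 𝓘(ℝ, V) ∞ Y]

namespace Splitting

variable {om : PreSymplecticForm V Y} {S : Splitting om} {κ : Type*} [Fintype κ]
  (b : Module.Basis κ ℝ V) {x : Y}

theorem exists_basis_G {u : V} (hu : u ∈ (extChartAt 𝓘(ℝ, V) x).target) {m : ℕ} {e : Fin m → V}
    {ε : Fin m → V →L[ℝ] ℝ} (hPe : ∀ a, S.Pc x u (e a) = 0)
    (hεe : ∀ a c, ε a (e c) = if a = c then 1 else 0)
    (hdec : ∀ v, S.Pc x u v + ∑ a, ε a v • e a = v) :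
    ∃ f : Module.Basis (Fin m) ℝ (S.G ((extChartAt 𝓘(ℝ, V) x).symm u)),
      ∀ a, (f a : Tan V ((extChartAt 𝓘(ℝ, V) x).symm u)) = chartD x u (e a) := by
  let g : Fin m → S.G ((extChartAt 𝓘(ℝ, V) x).symm u) := fun a =>
    ⟨chartD x u (e a), (chartD_Pc hu (e a)).symm.trans
      ((congrArg (chartD x u) (hPe a)).trans (map_zero _))⟩
  have hsum : ∀ c : Fin m → ℝ, ((∑ a, c a • g a : S.G ((extChartAt 𝓘(ℝ, V) x).symm u)) :
      Tan V ((extChartAt 𝓘(ℝ, V) x).symm u)) = chartD x u (∑ a, c a • e a) := fun c => by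
    rw [map_sum, Submodule.coe_sum]
    exact Finset.sum_congr rfl fun a _ => (map_smul (chartD x u) (c a) (e a)).symm
  refine ⟨Module.Basis.mk (v := g) (Fintype.linearIndependent_iff.2 fun c hc a => ?_)
    fun v _ => ?_, fun a => by rw [Module.Basis.mk_apply]⟩
  · have h1 : chartD x u (∑ a, c a • e a) = chartD x u 0 :=
      (hsum c).symm.trans ((congrArg Subtype.val hc).trans (map_zero _).symm)
    have h2 := congrArg (ε a) (chartD_injective hu h1)
    rw [map_sum, map_zero] at h2
    simpa [hεe] using h2
  · have h1 : S.Pc x u (chartE x _ v.1) = 0 := by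
      refine chartD_injective hu ((chartD_Pc hu _).trans ?_)
      rw [chartD_chartE hu, map_zero]
      exact v.2
    have h2 := hdec (chartE x _ v.1)
    rw [h1, zero_add] at h2
    have h3 : v = ∑ a, ε a (chartE x _ v.1) • g a :=
      Subtype.ext ((hsum _).trans ((congrArg (chartD x u) h2).trans (chartD_chartE hu v.1))).symm
    rw [h3]
    exact Submodule.sum_mem _ fun a _ => Submodule.smul_mem _ _ (Submodule.subset_span ⟨a, rfl⟩)

variable (S x) in
/-- `F` is the expression of the leafwise form `ξ` on the subset `U` of the chart at `x`. -/
def Represents {U : TopologicalSpace.Opens V} {j : ℕ} (F : ListForm κ (SmoothFn U))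
    (ξ : LeafField om j) : Prop :=
  ∀ u : U, map (ev u) F = S.leafComp b x u ξ

section

variable {b} {U : TopologicalSpace.Opens V} {i j : ℕ} {ξ : LeafField om i} {ζ : LeafField om j}
  {F G : ListForm κ (SmoothFn U)}

theorem Represents.add {ξ' : LeafField om i} {F' : ListForm κ (SmoothFn U)}
    (h : S.Represents b x F ξ) (h' : S.Represents b x F' ξ') :
    S.Represents b x (F + F') (ξ + ξ') := fun u => by
  rw [map_add', h u, h' u, leafComp_add]

theorem Represents.smul (h : S.Represents b x F ξ) (r : ℝ) :
    S.Represents b x (algebraMap ℝ (SmoothFn U) r • F) (r • ξ) := fun u => by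
  rw [map_smul', h u, leafComp_smul]
  rfl

theorem Represents.isHomogeneous (h : S.Represents b x F ξ) : IsHomogeneous i F := fun l hl =>
  smoothFn_ext_ev fun u => (congrFun (h u) l).trans
    ((isHomogeneous_components _ _ l hl).trans (map_zero (ev u)).symm)

theorem Represents.isAlt (h : S.Represents b x F ξ) : IsAlt F := fun l₁ k k' l₂ =>
  smoothFn_ext_ev fun u => by
    rw [map_neg]
    exact (congrFun (h u) _).trans ((isAlt_components _ _ l₁ k k' l₂).trans
      (congrArg Neg.neg (congrFun (h u) _).symm))

theorem Represents.eq_locForm (h : S.Represents b x F ξ)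
    (hη : ∀ u ∈ U, ContDiffAt ℝ ∞ ((S.extend ξ).inChart x) u) :
    F = locForm b ((S.extend ξ).inChart x) hη :=
  listForm_ext_ev fun u => by rw [map_ev_locForm, components_extend, h u]

end

theorem exists_represents {U : TopologicalSpace.Opens V}
    (hU : ∀ u ∈ U, u ∈ (extChartAt 𝓘(ℝ, V) x).target) {j : ℕ} {ξ : LeafField om j}
    (hξ : ξ ∈ leafwiseForms om j) : ∃ F : ListForm κ (SmoothFn U), S.Represents b x F ξ :=
  ⟨locForm b ((S.extend ξ).inChart x) fun u hu => (isSmooth_extend hξ).contDiffAt_inChart (hU u hu),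
    fun u => by rw [map_ev_locForm, components_extend]⟩

section

variable {b} [DecidableEq κ] {U : TopologicalSpace.Opens V}
  {m : ℕ} {T : FlatFrame (fun k => pd (U := U) (b k)) (Fin m)} {e : Fin m → V → V}

theorem Represents.hor (hU : ∀ u ∈ U, u ∈ (extChartAt 𝓘(ℝ, V) x).target)
    (hTe : ∀ a k (u : U), (T.e a k).1 u = b.repr (e a u) k)
    (hPe : ∀ u ∈ U, ∀ a, S.Pc x u (e a u) = 0) {j : ℕ} {ξ : LeafField om j}
    {F : ListForm κ (SmoothFn U)} (h : S.Represents b x F ξ) : T.Hor F := by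
  refine ⟨h.isAlt, fun a => listForm_ext_ev fun u => ?_⟩
  rw [map_iota, h u]
  have h0 : ∑ k, (T.e a k).1 u • S.leafMap x (u : V) (b k) = 0 := by
    have h1 : ∑ k, (T.e a k).1 u • S.leafMap x (u : V) (b k) = S.leafMap x (u : V) (e a u) := by
      conv_rhs => rw [← b.sum_repr (e a u), map_sum]
      exact Finset.sum_congr rfl fun k _ => by rw [hTe, map_smul]
    rw [h1]
    exact Subtype.ext ((chartD_Pc (hU u u.2) (e a u)).symm.trans
      ((congrArg (chartD x (u : V)) (hPe u u.2 a)).trans (map_zero _)))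
  refine (iota_components_eq_zero _ _ _ h0).trans ?_
  ext l
  exact (map_zero (ev u)).symm

theorem map_ev_pull (hTP : ∀ k j (u : U), (T.P k j).1 u = b.repr (S.Pc x (u : V) (b k)) j)
    (F : ListForm κ (SmoothFn U)) (u : U) {n : ℕ} {a : V [⋀^Fin n]→ₗ[ℝ] ℝ}
    (h : map (ev u) F = components b a) : map (ev u) (pull T.P F) =
      components b (a.compLinearMap (S.Pc x (u : V)).toLinearMap) := by
  rw [map_pull, h, ← pull_components]
  congr 2
  funext k j
  exact hTP k j u

theorem Represents.dF (hU : ∀ u ∈ U, u ∈ (extChartAt 𝓘(ℝ, V) x).target)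
    (hTP : ∀ k j (u : U), (T.P k j).1 u = b.repr (S.Pc x (u : V) (b k)) j)
    {j : ℕ} {ξ : LeafField om j} (hξ : ξ ∈ leafwiseForms om j)
    {F : ListForm κ (SmoothFn U)} (h : S.Represents b x F ξ) (hF : T.Hor F) :
    S.Represents b x (T.dF F) (S.leafD j ξ) := fun u => by
  have hη : ∀ u ∈ U, ContDiffAt ℝ ∞ ((S.extend ξ).inChart x) u := fun u hu =>
    (isSmooth_extend hξ).contDiffAt_inChart (hU u hu)
  rw [← hF.pull_d, leafComp_leafD b (hU u u.2) hξ]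
  refine map_ev_pull hTP _ u ?_
  rw [h.eq_locForm hη, d_locForm, map_ev_locForm]

/-- `L a F` is horizontal, hence equal to its own pull-back, and it is the contraction of `d F` with
the frame. This is the chart expression of `nabla`: insertion of the frame vector, then restriction
to the leaf. -/
theorem Represents.map_ev_L (hU : ∀ u ∈ U, u ∈ (extChartAt 𝓘(ℝ, V) x).target)
    (hTP : ∀ k j (u : U), (T.P k j).1 u = b.repr (S.Pc x (u : V) (b k)) j)
    (hTe : ∀ a k (u : U), (T.e a k).1 u = b.repr (e a u) k)
    {j : ℕ} {ξ : LeafField om j} (hξ : ξ ∈ leafwiseForms om j)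
    {F : ListForm κ (SmoothFn U)} (h : S.Represents b x F ξ) (hF : T.Hor F) (a : Fin m) (u : U)
    (g : S.G ((extChartAt 𝓘(ℝ, V) x).symm (u : V)))
    (hg : (g : Tan V ((extChartAt 𝓘(ℝ, V) x).symm (u : V))) = chartD x (u : V) (e a u)) :
    map (ev u) (T.L a F) = components (fun k => S.leafMap x (u : V) (b k)) (S.nabla ξ _ g) := by
  have hη : ∀ u ∈ U, ContDiffAt ℝ ∞ ((S.extend ξ).inChart x) u := fun u hu =>
    (isSmooth_extend hξ).contDiffAt_inChart (hU u hu)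
  rw [← (hF.L a).pull_eq, components_nabla b (hU u u.2) hξ (e a u) g hg, ← hF.iota_d]
  refine map_ev_pull hTP _ u ?_
  rw [map_iota, h.eq_locForm hη, d_locForm, map_ev_locForm, ← iota_components]
  congr 2
  funext k
  exact hTe a k u

theorem Represents.brk (hU : ∀ u ∈ U, u ∈ (extChartAt 𝓘(ℝ, V) x).target)
    (hTP : ∀ k j (u : U), (T.P k j).1 u = b.repr (S.Pc x (u : V) (b k)) j)
    (hTe : ∀ a k (u : U), (T.e a k).1 u = b.repr (e a u) k)
    (hTW : ∀ (u : U) a c, (T.W a c).1 u =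
      (Matrix.of fun a c => om.form.inChart x u ![e a u, e c u])⁻¹ a c)
    (hPe : ∀ u ∈ U, ∀ a, S.Pc x u (e a u) = 0) {ε : Fin m → V → V →L[ℝ] ℝ}
    (hεe : ∀ u ∈ U, ∀ a c, ε a u (e c u) = if a = c then 1 else 0)
    (hdec : ∀ u ∈ U, ∀ v, S.Pc x u v + ∑ a, ε a u v • e a u = v)
    {i j : ℕ} {ξ : LeafField om i} {ζ : LeafField om j} (hξ : ξ ∈ leafwiseForms om i)
    (hζ : ζ ∈ leafwiseForms om j) {F G : ListForm κ (SmoothFn U)} (h : S.Represents b x F ξ)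
    (h' : S.Represents b x G ζ) (hF : T.Hor F) (hG : T.Hor G) :
    S.Represents b x (algebraMap ℝ (SmoothFn U) (1 / 2) • T.brk F G) (S.bracket i j ξ ζ) :=
    fun u => by
  obtain ⟨f, hf⟩ := exists_basis_G (hU u u.2) (hPe u u.2) (hεe u u.2) (hdec u u.2)
  have hM : S.omegaMatrix _ f = Matrix.of fun a c => om.form.inChart x u ![e a u, e c u] := by
    ext a c
    refine congrArg (om.form _) (funext fun i => ?_)
    fin_cases i
    · exact hf a
    · exact hf c
  have hdet : (S.omegaMatrix _ f).det ≠ 0 := by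
    rw [hM]
    exact det_form_two_ne_zero (kernel_inChart (hU u u.2)) (Pc_Pc (hU u u.2)) (hdec u u.2)
      (hPe u u.2) (hεe u u.2)
  rw [map_smul', leafComp, bracket_eq f hdet, components_smul, components_sum]
  congr 1
  rw [FlatFrame.brk, map_sum']
  refine Finset.sum_congr rfl fun a _ => ?_
  rw [map_sum', components_sum]
  refine Finset.sum_congr rfl fun c _ => ?_
  rw [map_smul', ListForm.map_mul, components_smul, components_wedge,
    h.map_ev_L hU hTP hTe hξ hF a u (f a) (hf a), h'.map_ev_L hU hTP hTe hζ hG c u (f c) (hf c), hM]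
  congr 1
  exact hTW u a c

end

/-- Around every point, the leafwise forms with their operations are given by a flat frame. -/
theorem exists_local_flatFrame [DecidableEq κ] (hS : S.IsFlat) (x : Y) :
    ∃ (U : TopologicalSpace.Opens V) (m : ℕ) (T : FlatFrame (fun k => pd (U := U) (b k)) (Fin m)),
      extChartAt 𝓘(ℝ, V) x x ∈ U ∧ (∀ u ∈ U, u ∈ (extChartAt 𝓘(ℝ, V) x).target) ∧
      (∀ {j : ℕ} {ξ : LeafField om j} {F : ListForm κ (SmoothFn U)},
        S.Represents b x F ξ → T.Hor F) ∧
      (∀ {j : ℕ} {ξ : LeafField om j} {F : ListForm κ (SmoothFn U)}, ξ ∈ leafwiseForms om j →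
        S.Represents b x F ξ → S.Represents b x (T.dF F) (S.leafD j ξ)) ∧
      ∀ {i j : ℕ} {ξ : LeafField om i} {ζ : LeafField om j} {F G : ListForm κ (SmoothFn U)},
        ξ ∈ leafwiseForms om i → ζ ∈ leafwiseForms om j → S.Represents b x F ξ →
        S.Represents b x G ζ →
        S.Represents b x (algebraMap ℝ (SmoothFn U) (1 / 2) • T.brk F G) (S.bracket i j ξ ζ) := by
  have hPP : ∀ u ∈ (extChartAt 𝓘(ℝ, V) x).target, S.Pc x u * S.Pc x u = S.Pc x u := fun u hu =>
    ContinuousLinearMap.ext fun v => Pc_Pc hu v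
  have hflat : ∀ u ∈ (extChartAt 𝓘(ℝ, V) x).target, ∀ X Z : V → V, ContDiffAt ℝ ∞ X u →
      ContDiffAt ℝ ∞ Z u → (∀ᶠ z in 𝓝 u, S.Pc x z (X z) = 0) →
      (∀ᶠ z in 𝓝 u, S.Pc x z (Z z) = 0) → S.Pc x u (VectorField.lieBracket ℝ X Z u) = 0 :=
    fun u hu X Z hX hZ hPX hPZ => flat_inChart hS hu hX hZ hPX hPZ
  have ho : IsOpen (extChartAt 𝓘(ℝ, V) x).target := isOpen_extChartAt_target x
  have hmem : extChartAt 𝓘(ℝ, V) x x ∈ (extChartAt 𝓘(ℝ, V) x).target := mem_extChartAt_target x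
  obtain ⟨U, hUo, hx, hU, m, e, ε, he, hε, hPe, hεe, hdec, hcomm⟩ :=
    exists_commuting_frame ho hmem contDiffOn_Pc hPP hflat
  obtain ⟨T, hTe, hTP, hTW⟩ := exists_flatFrame (U := ⟨U, hUo⟩) b (om := om.form.inChart x)
    (P := S.Pc x) (fun u hu => om.smooth.contDiffAt_inChart (hU hu)) (contDiffOn_Pc.mono hU)
    (fun u hu => by
      rw [← inChart_d om.smooth (hU hu), om.closed]
      rfl)
    (fun u hu => Pc_Pc (hU hu)) (fun u hu => kernel_inChart (hU hu)) he hε hPe hεe hdec hcomm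
  have hU' : ∀ u ∈ (⟨U, hUo⟩ : TopologicalSpace.Opens V), u ∈ (extChartAt 𝓘(ℝ, V) x).target :=
    fun u hu => hU hu
  have hor : ∀ {j : ℕ} {ξ : LeafField om j} {F : ListForm κ (SmoothFn ⟨U, hUo⟩)},
      S.Represents b x F ξ → T.Hor F := fun h => h.hor hU' hTe hPe
  exact ⟨⟨U, hUo⟩, m, T, hx, hU', hor, fun hξ h => h.dF hU' hTP hξ (hor h),
    fun hξ hζ h h' => h.brk hU' hTP hTe hTW hPe hεe hdec hξ hζ h' (hor h) (hor h')⟩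

/-- Having smooth components in a chart is enough for smoothness of the extension; this is how the
bracket is seen to be a smooth leafwise form. -/
theorem Represents.smooth {U : TopologicalSpace.Opens V} {j : ℕ} {ξ : LeafField om j}
    {F : ListForm κ (SmoothFn U)} (h : S.Represents b x F ξ) {u : V} (hu : u ∈ U) :
    ContDiffAt ℝ ∞ ((S.extend ξ).inChart x) u := by
  refine contDiffAt_of_components b fun r =>
    (contDiffAt_extension (F (List.ofFn r)) hu).congr_of_eventuallyEq ?_
  filter_upwards [U.2.mem_nhds hu] with z hz
  rw [extension_apply _ hz]
  have h1 := congrFun (h ⟨z, hz⟩) (List.ofFn r)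
  rw [← components_extend, components_ofFn] at h1
  exact h1.symm

end Splitting

end

section

open ListForm SmoothFn

/-! ### The differential graded Lie algebra of leafwise forms -/

variable {V : Type*} [NormedAddCommGroup V] [NormedSpace ℝ V] [FiniteDimensional ℝ V]
  {Y : Type*} [TopologicalSpace Y] [ChartedSpace V Y] [IsManifold 𝓘(ℝ, V) ∞ Y]

namespace Splitting

variable {om : PreSymplecticForm V Y} {S : Splitting om}

theorem Represents.leafComp_eq {κ : Type*} [Fintype κ] {b : Module.Basis κ ℝ V} {x : Y}
    {U : TopologicalSpace.Opens V} {j : ℕ} {ξ : LeafField om j} {F : ListForm κ (SmoothFn U)}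
    (h : S.Represents b x F ξ) {u : V} (hu : u ∈ U) : S.leafComp b x u ξ = map (ev ⟨u, hu⟩) F :=
  (h ⟨u, hu⟩).symm

theorem map_ev_neg_one_pow_smul {κ : Type*} {U : TopologicalSpace.Opens V} (u : U) (n : ℕ)
    (F : ListForm κ (SmoothFn U)) :
    map (ev u) ((-1 : SmoothFn U) ^ n • F) = (-1 : ℝ) ^ n • map (ev u) F := by
  rw [map_smul', map_pow, map_neg, map_one]

theorem bracket_mem (hS : S.IsFlat) {i j : ℕ} {ξ : LeafField om i} {ζ : LeafField om j}
    (hξ : ξ ∈ leafwiseForms om i) (hζ : ζ ∈ leafwiseForms om j) :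
    S.bracket i j ξ ζ ∈ leafwiseForms om (i + j) := by
  refine ⟨S.extend (S.bracket i j ξ ζ), (isSmooth_iff _).2 fun x => ?_, S.toLeaf_extend _⟩
  obtain ⟨U, m, T, hx, hU, -, -, hbr⟩ := exists_local_flatFrame (Module.finBasis ℝ V) hS x
  obtain ⟨F, hF⟩ := exists_represents (S := S) (Module.finBasis ℝ V) hU hξ
  obtain ⟨G, hG⟩ := exists_represents (S := S) (Module.finBasis ℝ V) hU hζ
  exact (hbr hξ hζ hF hG).smooth _ hx

theorem leafD_add (hS : S.IsFlat) {j : ℕ} {ξ ζ : LeafField om j}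
    (hξ : ξ ∈ leafwiseForms om j) (hζ : ζ ∈ leafwiseForms om j) :
    S.leafD j (ξ + ζ) = S.leafD j ξ + S.leafD j ζ := by
  refine leafField_ext (S := S) (Module.finBasis ℝ V) fun x => ?_
  obtain ⟨U, m, T, hx, hU, -, hd, -⟩ := exists_local_flatFrame (Module.finBasis ℝ V) hS x
  obtain ⟨F, hF⟩ := exists_represents (S := S) (Module.finBasis ℝ V) hU hξ
  obtain ⟨G, hG⟩ := exists_represents (S := S) (Module.finBasis ℝ V) hU hζ
  rw [(hd (Submodule.add_mem _ hξ hζ) (hF.add hG)).leafComp_eq hx,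
    ((hd hξ hF).add (hd hζ hG)).leafComp_eq hx, T.dF_add]

theorem leafD_smul (hS : S.IsFlat) {j : ℕ} (r : ℝ) {ξ : LeafField om j}
    (hξ : ξ ∈ leafwiseForms om j) : S.leafD j (r • ξ) = r • S.leafD j ξ := by
  refine leafField_ext (S := S) (Module.finBasis ℝ V) fun x => ?_
  obtain ⟨U, m, T, hx, hU, -, hd, -⟩ := exists_local_flatFrame (Module.finBasis ℝ V) hS x
  obtain ⟨F, hF⟩ := exists_represents (S := S) (Module.finBasis ℝ V) hU hξ
  rw [(hd (Submodule.smul_mem _ r hξ) (hF.smul r)).leafComp_eq hx,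
    ((hd hξ hF).smul r).leafComp_eq hx, T.dF_smul_algebraMap]

theorem leafD_leafD (hS : S.IsFlat) {j : ℕ} {ξ : LeafField om j} (hξ : ξ ∈ leafwiseForms om j) :
    S.leafD (j + 1) (S.leafD j ξ) = 0 := by
  refine leafField_eq_zero (S := S) (Module.finBasis ℝ V) fun x => ?_
  obtain ⟨U, m, T, hx, hU, hor, hd, -⟩ := exists_local_flatFrame (Module.finBasis ℝ V) hS x
  obtain ⟨F, hF⟩ := exists_represents (S := S) (Module.finBasis ℝ V) hU hξ
  rw [(hd (leafD_mem hξ) (hd hξ hF)).leafComp_eq hx, T.dF_dF (hor hF)]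
  ext l
  exact map_zero (ev _)

theorem bracket_add_left (hS : S.IsFlat) {i j : ℕ} {ξ ξ' : LeafField om i} {ζ : LeafField om j}
    (hξ : ξ ∈ leafwiseForms om i) (hξ' : ξ' ∈ leafwiseForms om i) (hζ : ζ ∈ leafwiseForms om j) :
    S.bracket i j (ξ + ξ') ζ = S.bracket i j ξ ζ + S.bracket i j ξ' ζ := by
  refine leafField_ext (S := S) (Module.finBasis ℝ V) fun x => ?_
  obtain ⟨U, m, T, hx, hU, -, -, hbr⟩ := exists_local_flatFrame (Module.finBasis ℝ V) hS x
  obtain ⟨F, hF⟩ := exists_represents (S := S) (Module.finBasis ℝ V) hU hξ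
  obtain ⟨F', hF'⟩ := exists_represents (S := S) (Module.finBasis ℝ V) hU hξ'
  obtain ⟨G, hG⟩ := exists_represents (S := S) (Module.finBasis ℝ V) hU hζ
  rw [(hbr (Submodule.add_mem _ hξ hξ') hζ (hF.add hF') hG).leafComp_eq hx,
    ((hbr hξ hζ hF hG).add (hbr hξ' hζ hF' hG)).leafComp_eq hx, T.brk_add_left, smul_add]

theorem bracket_add_right (hS : S.IsFlat) {i j : ℕ} {ξ : LeafField om i} {ζ ζ' : LeafField om j}
    (hξ : ξ ∈ leafwiseForms om i) (hζ : ζ ∈ leafwiseForms om j) (hζ' : ζ' ∈ leafwiseForms om j) :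
    S.bracket i j ξ (ζ + ζ') = S.bracket i j ξ ζ + S.bracket i j ξ ζ' := by
  refine leafField_ext (S := S) (Module.finBasis ℝ V) fun x => ?_
  obtain ⟨U, m, T, hx, hU, -, -, hbr⟩ := exists_local_flatFrame (Module.finBasis ℝ V) hS x
  obtain ⟨F, hF⟩ := exists_represents (S := S) (Module.finBasis ℝ V) hU hξ
  obtain ⟨G, hG⟩ := exists_represents (S := S) (Module.finBasis ℝ V) hU hζ
  obtain ⟨G', hG'⟩ := exists_represents (S := S) (Module.finBasis ℝ V) hU hζ'
  rw [(hbr hξ (Submodule.add_mem _ hζ hζ') hF (hG.add hG')).leafComp_eq hx,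
    ((hbr hξ hζ hF hG).add (hbr hξ hζ' hF hG')).leafComp_eq hx, T.brk_add_right, smul_add]

theorem bracket_smul_left (hS : S.IsFlat) {i j : ℕ} (r : ℝ) {ξ : LeafField om i}
    {ζ : LeafField om j} (hξ : ξ ∈ leafwiseForms om i) (hζ : ζ ∈ leafwiseForms om j) :
    S.bracket i j (r • ξ) ζ = r • S.bracket i j ξ ζ := by
  refine leafField_ext (S := S) (Module.finBasis ℝ V) fun x => ?_
  obtain ⟨U, m, T, hx, hU, -, -, hbr⟩ := exists_local_flatFrame (Module.finBasis ℝ V) hS x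
  obtain ⟨F, hF⟩ := exists_represents (S := S) (Module.finBasis ℝ V) hU hξ
  obtain ⟨G, hG⟩ := exists_represents (S := S) (Module.finBasis ℝ V) hU hζ
  rw [(hbr (Submodule.smul_mem _ r hξ) hζ (hF.smul r) hG).leafComp_eq hx,
    ((hbr hξ hζ hF hG).smul r).leafComp_eq hx, T.brk_smul_left, smul_comm]

theorem bracket_smul_right (hS : S.IsFlat) {i j : ℕ} (r : ℝ) {ξ : LeafField om i}
    {ζ : LeafField om j} (hξ : ξ ∈ leafwiseForms om i) (hζ : ζ ∈ leafwiseForms om j) :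
    S.bracket i j ξ (r • ζ) = r • S.bracket i j ξ ζ := by
  refine leafField_ext (S := S) (Module.finBasis ℝ V) fun x => ?_
  obtain ⟨U, m, T, hx, hU, -, -, hbr⟩ := exists_local_flatFrame (Module.finBasis ℝ V) hS x
  obtain ⟨F, hF⟩ := exists_represents (S := S) (Module.finBasis ℝ V) hU hξ
  obtain ⟨G, hG⟩ := exists_represents (S := S) (Module.finBasis ℝ V) hU hζ
  rw [(hbr hξ (Submodule.smul_mem _ r hζ) hF (hG.smul r)).leafComp_eq hx,
    ((hbr hξ hζ hF hG).smul r).leafComp_eq hx, T.brk_smul_right, smul_comm]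

theorem bracket_symm (hS : S.IsFlat) {i j : ℕ} {ξ : LeafField om i} {ζ : LeafField om j}
    (hξ : ξ ∈ leafwiseForms om i) (hζ : ζ ∈ leafwiseForms om j) :
    DirectSum.of (fun j => LeafField om j) (i + j) (S.bracket i j ξ ζ) =
      -((-1 : ℝ) ^ (i * j) •
        DirectSum.of (fun j => LeafField om j) (j + i) (S.bracket j i ζ ξ)) := by
  refine directSum_ext (S := S) (Module.finBasis ℝ V) fun x => ?_
  obtain ⟨U, m, T, hx, hU, -, -, hbr⟩ := exists_local_flatFrame (Module.finBasis ℝ V) hS x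
  obtain ⟨F, hF⟩ := exists_represents (S := S) (Module.finBasis ℝ V) hU hξ
  obtain ⟨G, hG⟩ := exists_represents (S := S) (Module.finBasis ℝ V) hU hζ
  rw [map_neg, map_smul, mixedComp_of, mixedComp_of, (hbr hξ hζ hF hG).leafComp_eq hx,
    (hbr hζ hξ hG hF).leafComp_eq hx,
    T.brk_symm hF.isHomogeneous.grade_eq hG.isHomogeneous.grade_eq, ← map_ev_neg_one_pow_smul,
    smul_comm ((-1 : SmoothFn U) ^ (i * j)), smul_neg]
  ext l
  exact map_neg (ev _) _

theorem bracket_jacobi (hS : S.IsFlat) {i j k : ℕ} {ξ : LeafField om i} {ζ : LeafField om j}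
    {ρ : LeafField om k} (hξ : ξ ∈ leafwiseForms om i) (hζ : ζ ∈ leafwiseForms om j)
    (hρ : ρ ∈ leafwiseForms om k) :
    DirectSum.of (fun j => LeafField om j) (i + (j + k))
        (S.bracket i (j + k) ξ (S.bracket j k ζ ρ)) =
      DirectSum.of (fun j => LeafField om j) (i + j + k)
          (S.bracket (i + j) k (S.bracket i j ξ ζ) ρ) +
        (-1 : ℝ) ^ (i * j) • DirectSum.of (fun j => LeafField om j) (j + (i + k))
          (S.bracket j (i + k) ζ (S.bracket i k ξ ρ)) := by
  refine directSum_ext (S := S) (Module.finBasis ℝ V) fun x => ?_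
  obtain ⟨U, m, T, hx, hU, hor, -, hbr⟩ := exists_local_flatFrame (Module.finBasis ℝ V) hS x
  obtain ⟨F, hF⟩ := exists_represents (S := S) (Module.finBasis ℝ V) hU hξ
  obtain ⟨G, hG⟩ := exists_represents (S := S) (Module.finBasis ℝ V) hU hζ
  obtain ⟨H, hH⟩ := exists_represents (S := S) (Module.finBasis ℝ V) hU hρ
  rw [map_add, map_smul, mixedComp_of, mixedComp_of, mixedComp_of,
    (hbr hξ (bracket_mem hS hζ hρ) hF (hbr hζ hρ hG hH)).leafComp_eq hx,
    (hbr (bracket_mem hS hξ hζ) hρ (hbr hξ hζ hF hG) hH).leafComp_eq hx,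
    (hbr hζ (bracket_mem hS hξ hρ) hG (hbr hξ hρ hF hH)).leafComp_eq hx,
    ← map_ev_neg_one_pow_smul, ← map_add', T.brk_smul_right, T.brk_smul_left, T.brk_smul_right,
    T.jacobi_brk (hor hF) (hor hG) (hor hH) hF.isHomogeneous.grade_eq hG.isHomogeneous.grade_eq,
    smul_add, smul_add, smul_comm ((-1 : SmoothFn U) ^ (i * j)),
    smul_comm ((-1 : SmoothFn U) ^ (i * j))]

theorem leafD_bracket (hS : S.IsFlat) {i j : ℕ} {ξ : LeafField om i} {ζ : LeafField om j}
    (hξ : ξ ∈ leafwiseForms om i) (hζ : ζ ∈ leafwiseForms om j) :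
    DirectSum.of (fun j => LeafField om j) (i + j + 1) (S.leafD (i + j) (S.bracket i j ξ ζ)) =
      DirectSum.of (fun j => LeafField om j) (i + 1 + j) (S.bracket (i + 1) j (S.leafD i ξ) ζ) +
        (-1 : ℝ) ^ i • DirectSum.of (fun j => LeafField om j) (i + (j + 1))
          (S.bracket i (j + 1) ξ (S.leafD j ζ)) := by
  refine directSum_ext (S := S) (Module.finBasis ℝ V) fun x => ?_
  obtain ⟨U, m, T, hx, hU, hor, hd, hbr⟩ := exists_local_flatFrame (Module.finBasis ℝ V) hS x
  obtain ⟨F, hF⟩ := exists_represents (S := S) (Module.finBasis ℝ V) hU hξ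
  obtain ⟨G, hG⟩ := exists_represents (S := S) (Module.finBasis ℝ V) hU hζ
  have hsign : (-1 : SmoothFn U) ^ i = algebraMap ℝ (SmoothFn U) ((-1) ^ i) := by
    rw [map_pow, map_neg, map_one]
  rw [map_add, map_smul, mixedComp_of, mixedComp_of, mixedComp_of,
    (hd (bracket_mem hS hξ hζ) (hbr hξ hζ hF hG)).leafComp_eq hx,
    (hbr (leafD_mem hξ) hζ (hd hξ hF) hG).leafComp_eq hx,
    (hbr hξ (leafD_mem hζ) hF (hd hζ hG)).leafComp_eq hx,
    ← map_ev_neg_one_pow_smul, ← map_add', T.dF_smul_algebraMap, T.dF_brk (hor hF) (hor hG),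
    hF.isHomogeneous.grade_eq, hsign, T.brk_smul_left, smul_add, smul_comm (algebraMap ℝ _ (1 / 2))]

end Splitting

end

end PreSymp

end

theorem mainTheorem10 {V : Type*} [NormedAddCommGroup V] [NormedSpace ℝ V] [FiniteDimensional ℝ V]
    {Y : Type*} [TopologicalSpace Y] [ChartedSpace V Y] [IsManifold 𝓘(ℝ, V) ∞ Y]
    (om : PreSymp.PreSymplecticForm V Y) (S : PreSymp.Splitting om) (hS : S.IsFlat) :
    PreSymp.IsDGLieAlgebra (fun j => PreSymp.leafwiseForms om j) S.leafD S.bracket where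
  d_mem _ _ ha := PreSymp.Splitting.leafD_mem ha
  d_add _ _ ha _ hb := PreSymp.Splitting.leafD_add hS ha hb
  d_smul _ r _ ha := PreSymp.Splitting.leafD_smul hS r ha
  d_d _ _ ha := PreSymp.Splitting.leafD_leafD hS ha
  br_mem _ _ _ ha _ hb := PreSymp.Splitting.bracket_mem hS ha hb
  br_add_left _ _ _ ha _ ha' _ hb := PreSymp.Splitting.bracket_add_left hS ha ha' hb
  br_add_right _ _ _ ha _ hb _ hb' := PreSymp.Splitting.bracket_add_right hS ha hb hb'
  br_smul_left _ _ r _ ha _ hb := PreSymp.Splitting.bracket_smul_left hS r ha hb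
  br_smul_right _ _ r _ ha _ hb := PreSymp.Splitting.bracket_smul_right hS r ha hb
  br_symm _ _ _ ha _ hb := PreSymp.Splitting.bracket_symm hS ha hb
  jacobi _ _ _ _ ha _ hb _ hc := PreSymp.Splitting.bracket_jacobi hS ha hb hc
  leibniz _ _ _ ha _ hb := PreSymp.Splitting.leafD_bracket hS ha hb
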